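/- **Theorem.** Identify a line through the origin with a one-dimensional subspace. A set of lines in $\mathbf{R}^n$ is *equiangular* if the angle between any two distinct lines of the set is the same; it is *maximal* if no equiangular set of lines in $\mathbf{R}^n$ has larger cardinality. Let $\mathcal{B}$ be the block set of a Steiner system $S(4,7,23)$ on the point set $\mathcal{P}=\{1,\dots,23\}$, that is, a set of $7$-subsets (blocks) of $\mathcal{P}$ such that every $4$-subset of $\mathcal{P}$ lies in exactly one block. For $B\in\mathcal{B}$ let $v(B)\in\mathbf{R}^{23}$ have $j$-th entry $16+\sqrt3$ if $j\in B$ and $-7+\sqrt3$ if $j\notin B$; for $i\in\mathcal{P}$ let $v(i)\in\mathbf{R}^{23}$ have $j$-th entry $44-\sqrt{27}$ if $j=i$ and $-2-\sqrt{27}$ if $j\ne i$. Let $\Omega$ be the set of lines spanned by the vectors $v(B)$, $B\in\mathcal{B}$, and $v(i)$, $i\in\mathcal{P}$. Then: 1. $\Omega$ is a maximal set of equiangular lines in $\mathbf{R}^{23}$, and $|\Omega|=276$. 2. For $d=5,6,7$, every maximal set $\Lambda$ of equiangular lines in $\mathbf{R}^d$ appears as a projection onto a subspace of a subset of $\Omega$: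 there are a subset $S\subseteq\Omega$, a subspace $U\subseteq\mathbf{R}^{23}$ and a linear isometry of $\mathbf{R}^d$ onto $U$ that maps $\Lambda$ onto the set of orthogonal projections onto $U$ of the lines of $S$. 3. For $d=15$, there is a maximal set $\Lambda$ of equiangular lines in $\mathbf{R}^{15}$, with $|\Lambda|=36$, that appears as a subset of $\Omega$: some linear isometric embedding $\mathbf{R}^{15}\to\mathbf{R}^{23}$ maps every line of $\Lambda$ to a line of $\Omega$. -/

import Mathlib

/-- A set `Ω` of lines through the origin (one-dimensional subspaces) of a real inner product
space is equiangular: the absolute value of the inner product of unit vectors spanning two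
distinct lines of `Ω` is a constant `κ`, the cosine of the common angle. -/
def IsEquiangular {E : Type*} [NormedAddCommGroup E] [InnerProductSpace ℝ E]
    (Ω : Set (Submodule ℝ E)) : Prop :=
  (∀ l ∈ Ω, Module.finrank ℝ l = 1) ∧
    ∃ κ : ℝ, ∀ l ∈ Ω, ∀ m ∈ Ω, l ≠ m →
      ∀ u ∈ l, ∀ v ∈ m, ‖u‖ = 1 → ‖v‖ = 1 → |inner ℝ u v| = κ

/-- `Ω` is an equiangular set of lines of the largest possible size in its ambient space. -/
def IsMaximumEquiangular {E : Type*} [NormedAddCommGroup E] [InnerProductSpace ℝ E]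
    (Ω : Set (Submodule ℝ E)) : Prop :=
  IsEquiangular Ω ∧ ∀ Ω' : Set (Submodule ℝ E), IsEquiangular Ω' → Ω'.encard ≤ Ω.encard

/-- Up to isometry, the lines of `Λ` form a subset of the lines of `Ω`. -/
def AppearsAsSubset {F E : Type*} [NormedAddCommGroup F] [InnerProductSpace ℝ F]
    [NormedAddCommGroup E] [InnerProductSpace ℝ E]
    (Λ : Set (Submodule ℝ F)) (Ω : Set (Submodule ℝ E)) : Prop :=
  ∃ φ : F →ₗᵢ[ℝ] E, (fun l => l.map φ.toLinearMap) '' Λ ⊆ Ω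

/-- Up to isometry, `Λ` is the set of lines obtained by projecting orthogonally the lines of some
subset `S` of `Ω` onto a subspace `U`. Distinct lines of `S` may have the same projection; no line
of `S` is projected to zero if all members of `Λ` are lines. -/
def AppearsAsProjection {F E : Type*} [NormedAddCommGroup F] [InnerProductSpace ℝ F]
    [NormedAddCommGroup E] [InnerProductSpace ℝ E] [FiniteDimensional ℝ E]
    (Λ : Set (Submodule ℝ F)) (Ω : Set (Submodule ℝ E)) : Prop :=
  ∃ S ⊆ Ω, ∃ U : Submodule ℝ E, ∃ φ : F ≃ₗᵢ[ℝ] U,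
    (fun l => l.map (U.orthogonalProjectionOnto : E →ₗ[ℝ] U)) '' S
      = (fun l => l.map (φ.toLinearEquiv : F →ₗ[ℝ] U)) '' Λ

/-- `𝓑` is the block set of a Steiner system `S(t, k, n)` on the points `Fin n`. -/
def IsSteinerSystem (t k n : ℕ) (𝓑 : Finset (Finset (Fin n))) : Prop :=
  (∀ B ∈ 𝓑, B.card = k) ∧ ∀ T : Finset (Fin n), T.card = t → ∃! B, B ∈ 𝓑 ∧ T ⊆ B

/-- The vector `v(B)` of a block `B` of an `S(4, 7, 23)`. This is a quasi-symmetric design with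
`d = 23`, `k = 7` and block intersection numbers `s₁ = 3`, `s₂ = 1`; the entries are
`d - k + √Δ₁` on `B` and `-k + √Δ₁` off `B`, where `Δ₁ = k ^ 2 - d * (s₁ + s₂) / 2 = 3`. -/
noncomputable def blockVector (B : Finset (Fin 23)) : EuclideanSpace ℝ (Fin 23) :=
  WithLp.toLp 2 fun j => if j ∈ B then 16 + √3 else -7 + √3

/-- The vector `v(i)` of a point `i` of an `S(4, 7, 23)`: the entries are
`(s₁ - s₂) * (d - 1) - √Δ₂` at `i` and `-(s₁ - s₂) - √Δ₂` elsewhere, where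
`Δ₂ = (k - s₁) + d * (s₁ - s₂) / 2 = 27`. -/
noncomputable def pointVector (i : Fin 23) : EuclideanSpace ℝ (Fin 23) :=
  WithLp.toLp 2 fun j => if j = i then 44 - √27 else -2 - √27

/-- The lines of `ℝ²³` spanned by the vectors of the blocks in `𝓑` and of the 23 points. -/
noncomputable def steinerLines (𝓑 : Finset (Finset (Fin 23))) :
    Set (Submodule ℝ (EuclideanSpace ℝ (Fin 23))) :=
  {l | (∃ B ∈ 𝓑, l = Submodule.span ℝ {blockVector B}) ∨
    ∃ i : Fin 23, l = Submodule.span ℝ {pointVector i}}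

/-! Everything rests on upper bounds for equiangular unit vectors in dimension `d`, set against
explicit constructions inside the Steiner system.

For `d = 23` the bound is Gerzon's: the tensors `x ⊗ x` are independent symmetric tensors, so there
are at most `d (d + 1) / 2 = 276` lines. Counting shows that there are 253 blocks and that distinct
blocks meet in 1 or 3 points. The entries of the vectors are tuned so that every squared length is
`5 · 529` and every other inner product is `± 529`. Hence 253 + 23 lines have common cosine `1 / 5`.

Smaller dimensions use the relative bound (`relative_bound`), Neumann's theorem (`exists_int`) and
the pillar method of Lemmens and Seidel. In the latter, a triad `p, q, r` with inner products `-κ`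
is fixed, and the signs of the other vectors are chosen so that at least two of their three products
with it are `κ`; the position of the negative one sorts them into three pillars. A vector `v`
positive on the whole triad makes `p + q + r - v` of squared length `4 - 12 κ`, and two members `v,
w` of one pillar with product `-κ` do the same for `p + q - v - w`. So neither occurs for `κ > 1 /
3`, while at `κ = 1 / 3` these vectors vanish, and the components orthogonal to the triad are either
orthogonal or antipodal within a pillar. This bounds the pillars (`card_le_of_large`,
`card_dichotomy`).

For `d = 5, 6, 7` the maxima are 10, 16, 28, with cosine `1 / 3`, and a set of that size is unique
up to isometry: it contains a basis with prescribed Gram matrix, and a finite check shows that all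
lines at cosine `1 / 3` to that basis are needed to reach the size (`exists_config`). It then
suffices to exhibit one projection of that size. The symmetric difference `O` of two blocks meeting
in three points has eight points, and every pair in `O` is cut out by a block. Projecting these
blocks to the sum-zero vectors on `O`, made constant on a subset `A` when `d < 7`, gives the
required lines.

For `d = 15`, 37 lines would have `κ > 1 / 5` by the relative bound, hence `κ = 1 / 3` by Neumann,
but the pillars allow only 28. For 36 lines inside `Ω`, the complement of a block `B₀` is divided
into eight pairs, any two of which form the trace of a block. These 28 blocks, `B₀` and its seven
points give vectors that are constant on each pair, and such vectors form a space of dimension `7 +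
8 = 15`. -/

open Module

/-- A family of unit vectors whose pairwise inner products are `±κ`. -/
structure IsEquiSystem {ι E : Type*} [NormedAddCommGroup E] [InnerProductSpace ℝ E]
    (x : ι → E) (κ : ℝ) : Prop where
  norm_eq (i : ι) : ‖x i‖ = 1
  abs_inner (i j : ι) (hij : i ≠ j) : |inner ℝ (x i) (x j)| = κ

/-! ### Equiangular vectors and lines; Gerzon's bound and the relative bound. -/

section general

variable {E : Type*} [NormedAddCommGroup E] [InnerProductSpace ℝ E]

lemma inner_self_of_norm_one {u : E} (h : ‖u‖ = 1) : inner ℝ u u = 1 := by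
  rw [real_inner_self_eq_norm_sq, h]; norm_num

lemma IsEquiSystem.comp {ι ι' : Type*} {x : ι → E} {κ : ℝ} (h : IsEquiSystem x κ) (f : ι' → ι)
    (hf : Function.Injective f) : IsEquiSystem (x ∘ f) κ :=
  ⟨fun _ => h.norm_eq _, fun _ _ hij => h.abs_inner _ _ fun he => hij (hf he)⟩

lemma IsEquiSystem.inner_self {ι : Type*} {x : ι → E} {κ : ℝ} (h : IsEquiSystem x κ) (i : ι) :
    inner ℝ (x i) (x i) = 1 := inner_self_of_norm_one (h.norm_eq i)

lemma IsEquiSystem.inner_eq {ι : Type*} {x : ι → E} {κ : ℝ} (h : IsEquiSystem x κ) {i j : ι}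
    (hij : i ≠ j) : inner ℝ (x i) (x j) = κ ∨ inner ℝ (x i) (x j) = -κ := by
  have h1 := h.abs_inner i j hij
  rcases abs_choice (inner ℝ (x i) (x j)) with h2 | h2 <;> rw [h2] at h1
  · exact Or.inl h1
  · right; linarith

lemma span_eq_of_abs_inner_eq_one {u v : E} (hu : ‖u‖ = 1) (hv : ‖v‖ = 1)
    (h : |inner ℝ u v| = 1) : Submodule.span ℝ {u} = Submodule.span ℝ {v} := by
  have h2 : |inner ℝ u v / (‖u‖ * ‖v‖)| = 1 := by rw [hu, hv]; simpa using h
  obtain ⟨-, r, hr, rfl⟩ := (abs_real_inner_div_norm_mul_norm_eq_one_iff u v).1 h2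
  exact (Submodule.span_singleton_smul_eq (IsUnit.mk0 r hr) u).symm

/-- A line contains a unit vector, which spans it. -/
lemma exists_unit_of_finrank_one {l : Submodule ℝ E} (h : finrank ℝ l = 1) :
    ∃ u : E, ‖u‖ = 1 ∧ l = Submodule.span ℝ {u} := by
  obtain ⟨v, hv, hv'⟩ := finrank_eq_one_iff'.1 h
  have hv0 : (v : E) ≠ 0 := by simpa using hv
  have hn : ‖(v : E)‖ ≠ 0 := norm_ne_zero_iff.2 hv0
  refine ⟨(‖(v : E)‖)⁻¹ • (v : E), by rw [norm_smul, norm_inv, norm_norm, inv_mul_cancel₀ hn], ?_⟩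
  rw [Submodule.span_singleton_smul_eq (IsUnit.mk0 _ (inv_ne_zero hn))]
  apply le_antisymm
  · intro w hw
    obtain ⟨c, hc⟩ := hv' ⟨w, hw⟩
    exact Submodule.mem_span_singleton.2 ⟨c, congrArg Subtype.val hc⟩
  · rw [Submodule.span_singleton_le_iff_mem]; exact v.2

lemma unit_mem_span_singleton {u v : E} (hu : ‖u‖ = 1) (hv : ‖v‖ = 1)
    (h : v ∈ Submodule.span ℝ {u}) : v = u ∨ v = -u := by
  obtain ⟨c, rfl⟩ := Submodule.mem_span_singleton.1 h
  rw [norm_smul, hu, mul_one, Real.norm_eq_abs] at hv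
  rcases abs_choice c with h2 | h2 <;> rw [h2] at hv
  · left; rw [hv, one_smul]
  · right; rw [show c = -1 by linarith]; simp

/-- One unit vector is chosen on each line, so that the bounds can be proved for vectors; the choice
of sign is absorbed by the absolute value in `IsEquiSystem`. -/
lemma IsEquiangular.exists_system {Ω : Set (Submodule ℝ E)} (h : IsEquiangular Ω) :
    ∃ (κ : ℝ) (u : Ω → E), 0 ≤ κ ∧ κ < 1 ∧ IsEquiSystem u κ ∧
      ∀ l : Ω, (l : Submodule ℝ E) = Submodule.span ℝ {u l} := by
  obtain ⟨h1, κ, hκ⟩ := h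
  choose u hu hs using fun l : Ω => exists_unit_of_finrank_one (h1 l.1 l.2)
  have hmem : ∀ l : Ω, u l ∈ (l : Submodule ℝ E) := fun l => by
    rw [hs l]; exact Submodule.mem_span_singleton_self _
  by_cases hΩ : ∃ l m : Ω, l ≠ m
  · obtain ⟨l, m, hlm⟩ := hΩ
    have hi : ∀ l m : Ω, l ≠ m → |inner ℝ (u l) (u m)| = κ := fun l m hlm =>
      hκ l.1 l.2 m.1 m.2 (fun he => hlm (Subtype.ext he)) _ (hmem l) _ (hmem m) (hu l) (hu m)
    refine ⟨κ, u, hi l m hlm ▸ abs_nonneg _, ?_, ⟨hu, hi⟩, hs⟩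
    refine lt_of_le_of_ne ?_ ?_
    · rw [← hi l m hlm]
      simpa [hu] using abs_real_inner_le_norm (u l) (u m)
    · intro h1
      refine hlm (Subtype.ext ?_)
      rw [hs l, hs m]
      exact span_eq_of_abs_inner_eq_one (hu l) (hu m) (h1 ▸ hi l m hlm)
  -- With at most one line the condition on the angle is vacuous, and any cosine in `[0, 1)` would
  -- do.
  · refine ⟨0, u, le_rfl, one_pos, ⟨hu, fun l m hlm => absurd ⟨l, m, hlm⟩ hΩ⟩, hs⟩

lemma IsEquiSystem.span_injective {ι : Type*} {x : ι → E} {κ : ℝ} (h : IsEquiSystem x κ)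
    (hκ : κ < 1) : Function.Injective fun i => Submodule.span ℝ {x i} := by
  intro i j hij
  by_contra hne
  have h1 : x j ∈ Submodule.span ℝ {x i} := by
    rw [show Submodule.span ℝ {x i} = Submodule.span ℝ {x j} from hij]
    exact Submodule.mem_span_singleton_self _
  have h2 := h.abs_inner i j hne
  rcases unit_mem_span_singleton (h.norm_eq i) (h.norm_eq j) h1 with h3 | h3 <;>
    rw [h3] at h2 <;> simp [h.norm_eq] at h2 <;> linarith

lemma IsEquiSystem.isEquiangular {ι : Type*} {x : ι → E} {κ : ℝ} (h : IsEquiSystem x κ) :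
    IsEquiangular (Set.range fun i => Submodule.span ℝ {x i}) := by
  refine ⟨?_, κ, ?_⟩
  · rintro _ ⟨i, rfl⟩
    exact finrank_span_singleton (norm_ne_zero_iff.1 (by rw [h.norm_eq i]; exact one_ne_zero))
  · rintro _ ⟨i, rfl⟩ _ ⟨j, rfl⟩ hij u hu v hv hu1 hv1
    have hne : i ≠ j := fun he => hij (by rw [he])
    rw [← h.abs_inner i j hne]
    rcases unit_mem_span_singleton (h.norm_eq i) hu1 hu with rfl | rfl <;>
      rcases unit_mem_span_singleton (h.norm_eq j) hv1 hv with rfl | rfl <;> simp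

/-- A bound on the size of equiangular systems bounds the size of equiangular sets of lines. -/
lemma IsEquiangular.encard_le {Ω : Set (Submodule ℝ E)} (h : IsEquiangular Ω) (n : ℕ)
    (hn : ∀ (κ : ℝ) (x : Fin (n + 1) → E), 0 ≤ κ → κ < 1 → ¬ IsEquiSystem x κ) :
    Ω.encard ≤ n := by
  by_contra hc
  have h1 : ((n + 1 : ℕ) : ℕ∞) ≤ Ω.encard := by
    push_cast; exact Order.add_one_le_of_lt (not_le.1 hc)
  obtain ⟨t, ht, htc⟩ := Set.exists_subset_encard_eq h1
  have hf : t.Finite := Set.finite_of_encard_eq_coe htc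
  have : Fintype t := hf.fintype
  have hcard : Fintype.card t = n + 1 := by
    rw [Set.encard_eq_coe_toFinset_card] at htc
    rw [← Set.toFinset_card]; exact_mod_cast htc
  obtain ⟨κ, u, h0, h1, hs, -⟩ := h.exists_system
  let e := (Fintype.equivFinOfCardEq hcard).symm
  exact hn κ _ h0 h1 (hs.comp (fun i => Set.inclusion ht (e i))
    ((Set.inclusion_injective ht).comp e.injective))

/-- Unit vectors with pairwise inner products all equal to `κ ∈ [0, 1)` are independent. -/
lemma linearIndependent_of_inner_eq {ι : Type*} [Fintype ι] {x : ι → E} {κ : ℝ} (h0 : 0 ≤ κ)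
    (h1 : κ < 1) (hx : ∀ i, ‖x i‖ = 1) (hi : ∀ i j, i ≠ j → inner ℝ (x i) (x j) = κ) :
    LinearIndependent ℝ x := by
  classical
  rw [Fintype.linearIndependent_iff]
  intro c hc
  -- Pair the relation with `x j`. Summing over `j` then gives `(∑ c) (1 - κ + N κ) = 0`, so `∑ c =
  -- 0`.
  have key : ∀ j, c j * (1 - κ) + κ * ∑ i, c i = 0 := by
    intro j
    have h2 : inner ℝ (∑ i, c i • x i) (x j) = 0 := by rw [hc, inner_zero_left]
    rw [sum_inner, ← Finset.add_sum_erase _ _ (Finset.mem_univ j)] at h2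
    have : ∀ i ∈ Finset.univ.erase j, inner ℝ (c i • x i) (x j) = κ * c i := by
      intro i hij
      rw [real_inner_smul_left, hi i j (Finset.ne_of_mem_erase hij)]; ring
    rw [Finset.sum_congr rfl this, ← Finset.mul_sum, real_inner_smul_left,
      inner_self_of_norm_one (hx j)] at h2
    rw [← Finset.add_sum_erase _ _ (Finset.mem_univ j)]
    linarith
  have hsum : ∑ i, c i = 0 := by
    have h5 : (∑ i, c i) * (1 - κ) + Fintype.card ι * (κ * ∑ i, c i) = 0 := by
      rw [Finset.sum_mul, ← nsmul_eq_mul, ← Finset.card_univ, ← Finset.sum_const,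
        ← Finset.sum_add_distrib]
      exact Finset.sum_eq_zero fun j _ => key j
    have h6 : (∑ i, c i) * ((1 - κ) + Fintype.card ι * κ) = 0 := by
      rw [← h5]; ring
    rcases mul_eq_zero.1 h6 with h7 | h7
    · exact h7
    · have : 0 ≤ (Fintype.card ι : ℝ) * κ := by positivity
      linarith
  intro j
  have := key j
  rw [hsum, mul_zero, add_zero] at this
  exact (mul_eq_zero.1 this).resolve_right (by linarith)

variable [FiniteDimensional ℝ E]

/-- Gerzon's bound. -/
lemma IsEquiSystem.card_le_choose {ι : Type*} [Fintype ι] {x : ι → E} {κ : ℝ}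
    (h : IsEquiSystem x κ) (h0 : 0 ≤ κ) (h1 : κ < 1) :
    Fintype.card ι ≤ (finrank ℝ E + 1).choose 2 := by
  classical
  let b := stdOrthonormalBasis ℝ E
  -- The coordinates of `x i ⊗ x i`. They are symmetric in the two indices, which brings the
  -- dimension down to that of `Sym2`, namely `(d + 1).choose 2`.
  let w : ι → Sym2 (Fin (finrank ℝ E)) → ℝ := fun i => Sym2.lift
    ⟨fun s t => inner ℝ (x i) (b s) * inner ℝ (x i) (b t), fun s t => mul_comm _ _⟩
  have hw : LinearIndependent ℝ w := by
    rw [Fintype.linearIndependent_iff]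
    intro c hc
    have key : ∀ j, ∑ i, c i * inner ℝ (x i) (x j) ^ 2 = 0 := by
      intro j
      have h2 : ∀ s t, ∑ i, c i * (inner ℝ (x i) (b s) * inner ℝ (x i) (b t)) = 0 := by
        intro s t
        have := congrFun hc s(s, t)
        simpa [w, Finset.sum_apply] using this
      have h3 : ∀ i, inner ℝ (x i) (x j) ^ 2 = ∑ s, ∑ t, (inner ℝ (x i) (b s) *
          inner ℝ (x i) (b t)) * (inner ℝ (b s) (x j) * inner ℝ (b t) (x j)) := by
        intro i
        rw [sq, ← b.sum_inner_mul_inner (x i) (x j), Finset.sum_mul_sum]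
        refine Finset.sum_congr rfl fun s _ => Finset.sum_congr rfl fun t _ => by ring
      have h4 : ∑ i, c i * inner ℝ (x i) (x j) ^ 2 = ∑ s, ∑ t,
          (∑ i, c i * (inner ℝ (x i) (b s) * inner ℝ (x i) (b t))) *
            (inner ℝ (b s) (x j) * inner ℝ (b t) (x j)) := by
        simp_rw [h3, Finset.mul_sum, Finset.sum_mul]
        rw [Finset.sum_comm]
        refine Finset.sum_congr rfl fun s _ => ?_
        rw [Finset.sum_comm]
        exact Finset.sum_congr rfl fun t _ => Finset.sum_congr rfl fun i _ => by ring
      rw [h4]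
      simp [h2]
    -- The Gram matrix of the tensors has diagonal 1 and constant off-diagonal entry `κ ^ 2`.
    have key2 : ∀ j, c j * (1 - κ ^ 2) + κ ^ 2 * ∑ i, c i = 0 := by
      intro j
      rw [← key j, Finset.mul_sum, ← Finset.add_sum_erase _ _ (Finset.mem_univ j),
        ← Finset.add_sum_erase (a := j) _ (fun i => c i * inner ℝ (x i) (x j) ^ 2)
          (Finset.mem_univ j), h.inner_self j]
      have : ∀ i ∈ Finset.univ.erase j, c i * inner ℝ (x i) (x j) ^ 2 = κ ^ 2 * c i := by
        intro i hi
        rw [← sq_abs, h.abs_inner i j (Finset.ne_of_mem_erase hi)]; ring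
      rw [Finset.sum_congr rfl this]; ring
    have hpos : 0 < 1 - κ ^ 2 := by nlinarith
    have hsum : ∑ i, c i = 0 := by
      have h5 : (∑ i, c i) * (1 - κ ^ 2) + Fintype.card ι * (κ ^ 2 * ∑ i, c i) = 0 := by
        rw [Finset.sum_mul, ← nsmul_eq_mul, ← Finset.card_univ, ← Finset.sum_const,
          ← Finset.sum_add_distrib]
        exact Finset.sum_eq_zero fun j _ => key2 j
      have h6 : (∑ i, c i) * ((1 - κ ^ 2) + Fintype.card ι * κ ^ 2) = 0 := by
        rw [← h5]; ring
      rcases mul_eq_zero.1 h6 with h7 | h7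
      · exact h7
      · have : 0 ≤ (Fintype.card ι : ℝ) * κ ^ 2 := by positivity
        linarith
    intro j
    have := key2 j
    rw [hsum, mul_zero, add_zero] at this
    exact (mul_eq_zero.1 this).resolve_right hpos.ne'
  have := hw.fintype_card_le_finrank
  simpa [Sym2.card] using this

/-- The relative bound. -/
lemma IsEquiSystem.relative_bound {ι : Type*} [Fintype ι] {x : ι → E} {κ : ℝ}
    (h : IsEquiSystem x κ) :
    (Fintype.card ι : ℝ) ^ 2 ≤ finrank ℝ E *
      (Fintype.card ι + Fintype.card ι * (Fintype.card ι - 1) * κ ^ 2) := by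
  classical
  let b := stdOrthonormalBasis ℝ E
  -- The matrix of the frame operator `∑ x i ⊗ x i`, whose trace is the number of vectors and whose
  -- square has as trace the sum of the squared inner products.
  let A : Fin (finrank ℝ E) → Fin (finrank ℝ E) → ℝ := fun s t =>
    ∑ i, inner ℝ (b s) (x i) * inner ℝ (x i) (b t)
  have htr : ∑ s, A s s = Fintype.card ι := by
    simp only [A]
    rw [Finset.sum_comm]
    have : ∀ i, ∑ s, inner ℝ (b s) (x i) * inner ℝ (x i) (b s) = 1 := by
      intro i
      rw [← h.inner_self i, ← b.sum_inner_mul_inner (x i) (x i)]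
      exact Finset.sum_congr rfl fun s _ => mul_comm _ _
    simp [this]
  have hsq : ∑ s, ∑ t, A s t ^ 2 = ∑ i, ∑ j, inner ℝ (x i) (x j) ^ 2 := by
    have h1 : ∀ s t, A s t ^ 2 = ∑ i, ∑ j, (inner ℝ (x i) (b s) * inner ℝ (b s) (x j)) *
        (inner ℝ (x i) (b t) * inner ℝ (b t) (x j)) := by
      intro s t
      simp only [A]
      rw [sq, Finset.sum_mul_sum]
      refine Finset.sum_congr rfl fun i _ => Finset.sum_congr rfl fun j _ => ?_
      rw [real_inner_comm (b s) (x i), real_inner_comm (b t) (x j)]; ring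
    have h2 : ∀ i j, inner ℝ (x i) (x j) ^ 2 = ∑ s, ∑ t,
        (inner ℝ (x i) (b s) * inner ℝ (b s) (x j)) *
        (inner ℝ (x i) (b t) * inner ℝ (b t) (x j)) := by
      intro i j
      rw [sq, ← b.sum_inner_mul_inner (x i) (x j), Finset.sum_mul_sum]
    simp_rw [h1, h2]
    rw [Finset.sum_congr rfl fun s _ => Finset.sum_comm, Finset.sum_comm]
    refine Finset.sum_congr rfl fun i _ => ?_
    rw [Finset.sum_congr rfl fun s _ => Finset.sum_comm, Finset.sum_comm]
  have hg : ∑ i, ∑ j, inner ℝ (x i) (x j) ^ 2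
      = Fintype.card ι + Fintype.card ι * (Fintype.card ι - 1) * κ ^ 2 := by
    have h1 : ∀ i, ∑ j, inner ℝ (x i) (x j) ^ 2 = 1 + (Fintype.card ι - 1) * κ ^ 2 := by
      intro i
      rw [← Finset.add_sum_erase _ _ (Finset.mem_univ i), h.inner_self i]
      have : ∀ j ∈ Finset.univ.erase i, inner ℝ (x i) (x j) ^ 2 = κ ^ 2 := by
        intro j hj
        rw [← sq_abs, h.abs_inner i j (Finset.ne_of_mem_erase hj).symm]
      rw [Finset.sum_congr rfl this, Finset.sum_const, Finset.card_erase_of_mem (Finset.mem_univ i),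
        nsmul_eq_mul, Finset.card_univ, Nat.cast_sub (Fintype.card_pos_iff.2 ⟨i⟩)]
      norm_num
    simp_rw [h1]
    simp only [Finset.sum_const, Finset.card_univ, nsmul_eq_mul]
    ring
  rw [← hg, ← hsq, ← htr]
  -- Cauchy–Schwarz on the diagonal; the off-diagonal squares are then added.
  calc (∑ s, A s s) ^ 2 ≤ Finset.univ.card * ∑ s, A s s ^ 2 := sq_sum_le_card_mul_sum_sq
    _ ≤ finrank ℝ E * ∑ s, ∑ t, A s t ^ 2 := by
      rw [Finset.card_univ, Fintype.card_fin]
      gcongr with s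
      exact Finset.single_le_sum (f := fun t => A s t ^ 2) (fun t _ => sq_nonneg _)
        (Finset.mem_univ s)

end general

/-! ### Integrality of large eigenvalues and Neumann's theorem. -/

open Polynomial in
-- In characteristic zero the minimal polynomial is separable, so each of its factors uses up
-- exactly one factor `X - θ`; induction strips them off one at a time.
lemma minpoly_pow_dvd_of_pow_dvd_map {θ : ℝ} (hθ : IsIntegral ℚ θ) (k : ℕ) (f : ℚ[X])
    (h : (X - C θ) ^ k ∣ f.map (algebraMap ℚ ℝ)) : minpoly ℚ θ ^ k ∣ f := by
  induction k generalizing f with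
  | zero => simp
  | succ k ih =>
    have hroot : aeval θ f = 0 := by
      obtain ⟨g, hg⟩ := h
      rw [aeval_def, ← eval_map, hg]
      simp
    obtain ⟨g, rfl⟩ := minpoly.dvd ℚ θ hroot
    have hsep : (minpoly ℚ θ).Separable := (minpoly.irreducible hθ).separable
    have hsep' : ((minpoly ℚ θ).map (algebraMap ℚ ℝ)).Separable := hsep.map
    have hroot' : ((minpoly ℚ θ).map (algebraMap ℚ ℝ)).IsRoot θ := by
      rw [IsRoot, eval_map, ← aeval_def, minpoly.aeval]
    obtain ⟨q, hq⟩ := dvd_iff_isRoot.2 hroot'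
    have hcop : IsCoprime (X - C θ) q := by
      rw [hq] at hsep'
      exact hsep'.isCoprime
    rw [Polynomial.map_mul, hq, pow_succ', mul_assoc,
      mul_dvd_mul_iff_left (X_sub_C_ne_zero θ)] at h
    rw [pow_succ']
    exact mul_dvd_mul_left _ (ih g ((hcop.pow_left).dvd_of_dvd_mul_left h))

open Polynomial in
/-- A real eigenvalue of an integer matrix whose multiplicity exceeds half of the size is an
integer. -/
lemma exists_int_of_large_eigenspace {ι : Type*} [Fintype ι] [DecidableEq ι] (A : Matrix ι ι ℤ)
    (θ : ℝ) (W : Submodule ℝ (ι → ℝ))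
    (hW : ∀ v ∈ W, (A.map (Int.cast : ℤ → ℝ)).mulVec v = θ • v)
    (hcard : Fintype.card ι < 2 * finrank ℝ W) : ∃ n : ℤ, θ = n := by
  set B := A.map (Int.cast : ℤ → ℝ) with hB
  have hle : finrank ℝ W ≤ B.charpoly.rootMultiplicity θ := by
    have h1 := LinearMap.finrank_eigenspace_le (Matrix.toLin' B) θ
    rw [Matrix.charpoly_toLin'] at h1
    refine le_trans (Submodule.finrank_mono fun v hv => ?_) h1
    rw [End.mem_eigenspace_iff, Matrix.toLin'_apply, hW v hv]
  have hBc : B.charpoly = (A.charpoly.map (Int.castRingHom ℚ)).map (algebraMap ℚ ℝ) := by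
    rw [Polynomial.map_map, hB]
    have : (algebraMap ℚ ℝ).comp (Int.castRingHom ℚ) = Int.castRingHom ℝ := RingHom.ext_int _ _
    rw [this, ← Matrix.charpoly_map]
    rfl
  have hB0 : B.charpoly ≠ 0 := (Matrix.charpoly_monic B).ne_zero
  have hpos : 0 < finrank ℝ W := by omega
  have hev : B.charpoly.eval θ = 0 :=
    (rootMultiplicity_pos hB0).1 (hpos.trans_le hle)
  have hint : IsIntegral ℤ θ := by
    refine ⟨A.charpoly, Matrix.charpoly_monic A, ?_⟩
    rw [← hev, hBc, Polynomial.map_map, eval_map]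
    congr 1
  have hintQ : IsIntegral ℚ θ := hint.tower_top
  have hdvd := minpoly_pow_dvd_of_pow_dvd_map hintQ (finrank ℝ W)
    (A.charpoly.map (Int.castRingHom ℚ)) (by
      rw [← hBc]; exact (le_rootMultiplicity_iff hB0).1 hle)
  have hmonic : (A.charpoly.map (Int.castRingHom ℚ)).Monic := (Matrix.charpoly_monic A).map _
  have hdeg := natDegree_le_of_dvd hdvd hmonic.ne_zero
  rw [natDegree_pow, (Matrix.charpoly_monic A).natDegree_map, Matrix.charpoly_natDegree_eq_dim]
    at hdeg
  -- A minimal polynomial of degree at least two, raised to the dimension of `W`, would have larger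
  -- degree than the characteristic polynomial.
  have hd1 : (minpoly ℚ θ).natDegree = 1 := by
    have h1 := minpoly.natDegree_pos hintQ
    by_contra hne
    have : 2 ≤ (minpoly ℚ θ).natDegree := by omega
    nlinarith
  obtain ⟨r, hr⟩ := minpoly.mem_range_of_degree_eq_one ℚ θ
    ((degree_eq_iff_natDegree_eq_of_pos one_pos).2 hd1)
  have hrint : IsIntegral ℤ r := by
    rw [← hr] at hint
    exact (isIntegral_algebraMap_iff (algebraMap ℚ ℝ).injective).1 hint
  obtain ⟨n, hn⟩ := IsIntegrallyClosed.isIntegral_iff.1 hrint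
  refine ⟨n, ?_⟩
  rw [← hr, ← hn]; simp

/-- Neumann's theorem: the inverse of the cosine of the angle of more than `2 d + 2` equiangular
lines in a `d`-dimensional space is an odd integer. -/
lemma IsEquiSystem.exists_int {E ι : Type*} [NormedAddCommGroup E] [InnerProductSpace ℝ E]
    [FiniteDimensional ℝ E] [Fintype ι] {x : ι → E} {κ : ℝ} (h : IsEquiSystem x κ) (h0 : 0 < κ)
    (hcard : 2 * finrank ℝ E + 2 < Fintype.card ι) : ∃ n : ℤ, 1 / κ = 2 * n + 1 := by
  classical
  -- The graph of negative products: the Gram matrix is `κ J - 2 κ A + (1 - κ) I`. On the common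
  -- kernel of the Gram matrix and `J`, `A` acts as `(1 / κ - 1) / 2`, and that kernel contains the
  -- kernel of `T`, of codimension at most `d + 1`.
  let A : Matrix ι ι ℤ := fun i j => if i ≠ j ∧ inner ℝ (x i) (x j) = -κ then 1 else 0
  let T : (ι → ℝ) →ₗ[ℝ] E × ℝ :=
    (Fintype.linearCombination ℝ x).prod (∑ i, LinearMap.proj i)
  have hT : ∀ v, T v = (∑ i, v i • x i, ∑ i, v i) := fun v => by
    simp [T, Fintype.linearCombination_apply]
  have hrank : Fintype.card ι ≤ finrank ℝ E + 1 + finrank ℝ (LinearMap.ker T) := by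
    have h1 := LinearMap.finrank_range_add_finrank_ker T
    have h2 := Submodule.finrank_le (LinearMap.range T)
    rw [finrank_prod, finrank_self] at h2
    rw [finrank_fintype_fun_eq_card] at h1
    omega
  obtain ⟨n, hn⟩ := exists_int_of_large_eigenspace A ((1 / κ - 1) / 2) (LinearMap.ker T) (by
    intro v hv
    rw [LinearMap.mem_ker, hT, Prod.mk_eq_zero] at hv
    obtain ⟨hv1, hv2⟩ := hv
    ext i
    have hin : ∀ j, inner ℝ (x i) (x j) =
        κ - 2 * κ * (A i j : ℝ) + if i = j then 1 - κ else 0 := by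
      intro j
      by_cases hij : i = j
      · subst hij; simp [A, h.norm_eq]
      · rcases h.inner_eq hij with h3 | h3
        · have : κ ≠ -κ := by intro h4; linarith
          simp [A, hij, h3, this]
        · simp [A, hij, h3]; ring
    have h5 : ∑ j, v j * inner ℝ (x i) (x j) = 0 := by
      have : inner ℝ (x i) (∑ j, v j • x j) = 0 := by rw [hv1, inner_zero_right]
      simpa [inner_sum, real_inner_smul_right] using this
    have h6 : ∑ j, v j * inner ℝ (x i) (x j) =
        κ * ∑ j, v j - 2 * κ * ∑ j, (A i j : ℝ) * v j + (1 - κ) * v i := by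
      simp_rw [hin, mul_add, Finset.sum_add_distrib, mul_sub, Finset.sum_sub_distrib,
        Finset.mul_sum]
      congr 1
      · congr 1
        · exact Finset.sum_congr rfl fun j _ => by ring
        · exact Finset.sum_congr rfl fun j _ => by ring
      · simp [mul_comm]
    rw [h5, hv2] at h6
    change ∑ j, (A i j : ℝ) * v j = _
    simp only [Pi.smul_apply, smul_eq_mul]
    field_simp
    linarith) (by omega)
  exact ⟨n, by linarith⟩

/-! ### Triads and pillars at cosine `1 / 3`. -/

section pillars

variable {E : Type*} [NormedAddCommGroup E] [InnerProductSpace ℝ E]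

/-- Three unit vectors with pairwise inner products `-κ`. -/
structure IsTriad (κ : ℝ) (p q r : E) : Prop where
  norm_p : ‖p‖ = 1
  norm_q : ‖q‖ = 1
  norm_r : ‖r‖ = 1
  inner_pq : inner ℝ p q = -κ
  inner_pr : inner ℝ p r = -κ
  inner_qr : inner ℝ q r = -κ

/-- A unit vector with inner products `κ, κ, -κ` with `p, q, r`. -/
structure IsPillar (κ : ℝ) (p q r v : E) : Prop where
  norm_v : ‖v‖ = 1
  inner_p : inner ℝ p v = κ
  inner_q : inner ℝ q v = κ
  inner_r : inner ℝ r v = -κ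

lemma IsTriad.swap_pq {κ : ℝ} {p q r : E} (h : IsTriad κ p q r) : IsTriad κ q p r :=
  ⟨h.norm_q, h.norm_p, h.norm_r, by rw [real_inner_comm, h.inner_pq], h.inner_qr, h.inner_pr⟩

lemma IsTriad.swap_qr {κ : ℝ} {p q r : E} (h : IsTriad κ p q r) : IsTriad κ p r q :=
  ⟨h.norm_p, h.norm_r, h.norm_q, h.inner_pr, h.inner_pq, by rw [real_inner_comm, h.inner_qr]⟩

lemma IsPillar.swap {κ : ℝ} {p q r v : E} (h : IsPillar κ p q r v) : IsPillar κ q p r v :=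
  ⟨h.norm_v, h.inner_q, h.inner_p, h.inner_r⟩

lemma IsEquiSystem.of_sign {ι : Type*} {x x' : ι → E} {κ : ℝ} (h : IsEquiSystem x κ)
    (hx : ∀ i, x' i = x i ∨ x' i = -x i) : IsEquiSystem x' κ := by
  refine ⟨fun i => ?_, fun i j hij => ?_⟩
  · rcases hx i with h1 | h1 <;> rw [h1] <;> simp [h.norm_eq]
  · rw [← h.abs_inner i j hij]
    rcases hx i with h1 | h1 <;> rcases hx j with h2 | h2 <;> rw [h1, h2] <;> simp

/-- A system `x` containing the triad `x i, x j, x k`, all of whose other members have at least two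
positive inner products with the triad. -/
structure IsNormalized {ι : Type*} (x : ι → E) (κ : ℝ) (i j k : ι) : Prop where
  isEquiSystem : IsEquiSystem x κ
  triad : IsTriad κ (x i) (x j) (x k)
  cases (l : ι) (hi : l ≠ i) (hj : l ≠ j) (hk : l ≠ k) :
    IsPillar κ (x i) (x j) (x k) (x l) ∨ IsPillar κ (x i) (x k) (x j) (x l) ∨
    IsPillar κ (x j) (x k) (x i) (x l) ∨
    (inner ℝ (x i) (x l) = κ ∧ inner ℝ (x j) (x l) = κ ∧ inner ℝ (x k) (x l) = κ)

/-- A system of more than `d` vectors can be normalized. -/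
lemma IsEquiSystem.exists_normalized [FiniteDimensional ℝ E] {ι : Type*} [Fintype ι] {x : ι → E}
    {κ : ℝ} (h : IsEquiSystem x κ) (h0 : 0 < κ) (h1 : κ < 1) (hc : finrank ℝ E < Fintype.card ι) :
    ∃ (x' : ι → E) (i j k : ι), (∀ l, x' l = x l ∨ x' l = -x l) ∧ i ≠ j ∧ i ≠ k ∧ j ≠ k ∧
      IsNormalized x' κ i j k := by
  classical
  obtain ⟨i⟩ : Nonempty ι := Fintype.card_pos_iff.1 (by omega)
  let y : ι → E := fun l => if l ≠ i ∧ inner ℝ (x i) (x l) = -κ then -x l else x l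
  have hy : ∀ l, y l = x l ∨ y l = -x l := fun l => by
    by_cases hl : l ≠ i ∧ inner ℝ (x i) (x l) = -κ <;> simp [y, hl]
  have hys := h.of_sign hy
  have hyi : y i = x i := by simp [y]
  have hyp : ∀ l, l ≠ i → inner ℝ (y i) (y l) = κ := fun l hl => by
    rw [hyi]
    rcases h.inner_eq (Ne.symm hl) with h2 | h2
    · have h3 : κ ≠ -κ := by intro h4; linarith
      simp [y, h2, h3]
    · simp [y, h2, hl]
  -- More than `d` vectors cannot have all their products equal to `κ`, since they would be
  -- independent.
  obtain ⟨j, k, hjk, hne⟩ : ∃ j k, j ≠ k ∧ inner ℝ (y j) (y k) ≠ κ := by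
    by_contra hcon
    push Not at hcon
    have := (linearIndependent_of_inner_eq h0.le h1 hys.norm_eq hcon).fintype_card_le_finrank
    omega
  have hjk' : inner ℝ (y j) (y k) = -κ := (hys.inner_eq hjk).resolve_left hne
  have hji : i ≠ j := by rintro rfl; exact hne (hyp k hjk.symm)
  have hki : i ≠ k := by rintro rfl; rw [real_inner_comm] at hne; exact hne (hyp j hjk)
  -- All products with `y i` are `κ`, so negating `y i` makes all three products of the triad
  -- negative.
  have hT : IsTriad κ (-y i) (y j) (y k) := by
    refine ⟨by rw [norm_neg, hys.norm_eq], hys.norm_eq j, hys.norm_eq k, ?_, ?_, hjk'⟩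
    · rw [inner_neg_left, hyp j hji.symm]
    · rw [inner_neg_left, hyp k hki.symm]
  have hex : ∀ l, ∃ v : E, (v = x l ∨ v = -x l) ∧ (l = i → v = -y i) ∧ (l = j → v = y j) ∧
      (l = k → v = y k) ∧ (l ≠ i → l ≠ j → l ≠ k →
      IsPillar κ (-y i) (y j) (y k) v ∨ IsPillar κ (-y i) (y k) (y j) v ∨
      IsPillar κ (y j) (y k) (-y i) v ∨
      (inner ℝ (-y i) v = κ ∧ inner ℝ (y j) v = κ ∧ inner ℝ (y k) v = κ)) := by
    intro l
    by_cases hli : l = i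
    · subst hli
      exact ⟨-y l, by right; rw [hyi], fun _ => rfl, fun hh => absurd hh hji,
        fun hh => absurd hh hki, fun hh => absurd rfl hh⟩
    by_cases hlj : l = j
    · subst hlj
      exact ⟨y l, hy l, fun hh => absurd hh hli, fun _ => rfl, fun hh => absurd hh hjk,
        fun _ hh => absurd rfl hh⟩
    by_cases hlk : l = k
    · subst hlk
      exact ⟨y l, hy l, fun hh => absurd hh hli, fun hh => absurd hh hlj, fun _ => rfl,
        fun _ _ hh => absurd rfl hh⟩
    have e1 := hyp l hli
    have hn := hys.norm_eq l
    have hv : ∃ v : E, (v = y l ∨ v = -y l) ∧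
      (IsPillar κ (-y i) (y j) (y k) v ∨ IsPillar κ (-y i) (y k) (y j) v ∨
      IsPillar κ (y j) (y k) (-y i) v ∨
      (inner ℝ (-y i) v = κ ∧ inner ℝ (y j) v = κ ∧ inner ℝ (y k) v = κ)) := by
      rcases hys.inner_eq (Ne.symm hlj) with e2 | e2 <;>
        rcases hys.inner_eq (Ne.symm hlk) with e3 | e3
      · exact ⟨y l, Or.inl rfl, Or.inr (Or.inr (Or.inl ⟨hn, e2, e3, by simp [e1]⟩))⟩
      · exact ⟨-y l, Or.inr rfl, Or.inr (Or.inl ⟨by simp [hn], by simp [e1], by simp [e3],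
          by simp [e2]⟩)⟩
      · exact ⟨-y l, Or.inr rfl, Or.inl ⟨by simp [hn], by simp [e1], by simp [e2], by simp [e3]⟩⟩
      · exact ⟨-y l, Or.inr rfl, Or.inr (Or.inr (Or.inr ⟨by simp [e1], by simp [e2],
          by simp [e3]⟩))⟩
    obtain ⟨v, hv1, hv2⟩ := hv
    refine ⟨v, ?_, fun hh => absurd hh hli, fun hh => absurd hh hlj, fun hh => absurd hh hlk,
      fun _ _ _ => hv2⟩
    rcases hv1 with rfl | rfl <;> rcases hy l with h5 | h5 <;> simp [h5]
  choose x' hx1 hx2 hx3 hx4 hx5 using hex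
  refine ⟨x', i, j, k, hx1, hji, hki, hjk, h.of_sign hx1, ?_, ?_⟩
  · rw [hx2 i rfl, hx3 j rfl, hx4 k rfl]; exact hT
  · intro l hi hj hk
    rw [hx2 i rfl, hx3 j rfl, hx4 k rfl]; exact hx5 l hi hj hk

/-- Vectors of one pillar with inner product `-1/3` are antipodal. -/
lemma IsPillar.eq_of_inner {p q r v w : E} (ht : IsTriad (1 / 3) p q r)
    (hv : IsPillar (1 / 3) p q r v) (hw : IsPillar (1 / 3) p q r w)
    (h : inner ℝ v w = -(1 / 3 : ℝ)) : w = p + q - v := by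
  -- For general `κ` the squared length is `4 - 12 κ`.
  have h1 : inner ℝ (p + q - v - w) (p + q - v - w) = (0 : ℝ) := by
    simp only [inner_sub_left, inner_sub_right, inner_add_left, inner_add_right,
      real_inner_comm p q, real_inner_comm p v, real_inner_comm q v, real_inner_comm p w,
      real_inner_comm q w, real_inner_comm v w, ht.inner_pq, hv.inner_p, hv.inner_q, hw.inner_p,
      hw.inner_q, h, inner_self_of_norm_one ht.norm_p, inner_self_of_norm_one ht.norm_q,
      inner_self_of_norm_one hv.norm_v, inner_self_of_norm_one hw.norm_v]
    norm_num
  exact (sub_eq_zero.1 (inner_self_eq_zero.1 h1)).symm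

/-- The component of a pillar vector orthogonal to the triad. -/
noncomputable def pillarResidual (p q v : E) : E := v - (1 / 2 : ℝ) • (p + q)

/-- The projection of a pillar vector to the span of the triad is `(p + q) / 2`, of squared length
`1 / 3`. Residuals thus have squared length `2 / 3`; they are orthogonal if the product of the
vectors is `1 / 3` and antipodal if it is `-1 / 3`. -/
lemma inner_residual {p q r v w : E} (ht : IsTriad (1 / 3) p q r)
    (hv : IsPillar (1 / 3) p q r v) (hw : IsPillar (1 / 3) p q r w) :
    inner ℝ (pillarResidual p q v) (pillarResidual p q w) = inner ℝ v w - 1 / 3 := by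
  simp only [pillarResidual, inner_sub_left, inner_sub_right, inner_add_left, inner_add_right,
    real_inner_smul_left, real_inner_smul_right,
    real_inner_comm p q, real_inner_comm p v, real_inner_comm q v, ht.inner_pq, hv.inner_p,
    hv.inner_q, hw.inner_p, hw.inner_q, inner_self_of_norm_one ht.norm_p,
    inner_self_of_norm_one ht.norm_q]
  norm_num

/-- The projections `(p + q) / 2` and `(p + r) / 2` are orthogonal, so nothing is subtracted. -/
lemma inner_residual_cross {p q r v w : E} (ht : IsTriad (1 / 3) p q r)
    (hv : IsPillar (1 / 3) p q r v) (hw : IsPillar (1 / 3) p r q w) :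
    inner ℝ (pillarResidual p q v) (pillarResidual p r w) = inner ℝ v w := by
  simp only [pillarResidual, inner_sub_left, inner_sub_right, inner_add_left, inner_add_right,
    real_inner_smul_left, real_inner_smul_right,
    real_inner_comm p q, real_inner_comm p v, real_inner_comm q v, real_inner_comm r v,
    ht.inner_pq, ht.inner_pr, ht.inner_qr, hv.inner_p, hv.inner_r,
    hv.inner_q, hw.inner_p, hw.inner_q, hw.inner_r, inner_self_of_norm_one ht.norm_p,
    inner_self_of_norm_one ht.norm_q]
  norm_num

/-- An orthogonal basis of the span of a triad with `κ = 1 / 3`. -/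
def triadBasis (p q r : E) : Fin 3 → E := ![p + q, p + r, q + r]

lemma inner_triadBasis {p q r : E} (ht : IsTriad (1 / 3) p q r) (i j : Fin 3) :
    inner ℝ (triadBasis p q r i) (triadBasis p q r j) = if i = j then (4 / 3 : ℝ) else 0 := by
  fin_cases i <;> fin_cases j <;>
  simp [triadBasis, -inner_self_eq_norm_sq_to_K, inner_add_left,
    inner_add_right, real_inner_comm p q, real_inner_comm p r, real_inner_comm q r, ht.inner_pq,
    ht.inner_pr, ht.inner_qr, inner_self_of_norm_one ht.norm_p, inner_self_of_norm_one ht.norm_q,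
    inner_self_of_norm_one ht.norm_r] <;> norm_num

lemma inner_triadBasis_residual {p q r v : E} (ht : IsTriad (1 / 3) p q r)
    (hv : IsPillar (1 / 3) p q r v) (i : Fin 3) :
    inner ℝ (triadBasis p q r i) (pillarResidual p q v) = (0 : ℝ) := by
  fin_cases i <;>
  simp [triadBasis, pillarResidual, inner_add_left, inner_add_right, inner_sub_right,
    real_inner_smul_right,
    real_inner_comm p q, real_inner_comm p r, real_inner_comm q r, ht.inner_pq, ht.inner_pr,
    ht.inner_qr, ht.norm_p, ht.norm_q, ht.norm_r, hv.inner_p, hv.inner_q, hv.inner_r] <;> norm_num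

lemma inner_triadBasis_residual' {p q r v : E} (ht : IsTriad (1 / 3) p q r)
    (hv : IsPillar (1 / 3) p r q v) (i : Fin 3) :
    inner ℝ (triadBasis p q r i) (pillarResidual p r v) = (0 : ℝ) := by
  fin_cases i <;>
  simp [triadBasis, pillarResidual, inner_add_left, inner_add_right, inner_sub_right,
    real_inner_smul_right,
    real_inner_comm p q, real_inner_comm p r, real_inner_comm q r, ht.inner_pq, ht.inner_pr,
    ht.inner_qr, ht.norm_p, ht.norm_q, ht.norm_r, hv.inner_p, hv.inner_q, hv.inner_r] <;> norm_num

variable [FiniteDimensional ℝ E]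

lemma card_le_of_orthogonal {α : Type*} [Fintype α] {v : α → E}
    (h0 : ∀ i, inner ℝ (v i) (v i) ≠ (0 : ℝ))
    (h : ∀ i j, i ≠ j → inner ℝ (v i) (v j) = (0 : ℝ)) : Fintype.card α ≤ finrank ℝ E :=
  (linearIndependent_of_ne_zero_of_inner_eq_zero
    (fun i hi => h0 i (by rw [hi, inner_zero_left])) (fun i j hij => h i j hij)).fintype_card_le_finrank

/-- The residuals of a clique are orthogonal to each other and to the three-dimensional span of the
triad. -/
lemma card_pillar_clique_le {α : Type*} [Fintype α] {p q r : E} (ht : IsTriad (1 / 3) p q r)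
    {z : α → E} (hz : ∀ i, IsPillar (1 / 3) p q r (z i))
    (hi : ∀ i j, i ≠ j → inner ℝ (z i) (z j) = (1 / 3 : ℝ)) :
    Fintype.card α + 3 ≤ finrank ℝ E := by
  classical
  have := card_le_of_orthogonal (v := Sum.elim (triadBasis p q r) fun i => pillarResidual p q (z i))
    (by
      rintro (i | i)
      · simp only [Sum.elim_inl, inner_triadBasis ht]; norm_num
      · simp only [Sum.elim_inr, inner_residual ht (hz i) (hz i),
          inner_self_of_norm_one (hz i).norm_v]; norm_num)
    (by
      rintro (i | i) (j | j) hij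
      · simp only [Sum.elim_inl, inner_triadBasis ht]
        rw [if_neg (fun h => hij (by rw [h]))]
      · simp only [Sum.elim_inl, Sum.elim_inr, inner_triadBasis_residual ht (hz j)]
      · simp only [Sum.elim_inl, Sum.elim_inr]
        rw [real_inner_comm, inner_triadBasis_residual ht (hz i)]
      · simp only [Sum.elim_inr, inner_residual ht (hz i) (hz j)]
        rw [hi i j (fun h => hij (by rw [h]))]; norm_num)
  simp at this
  omega

/-- The residual of `y` has product `δ` with each clique residual. Its component `w` orthogonal to
them has squared length `2 / 3 - n / 6` for a clique of size `n`, whence `n ≤ 4`; for `n < 4` it is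
one more independent direction. -/
lemma card_pillar_clique_le_of_cross {α : Type*} [Fintype α] {p q r : E}
    (ht : IsTriad (1 / 3) p q r) {z : α → E} (hz : ∀ i, IsPillar (1 / 3) p q r (z i))
    (hi : ∀ i j, i ≠ j → inner ℝ (z i) (z j) = (1 / 3 : ℝ)) {y : E}
    (hy : IsPillar (1 / 3) p r q y) {δ : ℝ} (hδ : δ ^ 2 = 1 / 9)
    (hzy : ∀ i, inner ℝ (z i) y = δ) :
    Fintype.card α ≤ 4 ∧ (Fintype.card α = 4 ∨ Fintype.card α + 4 ≤ finrank ℝ E) := by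
  classical
  set ρ : α → E := fun i => pillarResidual p q (z i) with hρ
  set η : E := pillarResidual p r y with hη
  set w : E := η - (3 * δ / 2) • ∑ i, ρ i with hw
  have hρρ : ∀ i j, inner ℝ (ρ i) (ρ j) = if i = j then (2 / 3 : ℝ) else 0 := by
    intro i j
    rw [hρ, inner_residual ht (hz i) (hz j)]
    split_ifs with h
    · rw [h, inner_self_of_norm_one (hz j).norm_v]; norm_num
    · rw [hi i j h]; norm_num
  have hρη : ∀ i, inner ℝ (ρ i) η = δ := fun i => by
    rw [hρ, hη, inner_residual_cross ht (hz i) hy, hzy]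
  have hηη : inner ℝ η η = (2 / 3 : ℝ) := by
    rw [hη, inner_residual ht.swap_qr hy hy, inner_self_of_norm_one hy.norm_v]; norm_num
  have hρw : ∀ i, inner ℝ (ρ i) w = (0 : ℝ) := by
    intro i
    rw [hw, inner_sub_right, real_inner_smul_right, inner_sum, hρη]
    simp [hρρ]; ring
  have hww : inner ℝ w w = (2 / 3 - Fintype.card α / 6 : ℝ) := by
    have h1 : inner ℝ w w = inner ℝ η w := by
      conv_lhs => rw [hw, inner_sub_left, real_inner_smul_left, sum_inner]
      simp [hρw, ← hw]
    rw [h1, hw, inner_sub_right, real_inner_smul_right, inner_sum, hηη]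
    simp_rw [real_inner_comm (ρ _) η, hρη]
    simp only [Finset.sum_const, Finset.card_univ, nsmul_eq_mul]
    linear_combination (-3 / 2 * Fintype.card α : ℝ) * hδ
  have hnn : (0 : ℝ) ≤ inner ℝ w w := real_inner_self_nonneg
  have hle : Fintype.card α ≤ 4 := by
    rw [hww] at hnn
    have : (Fintype.card α : ℝ) ≤ 4 := by linarith
    exact_mod_cast this
  refine ⟨hle, ?_⟩
  by_cases h4 : Fintype.card α = 4
  · exact Or.inl h4
  right
  have hlt : (Fintype.card α : ℝ) < 4 := by exact_mod_cast lt_of_le_of_ne hle h4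
  have hbw : ∀ i, inner ℝ (triadBasis p q r i) w = (0 : ℝ) := by
    intro i
    rw [hw, inner_sub_right, real_inner_smul_right, inner_sum,
      inner_triadBasis_residual' ht hy]
    simp [hρ, inner_triadBasis_residual ht (hz _)]
  have := card_le_of_orthogonal (v := Sum.elim (Sum.elim (triadBasis p q r) ρ) fun _ : Unit => w)
    (by
      rintro ((i | i) | i)
      · simp only [Sum.elim_inl, inner_triadBasis ht]; norm_num
      · simp only [Sum.elim_inl, Sum.elim_inr, hρρ]; norm_num
      · simp only [Sum.elim_inr, hww]; linarith)
    (by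
      rintro ((i | i) | i) ((j | j) | j) hij
      · simp only [Sum.elim_inl, inner_triadBasis ht]
        rw [if_neg (fun h => hij (by rw [h]))]
      · simp only [Sum.elim_inl, Sum.elim_inr, hρ, inner_triadBasis_residual ht (hz j)]
      · simp only [Sum.elim_inl, Sum.elim_inr, hbw]
      · simp only [Sum.elim_inl, Sum.elim_inr]
        rw [real_inner_comm, hρ, inner_triadBasis_residual ht (hz i)]
      · simp only [Sum.elim_inl, Sum.elim_inr, hρρ]
        rw [if_neg (fun h => hij (by rw [h]))]
      · simp only [Sum.elim_inl, Sum.elim_inr, hρw]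
      · simp only [Sum.elim_inl, Sum.elim_inr]
        rw [real_inner_comm, hbw]
      · simp only [Sum.elim_inl, Sum.elim_inr]
        rw [real_inner_comm, hρw]
      · exact absurd rfl hij)
  simp at this
  omega

/-- A single pillar has at most `2 (d - 3)` members. -/
lemma card_pillar_le {α : Type*} [Fintype α] [LinearOrder α] {p q r : E}
    (ht : IsTriad (1 / 3) p q r) {z : α → E} (hs : IsEquiSystem z (1 / 3))
    (hz : ∀ i, IsPillar (1 / 3) p q r (z i)) :
    Fintype.card α + 6 ≤ 2 * finrank ℝ E := by
  -- Product `-1 / 3` pairs each member with at most one other. Separating the later member of each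
  -- such pair leaves two cliques.
  let P : α → Prop := fun i => ∃ j < i, inner ℝ (z i) (z j) = -(1 / 3 : ℝ)
  classical
  have h1 : Fintype.card {i // ¬ P i} + 3 ≤ finrank ℝ E := by
    refine card_pillar_clique_le ht (z := fun i : {i // ¬ P i} => z i) (fun i => hz i) ?_
    rintro ⟨i, hi⟩ ⟨j, hj⟩ hij
    have hij' : i ≠ j := fun h => hij (Subtype.ext h)
    refine (hs.inner_eq hij').resolve_right fun h => ?_
    rcases lt_or_gt_of_ne hij' with h2 | h2
    · exact hj ⟨i, h2, by rw [real_inner_comm]; exact h⟩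
    · exact hi ⟨j, h2, h⟩
  have h2 : Fintype.card {i // P i} + 3 ≤ finrank ℝ E := by
    refine card_pillar_clique_le ht (z := fun i : {i // P i} => z i) (fun i => hz i) ?_
    rintro ⟨i, k, hk, hik⟩ ⟨j, m, hm, hjm⟩ hij
    have hij' : i ≠ j := fun h => hij (Subtype.ext h)
    refine (hs.inner_eq hij').resolve_right fun h => ?_
    have inj : ∀ a b, z a = z b → a = b := fun a b hab => by
      by_contra hne
      have := hs.abs_inner a b hne
      rw [hab, hs.inner_self] at this
      norm_num at this
    have e1 := (hz i).eq_of_inner ht (hz j) h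
    have e2 := (hz i).eq_of_inner ht (hz k) hik
    have e3 := (hz j).eq_of_inner ht (hz i) (by rw [real_inner_comm]; exact h)
    have e4 := (hz j).eq_of_inner ht (hz m) hjm
    have f1 := inj j k (e1.trans e2.symm)
    have f2 := inj i m (e3.trans e4.symm)
    subst f1 f2
    exact lt_asymm hk hm
  have h3 := Fintype.card_subtype_compl P
  have h4 := Fintype.card_subtype_le P
  omega

end pillars

/-! ### Counting the members of the pillars. -/

section counting

variable {E : Type*} [NormedAddCommGroup E] [InnerProductSpace ℝ E] {ι : Type*}

lemma IsEquiSystem.injective {x : ι → E} {κ : ℝ} (h : IsEquiSystem x κ) (h1 : κ < 1) :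
    Function.Injective x := fun i j hij =>
  h.span_injective h1 (show Submodule.span ℝ {x i} = Submodule.span ℝ {x j} by rw [hij])

variable [Fintype ι]

open Classical in
/-- The indices of the members of one pillar. -/
noncomputable def pillarSet (x : ι → E) (κ : ℝ) (p q r : E) : Finset ι :=
  Finset.univ.filter fun l => IsPillar κ p q r (x l)

lemma mem_pillarSet {x : ι → E} {κ : ℝ} {p q r : E} {l : ι} :
    l ∈ pillarSet x κ p q r ↔ IsPillar κ p q r (x l) := by
  simp [pillarSet]

lemma pillarSet_swap (x : ι → E) (κ : ℝ) (p q r : E) :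
    pillarSet x κ p q r = pillarSet x κ q p r := by
  ext l; rw [mem_pillarSet, mem_pillarSet]; exact ⟨IsPillar.swap, IsPillar.swap⟩

lemma IsTriad.eq_add_of_inner {p q r v : E} (ht : IsTriad (1 / 3) p q r) (hv : ‖v‖ = 1)
    (hp : inner ℝ p v = (1 / 3 : ℝ)) (hq : inner ℝ q v = (1 / 3 : ℝ))
    (hr : inner ℝ r v = (1 / 3 : ℝ)) : v = p + q + r := by
  have h1 : inner ℝ (p + q + r - v) (p + q + r - v) = (0 : ℝ) := by
    simp only [inner_sub_left, inner_sub_right, inner_add_left, inner_add_right,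
      real_inner_comm p q, real_inner_comm p v, real_inner_comm q v, real_inner_comm p r,
      real_inner_comm q r, real_inner_comm r v, ht.inner_pq, ht.inner_pr, ht.inner_qr, hp, hq, hr,
      inner_self_of_norm_one ht.norm_p, inner_self_of_norm_one ht.norm_q,
      inner_self_of_norm_one ht.norm_r, inner_self_of_norm_one hv]
    norm_num
  exact (sub_eq_zero.1 (inner_self_eq_zero.1 h1)).symm

/-- The 4 accounts for the triad and for `p + q + r`, the only vector positive on the whole triad.
-/
lemma IsNormalized.card_le {x : ι → E} {i j k : ι} (h : IsNormalized x (1 / 3) i j k) :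
    Fintype.card ι ≤ 4 + (pillarSet x (1 / 3) (x i) (x j) (x k)).card +
      (pillarSet x (1 / 3) (x i) (x k) (x j)).card +
      (pillarSet x (1 / 3) (x j) (x k) (x i)).card := by
  classical
  let T0 : Finset ι := Finset.univ.filter fun l => x l = x i + x j + x k
  have h0 : T0.card ≤ 1 := by
    rw [Finset.card_le_one]
    intro a ha b hb
    rw [Finset.mem_filter] at ha hb
    exact h.isEquiSystem.injective (by norm_num) (ha.2.trans hb.2.symm)
  have h3 : ({i, j, k} : Finset ι).card ≤ 3 := Finset.card_le_three
  have hsub : (Finset.univ : Finset ι) ⊆ {i, j, k} ∪ T0 ∪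
      pillarSet x (1 / 3) (x i) (x j) (x k) ∪ pillarSet x (1 / 3) (x i) (x k) (x j) ∪
      pillarSet x (1 / 3) (x j) (x k) (x i) := by
    intro l _
    simp only [Finset.mem_union, mem_pillarSet]
    by_cases hl : l ∈ ({i, j, k} : Finset ι)
    · exact Or.inl (Or.inl (Or.inl (Or.inl hl)))
    · simp only [Finset.mem_insert, Finset.mem_singleton, not_or] at hl
      rcases h.cases l hl.1 hl.2.1 hl.2.2 with h4 | h4 | h4 | h4
      · exact Or.inl (Or.inl (Or.inr h4))
      · exact Or.inl (Or.inr h4)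
      · exact Or.inr h4
      · refine Or.inl (Or.inl (Or.inl (Or.inr ?_)))
        rw [Finset.mem_filter]
        exact ⟨Finset.mem_univ _, h.triad.eq_add_of_inner (h.isEquiSystem.norm_eq l) h4.1 h4.2.1
          h4.2.2⟩
  have := (Finset.card_le_card hsub).trans ((Finset.card_union_le _ _).trans
    (Nat.add_le_add_right ((Finset.card_union_le _ _).trans (Nat.add_le_add_right
      ((Finset.card_union_le _ _).trans (Nat.add_le_add_right (Finset.card_union_le _ _) _)) _)) _))
  rw [Finset.card_univ] at this
  omega

/-- Members of a pillar with equal inner products with a vector of another pillar have pairwise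
inner products `1 / 3`. -/
lemma IsPillar.inner_eq_of_cross {p q r v w y : E} (ht : IsTriad (1 / 3) p q r)
    (hv : IsPillar (1 / 3) p q r v) (hw : IsPillar (1 / 3) p q r w)
    (hy : IsPillar (1 / 3) p r q y) (hvw : inner ℝ v w = (1 / 3 : ℝ) ∨ inner ℝ v w = -(1 / 3 : ℝ))
    (hvy : inner ℝ v y = inner ℝ w y) (h0 : inner ℝ v y ≠ (0 : ℝ)) :
    inner ℝ v w = (1 / 3 : ℝ) := by
  refine hvw.resolve_right fun h => h0 ?_
  have h1 := hv.eq_of_inner ht hw h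
  rw [h1, inner_sub_left, inner_add_left, hy.inner_p, hy.inner_r] at hvy
  linarith

variable [FiniteDimensional ℝ E]

/-- The vector `x m` splits the pillar by the sign of the product. Each half is a clique by
`inner_eq_of_cross`, and `c` is any number that dominates the clique sizes allowed by the dimension.
-/
lemma IsEquiSystem.card_pillarSet_le_of_cross {x : ι → E} (h : IsEquiSystem x (1 / 3)) {p q r : E}
    (ht : IsTriad (1 / 3) p q r) {m : ι} (hy : IsPillar (1 / 3) p r q (x m)) {c : ℕ}
    (hc : ∀ n, n ≤ 4 → n + 3 ≤ finrank ℝ E → (n = 4 ∨ n + 4 ≤ finrank ℝ E) → n ≤ c) :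
    (pillarSet x (1 / 3) p q r).card ≤ c +
      ((pillarSet x (1 / 3) p q r).filter fun l => inner ℝ (x l) (x m) = (1 / 3 : ℝ)).card ∧
    ((pillarSet x (1 / 3) p q r).filter fun l => inner ℝ (x l) (x m) = (1 / 3 : ℝ)).card ≤ c := by
  classical
  have key : ∀ (δ : ℝ) (X : Finset ι), δ ^ 2 = 1 / 9 → X ⊆ pillarSet x (1 / 3) p q r →
      (∀ l ∈ X, inner ℝ (x l) (x m) = δ) → X.card ≤ c := by
    intro δ X hδ hX hXy
    have hp : ∀ l : X, IsPillar (1 / 3) p q r (x l) := fun l => mem_pillarSet.1 (hX l.2)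
    have hδ0 : δ ≠ 0 := by rintro rfl; norm_num at hδ
    have hi : ∀ l l' : X, l ≠ l' → inner ℝ (x l) (x l') = (1 / 3 : ℝ) := by
      intro l l' hll
      refine (hp l).inner_eq_of_cross ht (hp l') hy
        (h.inner_eq fun hh => hll (Subtype.ext hh)) ?_ ?_
      · rw [hXy l l.2, hXy l' l'.2]
      · rw [hXy l l.2]; exact hδ0
    have h1 := card_pillar_clique_le ht hp hi
    have h2 := card_pillar_clique_le_of_cross ht hp hi hy hδ (fun l => hXy l l.2)
    rw [Fintype.card_coe] at h1 h2
    exact hc _ h2.1 h1 h2.2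
  refine ⟨?_, key (1 / 3) _ (by norm_num) (Finset.filter_subset _ _)
    fun l hl => (Finset.mem_filter.1 hl).2⟩
  rw [← Finset.card_filter_add_card_filter_not
    (fun l => inner ℝ (x l) (x m) = (1 / 3 : ℝ)), add_comm]
  refine Nat.add_le_add_right (key (-(1 / 3)) _ (by norm_num) (Finset.filter_subset _ _)
    fun l hl => ?_) _
  rw [Finset.mem_filter, mem_pillarSet] at hl
  refine (h.inner_eq ?_).resolve_left hl.2
  rintro rfl
  have h1 := hl.1.inner_q
  rw [hy.inner_r] at h1
  norm_num at h1

lemma IsEquiSystem.card_pillarSet_le [LinearOrder ι] {x : ι → E} (h : IsEquiSystem x (1 / 3))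
    {p q r : E} (ht : IsTriad (1 / 3) p q r) (hne : (pillarSet x (1 / 3) p q r).Nonempty) :
    (pillarSet x (1 / 3) p q r).card + 6 ≤ 2 * finrank ℝ E := by
  have := card_pillar_le ht (z := fun l : pillarSet x (1 / 3) p q r => x l)
    (h.comp _ Subtype.val_injective) (fun l => mem_pillarSet.1 l.2)
  rwa [Fintype.card_coe] at this

/-- Either only one pillar is inhabited, or all pillars are small, and if they are as large as
possible then they contain a large clique with constant inner product with a vector of another
pillar. -/
lemma IsNormalized.card_dichotomy [LinearOrder ι] {x : ι → E} {i j k : ι}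
    (h : IsNormalized x (1 / 3) i j k) {c : ℕ}
    (hc : ∀ n, n ≤ 4 → n + 3 ≤ finrank ℝ E → (n = 4 ∨ n + 4 ≤ finrank ℝ E) → n ≤ c) :
    Fintype.card ι ≤ 4 ∨ Fintype.card ι + 2 ≤ 2 * finrank ℝ E ∨ (Fintype.card ι ≤ 4 + 6 * c ∧
    (Fintype.card ι = 4 + 6 * c → 0 < c → ∃ m, IsPillar (1 / 3) (x i) (x k) (x j) (x m) ∧
      ((pillarSet x (1 / 3) (x i) (x j) (x k)).filter
        fun l => inner ℝ (x l) (x m) = (1 / 3 : ℝ)).card = c)) := by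
  have hs := h.isEquiSystem
  have hN := h.card_le
  have t1 := h.triad
  -- A second inhabited pillar splits the first into two halves of size at most `c`.
  have key : ∀ {p q r : E}, IsTriad (1 / 3) p q r → (pillarSet x (1 / 3) p r q).Nonempty →
      (pillarSet x (1 / 3) p q r).card ≤ 2 * c := by
    rintro p q r ht ⟨m, hm⟩
    have := hs.card_pillarSet_le_of_cross ht (mem_pillarSet.1 hm) hc
    omega
  rcases Finset.eq_empty_or_nonempty (pillarSet x (1 / 3) (x i) (x j) (x k)) with e1 | e1 <;>
  rcases Finset.eq_empty_or_nonempty (pillarSet x (1 / 3) (x i) (x k) (x j)) with e2 | e2 <;>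
  rcases Finset.eq_empty_or_nonempty (pillarSet x (1 / 3) (x j) (x k) (x i)) with e3 | e3
  · left; simpa only [e1, e2, e3, Finset.card_empty, add_zero] using hN
  · right; left
    have := hs.card_pillarSet_le t1.swap_pq.swap_qr e3
    simp only [e1, e2, Finset.card_empty, add_zero] at hN; omega
  · right; left
    have := hs.card_pillarSet_le t1.swap_qr e2
    simp only [e1, e3, Finset.card_empty, add_zero] at hN; omega
  · right; right
    have f2 := key t1.swap_qr.swap_pq (by rw [pillarSet_swap]; exact e3)
    have f3 := key t1.swap_pq.swap_qr.swap_pq (by rw [pillarSet_swap]; exact e2)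
    rw [pillarSet_swap] at f2 f3
    simp only [e1, Finset.card_empty, add_zero] at hN
    exact ⟨by omega, fun _ _ => by omega⟩
  · right; left
    have := hs.card_pillarSet_le t1 e1
    simp only [e2, e3, Finset.card_empty, add_zero] at hN; omega
  · right; right
    have f1 := key t1.swap_pq (by exact e3)
    have f3 := key t1.swap_pq.swap_qr (by rw [pillarSet_swap]; exact e1)
    rw [pillarSet_swap] at f1
    simp only [e2, Finset.card_empty, add_zero] at hN
    exact ⟨by omega, fun _ _ => by omega⟩
  · right; right
    have f1 := key t1 e2
    have f2 := key t1.swap_qr e1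
    simp only [e3, Finset.card_empty, add_zero] at hN
    exact ⟨by omega, fun _ _ => by omega⟩
  · right; right
    have f1 := key t1 e2
    have f2 := key t1.swap_qr e1
    have f3 := key t1.swap_pq.swap_qr (by rw [pillarSet_swap]; exact e1)
    refine ⟨by omega, fun hcard _ => ?_⟩
    obtain ⟨m, hm⟩ := e2
    rw [mem_pillarSet] at hm
    have := hs.card_pillarSet_le_of_cross t1 hm hc
    exact ⟨m, hm, by omega⟩

end counting

/-! ### Excluding cosines larger than `1 / 3`. -/

section largeAngle

variable {E : Type*} [NormedAddCommGroup E] [InnerProductSpace ℝ E]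

lemma IsTriad.add_three_mul_le {κ : ℝ} {p q r v : E} (ht : IsTriad κ p q r) (hv : ‖v‖ = 1)
    (hp : inner ℝ p v = κ) (hq : inner ℝ q v = κ) (hr : inner ℝ r v = κ) : κ ≤ 1 / 3 := by
  have h1 : (0 : ℝ) ≤ inner ℝ (p + q + r - v) (p + q + r - v) := real_inner_self_nonneg
  simp only [inner_sub_left, inner_sub_right, inner_add_left, inner_add_right,
      real_inner_comm p q, real_inner_comm p v, real_inner_comm q v, real_inner_comm p r,
      real_inner_comm q r, real_inner_comm r v, ht.inner_pq, ht.inner_pr, ht.inner_qr, hp, hq, hr,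
      inner_self_of_norm_one ht.norm_p, inner_self_of_norm_one ht.norm_q,
      inner_self_of_norm_one ht.norm_r, inner_self_of_norm_one hv] at h1
  linarith

/-- The squared length of `p + q - v - w` is `4 - 12 κ`. For `κ > 1 / 3` every pillar is therefore a
clique. -/
lemma IsPillar.le_of_inner {κ : ℝ} {p q r v w : E} (ht : IsTriad κ p q r)
    (hv : IsPillar κ p q r v) (hw : IsPillar κ p q r w) (h : inner ℝ v w = -κ) : κ ≤ 1 / 3 := by
  have h1 : (0 : ℝ) ≤ inner ℝ (p + q - v - w) (p + q - v - w) := real_inner_self_nonneg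
  simp only [inner_sub_left, inner_sub_right, inner_add_left, inner_add_right,
      real_inner_comm p q, real_inner_comm p v, real_inner_comm q v, real_inner_comm p w,
      real_inner_comm q w, real_inner_comm v w, ht.inner_pq, hv.inner_p, hv.inner_q, hw.inner_p,
      hw.inner_q, h, inner_self_of_norm_one ht.norm_p, inner_self_of_norm_one ht.norm_q,
      inner_self_of_norm_one hv.norm_v, inner_self_of_norm_one hw.norm_v] at h1
  linarith

lemma eq_zero_of_inner_eq_zero [FiniteDimensional ℝ E] {α : Type*} [Fintype α] {e : α → E}
    (he : LinearIndependent ℝ e) (hc : Fintype.card α = finrank ℝ E) {w : E}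
    (hw : ∀ i, inner ℝ (e i) w = (0 : ℝ)) : w = 0 := by
  have hs := he.span_eq_top_of_card_eq_finrank' hc
  have : w ∈ (Submodule.span ℝ (Set.range e))ᗮ := by
    rw [Submodule.mem_orthogonal]
    intro u hu
    induction hu using Submodule.span_induction with
    | mem u hu => obtain ⟨i, rfl⟩ := hu; exact hw i
    | zero => simp
    | add u v _ _ hu hv => rw [inner_add_left, hu, hv, add_zero]
    | smul c u _ hu => rw [real_inner_smul_left, hu, mul_zero]
  rw [hs, Submodule.top_orthogonal_eq_bot] at this
  simpa using this

/-- The inner product of two vectors in terms of their inner products with a basis of unit vectors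
with pairwise inner products `κ`. -/
lemma inner_of_clique_basis [FiniteDimensional ℝ E] {α : Type*} [Fintype α] {e : α → E} {κ : ℝ}
    (h0 : 0 < κ) (h1 : κ < 1) (he : ∀ i, ‖e i‖ = 1)
    (hi : ∀ i j, i ≠ j → inner ℝ (e i) (e j) = κ) (hc : Fintype.card α = finrank ℝ E)
    {u v : E} {σ τ : α → ℝ} (hu : ∀ i, inner ℝ (e i) u = κ * σ i)
    (hv : ∀ i, inner ℝ (e i) v = κ * τ i) :
    (1 - κ) * (1 - κ + Fintype.card α * κ) * inner ℝ u v =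
      κ ^ 2 * ((1 - κ + Fintype.card α * κ) * ∑ i, σ i * τ i - κ * (∑ i, σ i) * ∑ i, τ i) := by
  classical
  set D : ℝ := 1 - κ + Fintype.card α * κ with hD
  have hDpos : 0 < D := by
    have : (0 : ℝ) ≤ Fintype.card α * κ := by positivity
    rw [hD]; linarith
  have hk : 1 - κ ≠ 0 := by linarith
  set m := ∑ i, σ i with hm
  -- The coefficients of `u`: the inverse of `(1 - κ) I + κ J` is `(I - (κ / D) J) / (1 - κ)`,
  -- applied here to `κ σ`.
  set a : α → ℝ := fun i => κ / (1 - κ) * (σ i - κ * m / D) with ha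
  have hsum : ∑ i, a i = κ * m / D := by
    rw [ha, ← Finset.mul_sum, Finset.sum_sub_distrib, ← hm, Finset.sum_const, Finset.card_univ,
      nsmul_eq_mul]
    field_simp
    rw [hD]; ring
  have hu' : u = ∑ i, a i • e i := by
    rw [← sub_eq_zero]
    refine eq_zero_of_inner_eq_zero (linearIndependent_of_inner_eq h0.le h1 he hi) hc fun j => ?_
    have h2 : inner ℝ (e j) (∑ i, a i • e i) = a j * (1 - κ) + κ * ∑ i, a i := by
      rw [inner_sum, ← Finset.add_sum_erase _ _ (Finset.mem_univ j),
        ← Finset.add_sum_erase _ a (Finset.mem_univ j), real_inner_smul_right,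
        inner_self_of_norm_one (he j)]
      have : ∀ i ∈ Finset.univ.erase j, inner ℝ (e j) (a i • e i) = κ * a i := by
        intro i hij
        rw [real_inner_smul_right, hi j i (Finset.ne_of_mem_erase hij).symm]; ring
      rw [Finset.sum_congr rfl this, ← Finset.mul_sum]
      ring
    rw [inner_sub_right, hu, h2, hsum, ha]
    field_simp
    ring
  have h3 : inner ℝ u v = κ * ∑ i, a i * τ i := by
    conv_lhs => rw [hu']
    rw [sum_inner, Finset.mul_sum]
    refine Finset.sum_congr rfl fun i _ => ?_
    rw [real_inner_smul_left, hv]; ring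
  have h4 : ∑ i, a i * τ i = κ / (1 - κ) * (∑ i, σ i * τ i - κ * m / D * ∑ i, τ i) := by
    rw [Finset.mul_sum, ← Finset.sum_sub_distrib, Finset.mul_sum]
    exact Finset.sum_congr rfl fun i _ => by rw [ha]; ring
  rw [h3, h4]
  field_simp

/-- A pillar together with two vectors of the triad is a clique. -/
def pillarClique {α : Type*} (p r : E) (z : α → E) : Option (Option α) → E
  | none => p
  | some none => -r
  | some (some i) => z i

lemma norm_pillarClique {α : Type*} {κ : ℝ} {p q r : E} (ht : IsTriad κ p q r) {z : α → E}
    (hz : ∀ i, IsPillar κ p q r (z i)) (i : Option (Option α)) : ‖pillarClique p r z i‖ = 1 := by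
  rcases i with _ | _ | i
  · exact ht.norm_p
  · simp [pillarClique, ht.norm_r]
  · exact (hz i).norm_v

lemma inner_pillarClique {α : Type*} {κ : ℝ} {p q r : E} (ht : IsTriad κ p q r) {z : α → E}
    (hz : ∀ i, IsPillar κ p q r (z i)) (hi : ∀ i j, i ≠ j → inner ℝ (z i) (z j) = κ)
    (i j : Option (Option α)) (hij : i ≠ j) :
    inner ℝ (pillarClique p r z i) (pillarClique p r z j) = κ := by
  rcases i with _ | _ | i <;> rcases j with _ | _ | j
  · exact absurd rfl hij
  · simp [pillarClique, ht.inner_pr]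
  · exact (hz j).inner_p
  · simp [pillarClique, real_inner_comm p r, ht.inner_pr]
  · exact absurd rfl hij
  · simp [pillarClique, (hz j).inner_r]
  · rw [real_inner_comm]; exact (hz i).inner_p
  · simp [pillarClique, real_inner_comm r (z i), (hz i).inner_r]
  · exact hi i j fun h => hij (by rw [h])

variable [FiniteDimensional ℝ E]

/-- In dimension five, a pillar of size three excludes the other pillars if `κ > 1 / 3`. -/
lemma false_of_three_pillar {κ : ℝ} (h0 : 1 / 3 < κ) (h1 : κ < 1) {p q r : E}
    (ht : IsTriad κ p q r) {z : Fin 3 → E} (hz : ∀ i, IsPillar κ p q r (z i))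
    (hi : ∀ i j, i ≠ j → inner ℝ (z i) (z j) = κ) (hd : finrank ℝ E = 5) {y : E}
    (hy : IsPillar κ p r q y) (hzy : ∀ i, |inner ℝ (z i) y| = κ) : False := by
  have hκ : 0 < κ := by linarith
  have ht' : ∀ i, ∃ t : ℝ, (t = 1 ∨ t = -1) ∧ inner ℝ (z i) y = κ * t := by
    intro i
    rcases abs_choice (inner ℝ (z i) y) with h2 | h2 <;> have h3 := hzy i <;> rw [h2] at h3
    · exact ⟨1, Or.inl rfl, by linarith⟩
    · exact ⟨-1, Or.inr rfl, by linarith⟩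
  choose t ht1 ht2 using ht'
  -- The five vectors `p, -r, z i` are a basis; `σ` and `τ` are the signs of the products of `q` and
  -- `y` with it.
  let σ : Option (Option (Fin 3)) → ℝ := fun
    | none => -1
    | some none => 1
    | some (some _) => 1
  let τ : Option (Option (Fin 3)) → ℝ := fun
    | none => 1
    | some none => -1
    | some (some i) => t i
  have hq : ∀ i, inner ℝ (pillarClique p r z i) q = κ * σ i := by
    rintro (_ | _ | i)
    · simp [pillarClique, σ, ht.inner_pq]
    · simp [pillarClique, σ, real_inner_comm q r, ht.inner_qr]
    · simp [pillarClique, σ, real_inner_comm q (z i), (hz i).inner_q]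
  have hy' : ∀ i, inner ℝ (pillarClique p r z i) y = κ * τ i := by
    rintro (_ | _ | i)
    · simp [pillarClique, τ, hy.inner_p]
    · simp [pillarClique, τ, hy.inner_q]
    · simp [pillarClique, τ, ht2]
  have hc : Fintype.card (Option (Option (Fin 3))) = finrank ℝ E := by rw [hd]; rfl
  have key := fun {u v : E} {σ τ : Option (Option (Fin 3)) → ℝ} =>
    inner_of_clique_basis (u := u) (v := v) (σ := σ) (τ := τ) hκ h1 (norm_pillarClique ht hz)
      (inner_pillarClique ht hz hi) hc
  have e1 := key hq hq
  have e2 := key hy' hy'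
  have e3 := key hq hy'
  rw [inner_self_of_norm_one ht.norm_q] at e1
  rw [inner_self_of_norm_one hy.norm_v] at e2
  rw [hy.inner_r] at e3
  simp only [Fintype.sum_option, Fin.sum_univ_three, σ, τ, Fintype.card_option,
    Fintype.card_fin] at e1 e2 e3
  push_cast at e1 e2 e3
  clear key hy' hq σ τ hc
  have g1 : 11 * κ ^ 2 - 2 * κ - 1 = 0 := by
    have : (κ + 1) * (11 * κ ^ 2 - 2 * κ - 1) = 0 := by linarith
    exact (mul_eq_zero.1 this).resolve_left (by linarith)
  -- The lengths of `q` and `y` depend only on the squares of their sign sums, 3 and `∑ t`, so these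
  -- agree. The prescribed product of `q` and `y` is then incompatible with `g1` or with `κ > 1 /
  -- 3`.
  have g2 : κ ^ 3 * ((t 0 + t 1 + t 2) ^ 2 - 9) = 0 := by
    have s0 : t 0 ^ 2 = 1 := by rcases ht1 0 with h | h <;> rw [h] <;> norm_num
    have s1 : t 1 ^ 2 = 1 := by rcases ht1 1 with h | h <;> rw [h] <;> norm_num
    have s2 : t 2 ^ 2 = 1 := by rcases ht1 2 with h | h <;> rw [h] <;> norm_num
    linear_combination e2 - e1 + κ ^ 2 * (1 + 4 * κ) * (s0 + s1 + s2)
  have g3 : (t 0 + t 1 + t 2 - 3) * (t 0 + t 1 + t 2 + 3) = 0 := by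
    have := (mul_eq_zero.1 g2).resolve_left (by positivity)
    linear_combination this
  rcases mul_eq_zero.1 g3 with h | h
  · have hm : t 2 = 3 - t 0 - t 1 := by linarith
    rw [hm] at e3
    have : κ * (9 * κ ^ 2 - 4 * κ - 1) = 0 := by linear_combination e3
    have := (mul_eq_zero.1 this).resolve_left hκ.ne'
    nlinarith
  · have hm : t 2 = -3 - t 0 - t 1 := by linarith
    rw [hm] at e3
    have : κ * ((5 * κ - 1) * (3 * κ + 1)) = 0 := by linear_combination e3
    rcases mul_eq_zero.1 ((mul_eq_zero.1 this).resolve_left hκ.ne') with h5 | h5 <;> linarith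

/-- No vector is positive on the whole triad, and each pillar together with `p` and `-r` is an
independent clique, so it has at most `d - 2` members: `3 + 3 (d - 2)` in all. In dimension five a
pillar of size 3 leaves the others empty, so the total is at most 9. -/
lemma IsNormalized.card_le_of_large {ι : Type*} [Fintype ι] {x : ι → E} {κ : ℝ} {i j k : ι}
    (h : IsNormalized x κ i j k) (h0 : 1 / 3 < κ) (h1 : κ < 1) :
    Fintype.card ι + 3 ≤ 3 * finrank ℝ E ∧ (finrank ℝ E = 5 → Fintype.card ι ≤ 9) := by
  classical
  have hs := h.isEquiSystem
  have t1 := h.triad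
  have h3 : ({i, j, k} : Finset ι).card ≤ 3 := Finset.card_le_three
  have hsub : (Finset.univ : Finset ι) ⊆ {i, j, k} ∪
      pillarSet x κ (x i) (x j) (x k) ∪ pillarSet x κ (x i) (x k) (x j) ∪
      pillarSet x κ (x j) (x k) (x i) := by
    intro l _
    simp only [Finset.mem_union, mem_pillarSet]
    by_cases hl : l ∈ ({i, j, k} : Finset ι)
    · exact Or.inl (Or.inl (Or.inl hl))
    · simp only [Finset.mem_insert, Finset.mem_singleton, not_or] at hl
      rcases h.cases l hl.1 hl.2.1 hl.2.2 with h4 | h4 | h4 | h4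
      · exact Or.inl (Or.inl (Or.inr h4))
      · exact Or.inl (Or.inr h4)
      · exact Or.inr h4
      · have := t1.add_three_mul_le (hs.norm_eq l) h4.1 h4.2.1 h4.2.2
        linarith
  have hN := (Finset.card_le_card hsub).trans ((Finset.card_union_le _ _).trans
    (Nat.add_le_add_right ((Finset.card_union_le _ _).trans (Nat.add_le_add_right
      (Finset.card_union_le _ _) _)) _))
  rw [Finset.card_univ] at hN
  have hi : ∀ {p q r : E}, IsTriad κ p q r → ∀ a b : pillarSet x κ p q r, a ≠ b →
      inner ℝ (x a) (x b) = κ := by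
    intro p q r ht a b hab
    refine (hs.inner_eq fun hh => hab (Subtype.ext hh)).resolve_right fun hh => ?_
    have := (mem_pillarSet.1 a.2).le_of_inner ht (mem_pillarSet.1 b.2) hh
    linarith
  have hle : ∀ {p q r : E}, IsTriad κ p q r → (pillarSet x κ p q r).card + 2 ≤ finrank ℝ E := by
    intro p q r ht
    have hz : ∀ a : pillarSet x κ p q r, IsPillar κ p q r (x a) := fun a => mem_pillarSet.1 a.2
    have := (linearIndependent_of_inner_eq (by linarith) h1 (norm_pillarClique ht hz)
      (inner_pillarClique ht hz (hi ht))).fintype_card_le_finrank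
    simp only [Fintype.card_option, Fintype.card_coe] at this
    omega
  have f1 := hle t1
  have f2 := hle t1.swap_qr
  have f3 := hle t1.swap_pq.swap_qr
  refine ⟨by omega, fun hd => ?_⟩
  by_contra hcon
  have hlt : ∀ {p q r : E}, IsTriad κ p q r → (pillarSet x κ p r q).card ≠ 0 →
      (pillarSet x κ p q r).card ≠ 3 := by
    intro p q r ht hne hcard
    obtain ⟨m, hm⟩ := Finset.card_ne_zero.1 hne
    have hm := mem_pillarSet.1 hm
    have hz : ∀ a : pillarSet x κ p q r, IsPillar κ p q r (x a) := fun a => mem_pillarSet.1 a.2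
    let e : Fin 3 ≃ pillarSet x κ p q r := (Finset.equivFinOfCardEq hcard).symm
    refine false_of_three_pillar h0 h1 ht (z := fun a => x (e a)) (fun a => hz _)
      (fun a b hab => hi ht _ _ fun hh => hab (e.injective hh)) hd hm fun a => hs.abs_inner _ _ ?_
    intro hh
    have h5 := (hz (e a)).inner_q
    rw [hh, hm.inner_r] at h5
    linarith
  have g1 := hlt t1
  have g2 := hlt t1.swap_qr
  have g3 := hlt t1.swap_pq.swap_qr
  rw [pillarSet_swap x κ (x j) (x i) (x k)] at g3
  rw [hd] at f1 f2 f3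
  omega

/-- Ten lines in dimension five, or `3 d - 2` lines in dimension `d`, have an angle of cosine at
most `1 / 3`. -/
lemma IsEquiSystem.le_one_third {ι : Type*} [Fintype ι] {x : ι → E} {κ : ℝ}
    (h : IsEquiSystem x κ) (h1 : κ < 1) (hd : finrank ℝ E < Fintype.card ι)
    (hcard : 3 * finrank ℝ E < Fintype.card ι + 3 ∨ finrank ℝ E = 5 ∧ 9 < Fintype.card ι) :
    κ ≤ 1 / 3 := by
  by_contra hc
  push Not at hc
  obtain ⟨x', i, j, k, -, -, -, -, hn⟩ := h.exists_normalized (by linarith) h1 hd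
  have := hn.card_le_of_large hc h1
  rcases hcard with h2 | h2
  · omega
  · have := this.2 h2.1; omega

end largeAngle

/-! ### The upper bound in dimension 15. -/

section dimensionFifteen

variable {E : Type*} [NormedAddCommGroup E] [InnerProductSpace ℝ E] [FiniteDimensional ℝ E]

/-- There are no 37 equiangular lines in dimension 15. -/
lemma IsEquiSystem.false_of_fifteen (hd : finrank ℝ E = 15) {x : Fin 37 → E} {κ : ℝ} (h0 : 0 ≤ κ)
    (h1 : κ < 1) (h : IsEquiSystem x κ) : False := by
  have hrel := h.relative_bound
  rw [hd, Fintype.card_fin] at hrel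
  norm_num at hrel
  -- At `κ = 1 / 5` the relative bound is exactly 36.
  have h5 : 1 / 5 < κ := by nlinarith
  obtain ⟨n, hn⟩ := h.exists_int (by linarith) (by rw [hd, Fintype.card_fin]; norm_num)
  have hκ : (2 * n + 1 : ℝ) * κ = 1 := by rw [← hn]; field_simp
  have hn1 : n = 1 := by
    have l1 : (n : ℝ) < 2 := by nlinarith
    have l2 : (0 : ℝ) < n := by nlinarith
    have l1' : n < 2 := by exact_mod_cast l1
    have l2' : 0 < n := by exact_mod_cast l2
    omega
  have h3 : κ = 1 / 3 := by rw [hn1] at hκ; push_cast at hκ; linarith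
  subst h3
  obtain ⟨x', i, j, k, -, -, -, -, hN⟩ := h.exists_normalized (by norm_num) (by norm_num)
    (by rw [hd, Fintype.card_fin]; norm_num)
  -- All three alternatives give at most 28 vectors.
  have := hN.card_dichotomy (c := 4) (fun n hn _ _ => hn)
  rw [hd, Fintype.card_fin] at this
  omega

end dimensionFifteen

/-! ### Lines determined by a basis with integral Gram matrix. -/

section config

/-- The sign of a truth value. -/
def boolSign (b : Bool) : ℤ := if b then 1 else -1

/-- An integer matrix `M` with inverse `A / D`, for which `n` sign vectors `σ` with `σ i₀ = 1`
satisfy `σᵀ A σ = 3 D`. -/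
structure ConfigData (α : Type) [Fintype α] [DecidableEq α] (M A : α → α → ℤ) (D : ℤ)
    (i₀ : α) (n : ℕ) : Prop where
  D_ne : D ≠ 0
  mul_left : ∀ i k, ∑ j, A i j * M j k = if i = k then D else 0
  mul_right : ∀ i k, ∑ j, M i j * A j k = if i = k then D else 0
  card_signs : (Finset.univ.filter fun s : α → Bool =>
    s i₀ = true ∧ ∑ i, ∑ k, A i k * (boolSign (s i) * boolSign (s k)) = 3 * D).card = n

variable {α : Type} [Fintype α] [DecidableEq α] {M A : α → α → ℤ} {D : ℤ} {i₀ : α} {n : ℕ}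

variable {E : Type*} [NormedAddCommGroup E] [InnerProductSpace ℝ E]

/-- The lines of a configuration `K`, and those at the angle of cosine `1 / 3` to all of them. -/
def configLines (K : α → E) : Set (Submodule ℝ E) :=
  {l | (∃ i, l = Submodule.span ℝ {K i}) ∨
    ∃ v, ‖v‖ = 1 ∧ l = Submodule.span ℝ {v} ∧ ∀ i, |inner ℝ (K i) v| = (1 / 3 : ℝ)}

lemma ConfigData.sum_mul (h : ConfigData α M A D i₀ n) (i : α) (f : α → ℝ) :
    ∑ j, (A i j : ℝ) * ∑ k, (M j k : ℝ) * f k = D * f i := by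
  simp_rw [Finset.mul_sum]
  rw [Finset.sum_comm]
  have : ∀ k, ∑ j, (A i j : ℝ) * ((M j k : ℝ) * f k) = (if i = k then (D : ℝ) else 0) * f k := by
    intro k
    rw [show (if i = k then (D : ℝ) else 0) = ((if i = k then D else 0 : ℤ) : ℝ) by
      split_ifs <;> simp, ← h.mul_left i k]
    push_cast
    rw [Finset.sum_mul]
    exact Finset.sum_congr rfl fun j _ => by ring
  simp [this]

lemma ConfigData.sum_mul' (h : ConfigData α M A D i₀ n) (i : α) (f : α → ℝ) :
    ∑ j, (M i j : ℝ) * ∑ k, (A j k : ℝ) * f k = D * f i := by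
  simp_rw [Finset.mul_sum]
  rw [Finset.sum_comm]
  have : ∀ k, ∑ j, (M i j : ℝ) * ((A j k : ℝ) * f k) = (if i = k then (D : ℝ) else 0) * f k := by
    intro k
    rw [show (if i = k then (D : ℝ) else 0) = ((if i = k then D else 0 : ℤ) : ℝ) by
      split_ifs <;> simp, ← h.mul_right i k]
    push_cast
    rw [Finset.sum_mul]
    exact Finset.sum_congr rfl fun j _ => by ring
  simp [this]

lemma ConfigData.linearIndependent (h : ConfigData α M A D i₀ n) {K : α → E}
    (hK : ∀ i j, inner ℝ (K i) (K j) = (M i j : ℝ) / 3) : LinearIndependent ℝ K := by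
  rw [Fintype.linearIndependent_iff]
  intro a ha i
  have h1 : ∀ j, ∑ k, (M j k : ℝ) * a k = 0 := by
    intro j
    have : inner ℝ (K j) (∑ k, a k • K k) = (0 : ℝ) := by rw [ha, inner_zero_right]
    simp_rw [inner_sum, real_inner_smul_right, hK] at this
    rw [← mul_eq_zero_iff_left (show (1 / 3 : ℝ) ≠ 0 by norm_num), Finset.mul_sum, ← this]
    exact Finset.sum_congr rfl fun k _ => by ring
  have h2 := h.sum_mul i a
  simp only [h1, mul_zero, Finset.sum_const_zero] at h2
  exact (mul_eq_zero.1 h2.symm).resolve_left (by exact_mod_cast h.D_ne)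

lemma map_mem_configLines {β : Type} {E' : Type*} [NormedAddCommGroup E'] [InnerProductSpace ℝ E']
    {K : β → E} {K' : β → E'} (ψ : E ≃ₗᵢ[ℝ] E') (hψ : ∀ i, ψ (K i) = K' i)
    {l : Submodule ℝ E} (hl : l ∈ configLines K) :
    l.map (ψ.toLinearEquiv : E →ₗ[ℝ] E') ∈ configLines K' := by
  rcases hl with ⟨i, rfl⟩ | ⟨v, h1, rfl, h3⟩
  · left
    exact ⟨i, by rw [Submodule.map_span, Set.image_singleton, ← hψ]; rfl⟩
  · right
    refine ⟨ψ v, by rw [ψ.norm_map, h1], by rw [Submodule.map_span, Set.image_singleton]; rfl,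
      fun i => ?_⟩
    rw [← hψ, ψ.inner_map_map, h3]

lemma image_configLines {β : Type} {E' : Type*} [NormedAddCommGroup E'] [InnerProductSpace ℝ E']
    {K : β → E} {K' : β → E'} (ψ : E ≃ₗᵢ[ℝ] E') (hψ : ∀ i, ψ (K i) = K' i) :
    (fun l => l.map (ψ.toLinearEquiv : E →ₗ[ℝ] E')) '' configLines K = configLines K' := by
  apply Set.Subset.antisymm
  · rintro _ ⟨l, hl, rfl⟩
    exact map_mem_configLines ψ hψ hl
  · intro l hl
    refine ⟨_, map_mem_configLines ψ.symm (fun i => by rw [← hψ, ψ.symm_apply_apply]) hl, ?_⟩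
    change Submodule.map _ (Submodule.map _ l) = l
    rw [← Submodule.map_comp]
    convert Submodule.map_id l
    ext v
    simp

/-- Both families are bases, and the linear map between them preserves inner products because the
Gram matrices agree. -/
lemma ConfigData.exists_isometry (h : ConfigData α M A D i₀ n) {E' : Type*}
    [NormedAddCommGroup E'] [InnerProductSpace ℝ E'] {K : α → E}
    {K' : α → E'} (hK : ∀ i j, inner ℝ (K i) (K j) = (M i j : ℝ) / 3)
    (hK' : ∀ i j, inner ℝ (K' i) (K' j) = (M i j : ℝ) / 3)
    (hc : Fintype.card α = finrank ℝ E) (hc' : Fintype.card α = finrank ℝ E') :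
    ∃ ψ : E ≃ₗᵢ[ℝ] E', ∀ i, ψ (K i) = K' i := by
  have : Nonempty α := ⟨i₀⟩
  let b := basisOfLinearIndependentOfCardEqFinrank (h.linearIndependent hK) hc
  let b' := basisOfLinearIndependentOfCardEqFinrank (h.linearIndependent hK') hc'
  have hb : ∀ i, b i = K i := fun i => by simp [b]
  have hb' : ∀ i, b' i = K' i := fun i => by simp [b']
  let e : E ≃ₗ[ℝ] E' := b.equiv b' (Equiv.refl α)
  have he : ∀ i, e (K i) = K' i := fun i => by
    rw [← hb, ← hb']; simp [e]
  refine ⟨e.isometryOfInner fun u v => ?_, fun i => he i⟩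
  have hu := b.sum_repr u
  have hv := b.sum_repr v
  simp only [hb] at hu hv
  rw [← hu, ← hv]
  simp only [map_sum, map_smul, he, sum_inner, inner_sum, real_inner_smul_left,
    real_inner_smul_right, hK, hK']

variable [FiniteDimensional ℝ E]

lemma ConfigData.eq_sum (h : ConfigData α M A D i₀ n) {K : α → E}
    (hK : ∀ i j, inner ℝ (K i) (K j) = (M i j : ℝ) / 3) (hc : Fintype.card α = finrank ℝ E)
    {v : E} {σ : α → ℝ} (hv : ∀ i, inner ℝ (K i) v = σ i / 3) :
    v = ∑ i, ((∑ k, (A i k : ℝ) * σ k) / D) • K i := by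
  have hD : (D : ℝ) ≠ 0 := by exact_mod_cast h.D_ne
  rw [← sub_eq_zero]
  refine eq_zero_of_inner_eq_zero (h.linearIndependent hK) hc fun j => ?_
  rw [inner_sub_right, hv, inner_sum]
  simp_rw [real_inner_smul_right, hK]
  have : ∑ i, (∑ k, (A i k : ℝ) * σ k) / D * ((M j i : ℝ) / 3) =
      1 / (3 * D) * ∑ i, (M j i : ℝ) * ∑ k, (A i k : ℝ) * σ k := by
    rw [Finset.mul_sum]
    exact Finset.sum_congr rfl fun i _ => by field_simp
  rw [this, h.sum_mul']
  field_simp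
  ring

/-- A line at cosine `1 / 3` to the whole basis is determined by the signs `σ` of a unit vector on
it, made positive at `i₀`. By `eq_sum` the vector has squared length `σᵀ A σ / (3 D)`, so `σ` is
among the `n` sign vectors counted in `ConfigData`. -/
lemma ConfigData.encard_configLines_le (h : ConfigData α M A D i₀ n) {K : α → E}
    (hK : ∀ i j, inner ℝ (K i) (K j) = (M i j : ℝ) / 3) (hc : Fintype.card α = finrank ℝ E) :
    (configLines K).encard ≤ (Fintype.card α + n : ℕ) := by
  classical
  have hD : (D : ℝ) ≠ 0 := by exact_mod_cast h.D_ne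
  let Z : Set (Submodule ℝ E) :=
    {l | ∃ v, ‖v‖ = 1 ∧ l = Submodule.span ℝ {v} ∧ ∀ i, |inner ℝ (K i) v| = (1 / 3 : ℝ)}
  have hsub : configLines K ⊆ Set.range (fun i => Submodule.span ℝ {K i}) ∪ Z := by
    rintro l (⟨i, rfl⟩ | hl)
    · exact Or.inl ⟨i, rfl⟩
    · exact Or.inr hl
  have hex : ∀ l : Submodule ℝ E, ∃ (v : E) (s : α → Bool), l ∈ Z → ‖v‖ = 1 ∧
      l = Submodule.span ℝ {v} ∧ s i₀ = true ∧
      ∀ i, inner ℝ (K i) v = (boolSign (s i) : ℝ) / 3 := by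
    intro l
    by_cases hl : l ∈ Z
    · obtain ⟨v, hv1, hv2, hv3⟩ := hl
      have hw : ∃ w : E, ‖w‖ = 1 ∧ l = Submodule.span ℝ {w} ∧
          (∀ i, |inner ℝ (K i) w| = (1 / 3 : ℝ)) ∧ inner ℝ (K i₀) w = (1 / 3 : ℝ) := by
        rcases abs_choice (inner ℝ (K i₀) v) with h2 | h2
        · exact ⟨v, hv1, hv2, hv3, by rw [← h2, hv3]⟩
        · refine ⟨-v, by rw [norm_neg, hv1], ?_, fun i => by rw [inner_neg_right, abs_neg, hv3],
            by rw [inner_neg_right, ← h2, hv3]⟩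
          rw [hv2, ← Set.neg_singleton, Submodule.span_neg]
      obtain ⟨w, hw1, hw2, hw3, hw4⟩ := hw
      refine ⟨w, fun i => decide (0 < inner ℝ (K i) w), fun _ => ⟨hw1, hw2, ?_, fun i => ?_⟩⟩
      · rw [decide_eq_true_eq, hw4]; norm_num
      · by_cases hpos : 0 < inner ℝ (K i) w
        · have := hw3 i
          rw [abs_of_pos hpos] at this
          simp [boolSign, hpos, this]
        · have := hw3 i
          rw [abs_of_nonpos (not_lt.1 hpos)] at this
          simp only [boolSign, hpos, decide_false, Bool.false_eq_true, if_false]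
          push_cast; linarith
    -- Values off `Z` are irrelevant.
    · exact ⟨0, fun _ => true, fun hh => absurd hh hl⟩
  choose v s hvs using hex
  let C : Finset (α → Bool) := Finset.univ.filter fun s : α → Bool =>
    s i₀ = true ∧ ∑ i, ∑ k, A i k * (boolSign (s i) * boolSign (s k)) = 3 * D
  have hZ : Z.encard ≤ n := by
    rw [← h.card_signs, ← Set.encard_coe_eq_coe_finsetCard]
    refine Set.encard_le_encard_of_injOn (f := s) ?_ ?_
    · intro l hl
      obtain ⟨h1, h2, h3, h4⟩ := hvs l hl
      have h5 := h.eq_sum hK hc h4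
      have h6 : (1 : ℝ) = inner ℝ (v l) (v l) := (inner_self_of_norm_one h1).symm
      nth_rewrite 1 [h5] at h6
      rw [sum_inner] at h6
      simp_rw [real_inner_smul_left, h4] at h6
      rw [Finset.mem_coe, Finset.mem_filter]
      refine ⟨Finset.mem_univ _, h3, ?_⟩
      have h7 : (∑ i, ∑ k, (A i k : ℝ) * (boolSign (s l i) * boolSign (s l k))) = 3 * D := by
        have h8 : ∑ i, (∑ k, (A i k : ℝ) * boolSign (s l k)) / D * (boolSign (s l i) / 3) =
            1 / (3 * D) * ∑ i, ∑ k, (A i k : ℝ) * (boolSign (s l i) * boolSign (s l k)) := by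
          rw [Finset.mul_sum]
          refine Finset.sum_congr rfl fun i _ => ?_
          have : ∑ k, (A i k : ℝ) * (boolSign (s l i) * boolSign (s l k)) =
              boolSign (s l i) * ∑ k, (A i k : ℝ) * boolSign (s l k) := by
            rw [Finset.mul_sum]
            exact Finset.sum_congr rfl fun k _ => by ring
          rw [this]; field_simp
        rw [h8] at h6
        rw [eq_comm, one_div, inv_mul_eq_one₀ (by positivity)] at h6
        exact h6.symm
      exact_mod_cast h7
    · intro l hl l' hl' hll
      obtain ⟨-, h2, -, h4⟩ := hvs l hl
      obtain ⟨-, h2', -, h4'⟩ := hvs l' hl'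
      rw [h2, h2', h.eq_sum hK hc h4, h.eq_sum hK hc h4', hll]
  have hR : (Set.range fun i => Submodule.span ℝ {K i}).encard ≤ Fintype.card α := by
    rw [← Set.image_univ]
    refine (Set.encard_image_le _ _).trans ?_
    rw [Set.encard_univ, ENat.card_eq_coe_fintype_card]
  push_cast
  exact (Set.encard_le_encard hsub).trans ((Set.encard_union_le _ _).trans (add_le_add hR hZ))

/-- A large enough equiangular set that contains a configuration is determined by it. -/
lemma ConfigData.eq_configLines (h : ConfigData α M A D i₀ n) {K : α → E}
    (hK : ∀ i j, inner ℝ (K i) (K j) = (M i j : ℝ) / 3) (hc : Fintype.card α = finrank ℝ E)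
    {ι : Type*} {x : ι → E} (hx : IsEquiSystem x (1 / 3)) (f : α → ι) (hf : ∀ i, K i = x (f i))
    {Λ : Set (Submodule ℝ E)} (hΛ : Λ = Set.range fun i => Submodule.span ℝ {x i})
    (hcard : (Fintype.card α + n : ℕ) ≤ Λ.encard) : Λ = configLines K := by
  have hsub : Λ ⊆ configLines K := by
    rw [hΛ]
    rintro _ ⟨l, rfl⟩
    by_cases hl : ∃ i, l = f i
    · obtain ⟨i, rfl⟩ := hl
      exact Or.inl ⟨i, by rw [hf]⟩
    · push Not at hl
      refine Or.inr ⟨x l, hx.norm_eq l, rfl, fun i => ?_⟩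
      rw [hf]
      exact hx.abs_inner _ _ (hl i).symm
  have hle := h.encard_configLines_le hK hc
  refine Set.Finite.eq_of_subset_of_encard_le ?_ hsub (hle.trans hcard)
  exact (Set.finite_of_encard_le_coe hle).subset hsub

/-- The index type of a triad, `m` members of a pillar, and a member of another pillar. -/
abbrev PillarIdx (m : ℕ) := Fin 3 ⊕ Option (Fin m)

/-- Three times the Gram matrix of a triad, `m` members of a pillar, and a member of another
pillar. -/
def pillarGram (m : ℕ) : PillarIdx m → PillarIdx m → ℤ
  | .inl i, .inl j => if i = j then 3 else -1
  | .inl i, .inr (some _) => ![1, 1, -1] i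
  | .inl i, .inr none => ![1, -1, 1] i
  | .inr (some _), .inl i => ![1, 1, -1] i
  | .inr none, .inl i => ![1, -1, 1] i
  | .inr (some i), .inr (some j) => if i = j then 3 else 1
  | .inr none, .inr none => 3
  | .inr none, .inr (some _) => 1
  | .inr (some _), .inr none => 1

/-- The inverse of `pillarGram m`, up to the factor `8 - 2 m`. -/
def pillarGramInv (m : ℕ) : PillarIdx m → PillarIdx m → ℤ
  | .inl i, .inl j => ![![5 - (m : ℤ), 2, 3 - m], ![2, 4, 2 - (m : ℤ)],
      ![3 - (m : ℤ), 2 - m, 5 - m]] i j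
  | .inl i, .inr (some _) => ![-1, -2, 1] i
  | .inl i, .inr none => ![(m : ℤ) - 2, m, -2] i
  | .inr (some _), .inl i => ![-1, -2, 1] i
  | .inr none, .inl i => ![(m : ℤ) - 2, m, -2] i
  | .inr (some i), .inr (some j) => if i = j then 5 - (m : ℤ) else 1
  | .inr none, .inr none => 4
  | .inr none, .inr (some _) => -2
  | .inr (some _), .inr none => -2

/-- The numbers 5, 10, 21 of sign vectors are exactly what the bases of 5, 6, 7 vectors lack of 10,
16, 28 lines. This coincidence yields uniqueness. -/
lemma configData_one : ConfigData (PillarIdx 1) (pillarGram 1) (pillarGramInv 1) 6 (.inl 0) 5 :=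
  ⟨by decide, by decide +kernel, by decide +kernel, by decide +kernel⟩

lemma configData_two : ConfigData (PillarIdx 2) (pillarGram 2) (pillarGramInv 2) 4 (.inl 0) 10 :=
  ⟨by decide, by decide +kernel, by decide +kernel, by decide +kernel⟩

lemma configData_three :
    ConfigData (PillarIdx 3) (pillarGram 3) (pillarGramInv 3) 2 (.inl 0) 21 :=
  ⟨by decide, by decide +kernel, by decide +kernel, by decide +kernel⟩

end config

/-! ### Uniqueness of the maximum sets in dimensions 5, 6 and 7. -/

section uniqueness

variable {E : Type*} [NormedAddCommGroup E] [InnerProductSpace ℝ E]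

/-- A triad, `m` members of a pillar, and a member of another pillar. -/
def pillarConfig {m : ℕ} (p q r y : E) (z : Fin m → E) : PillarIdx m → E :=
  Sum.elim ![p, q, r] fun i => i.elim y z

lemma inner_pillarConfig {m : ℕ} {p q r y : E} {z : Fin m → E} (ht : IsTriad (1 / 3) p q r)
    (hz : ∀ i, IsPillar (1 / 3) p q r (z i))
    (hi : ∀ i j, i ≠ j → inner ℝ (z i) (z j) = (1 / 3 : ℝ)) (hy : IsPillar (1 / 3) p r q y)
    (hzy : ∀ i, inner ℝ (z i) y = (1 / 3 : ℝ)) (i j : PillarIdx m) :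
    inner ℝ (pillarConfig p q r y z i) (pillarConfig p q r y z j) = (pillarGram m i j : ℝ) / 3 := by
  rcases i with i | _ | i <;> rcases j with j | _ | j
  · fin_cases i <;> fin_cases j <;> simp [pillarConfig, pillarGram, ht.norm_p, ht.norm_q,
      ht.norm_r, ht.inner_pq, ht.inner_pr, ht.inner_qr, real_inner_comm p q, real_inner_comm p r,
      real_inner_comm q r] <;> norm_num
  · fin_cases i <;> simp [pillarConfig, pillarGram, hy.inner_p, hy.inner_q, hy.inner_r] <;> norm_num
  · fin_cases i <;>
      simp [pillarConfig, pillarGram, (hz j).inner_p, (hz j).inner_q, (hz j).inner_r] <;> norm_num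
  · rw [real_inner_comm]
    fin_cases j <;> simp [pillarConfig, pillarGram, hy.inner_p, hy.inner_q, hy.inner_r] <;> norm_num
  · simp [pillarConfig, pillarGram, hy.norm_v]
  · rw [real_inner_comm]
    simp [pillarConfig, pillarGram, hzy]
  · rw [real_inner_comm]
    fin_cases j <;>
      simp [pillarConfig, pillarGram, (hz i).inner_p, (hz i).inner_q, (hz i).inner_r] <;> norm_num
  · simp [pillarConfig, pillarGram, hzy]
  · by_cases hij : i = j
    · subst hij; simp [pillarConfig, pillarGram, (hz i).norm_v]
    · simp [pillarConfig, pillarGram, hij, hi i j hij]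

variable [FiniteDimensional ℝ E]

/-- The parameters of the maximum equiangular sets in dimensions `m + 4 = 5, 6, 7`. -/
def IsGoodParameter (m c : ℕ) : Prop := m = 1 ∧ c = 1 ∨ m = 2 ∧ c = 2 ∨ m = 3 ∧ c = 4

/-- Once `κ ≤ 1 / 3` is known from the pillars, the relative bound gives at most 10, 16, 28 vectors,
and equality forces `κ = 1 / 3`. -/
lemma IsEquiSystem.card_le_of_parameter {ι : Type*} [Fintype ι] {x : ι → E} {κ : ℝ} {m c : ℕ}
    (hmc : IsGoodParameter m c) (hd : finrank ℝ E = m + 4) (h : IsEquiSystem x κ) (h0 : 0 ≤ κ)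
    (h1 : κ < 1) (hN : 4 + 6 * c ≤ Fintype.card ι) : Fintype.card ι = 4 + 6 * c ∧ κ = 1 / 3 := by
  have hle : κ ≤ 1 / 3 := by
    refine h.le_one_third h1 ?_ ?_ <;> rcases hmc with ⟨rfl, rfl⟩ | ⟨rfl, rfl⟩ | ⟨rfl, rfl⟩ <;> omega
  have hrel := h.relative_bound
  set N := Fintype.card ι with hNdef
  have hN' : (4 + 6 * c : ℝ) ≤ N := by exact_mod_cast hN
  have hpos : (0 : ℝ) < N := by
    have : (0 : ℝ) ≤ c := by positivity
    linarith
  rw [hd] at hrel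
  push_cast at hrel
  have hrel2 : (N : ℝ) ≤ (m + 4) * (1 + (N - 1) * κ ^ 2) := by
    have : (N : ℝ) * N ≤ N * ((m + 4) * (1 + (N - 1) * κ ^ 2)) := by linarith
    exact le_of_mul_le_mul_left this hpos
  have hsq : κ ^ 2 ≤ 1 / 9 := by nlinarith
  have hmono : (N - 1 : ℝ) * κ ^ 2 ≤ (N - 1) * (1 / 9) := by
    apply mul_le_mul_of_nonneg_left hsq
    have : (0 : ℝ) ≤ c := by positivity
    linarith
  have hNeq : N = 4 + 6 * c := by
    refine le_antisymm ?_ hN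
    have : (N : ℝ) ≤ (4 + 6 * c : ℕ) := by
      rcases hmc with ⟨rfl, rfl⟩ | ⟨rfl, rfl⟩ | ⟨rfl, rfl⟩ <;> push_cast at * <;> linarith
    exact_mod_cast this
  refine ⟨hNeq, le_antisymm hle ?_⟩
  rw [hNeq] at hrel2
  have : 1 / 9 ≤ κ ^ 2 := by
    rcases hmc with ⟨rfl, rfl⟩ | ⟨rfl, rfl⟩ | ⟨rfl, rfl⟩ <;> push_cast at hrel2 <;> linarith
  nlinarith

lemma exists_configData {m c : ℕ} (hmc : IsGoodParameter m c) :
    ∃ (D : ℤ) (n : ℕ), ConfigData (PillarIdx m) (pillarGram m) (pillarGramInv m) D (.inl 0) n ∧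
      m + 4 + n = 4 + 6 * c := by
  rcases hmc with ⟨rfl, rfl⟩ | ⟨rfl, rfl⟩ | ⟨rfl, rfl⟩
  · exact ⟨6, 5, configData_one, rfl⟩
  · exact ⟨4, 10, configData_two, rfl⟩
  · exact ⟨2, 21, configData_three, rfl⟩

/-- The structure of the maximum equiangular sets in dimensions 5, 6 and 7. -/
lemma IsEquiangular.exists_config {m c : ℕ} (hmc : IsGoodParameter m c)
    (hd : finrank ℝ E = m + 4) {Λ : Set (Submodule ℝ E)} (hΛ : IsEquiangular Λ)
    (hN : (4 + 6 * c : ℕ) ≤ Λ.encard) :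
    ∃ K : PillarIdx m → E, (∀ i j, inner ℝ (K i) (K j) = (pillarGram m i j : ℝ) / 3) ∧
      Λ = configLines K := by
  classical
  have hle : Λ.encard ≤ (4 + 6 * c : ℕ) := hΛ.encard_le _ fun κ x h0 h1 hx => by
    have := (hx.card_le_of_parameter hmc hd h0 h1 (by simp)).1
    simp at this
  have heq : Λ.encard = (4 + 6 * c : ℕ) := le_antisymm hle hN
  have : Fintype Λ := (Set.finite_of_encard_eq_coe heq).fintype
  have hcard : Fintype.card Λ = 4 + 6 * c := by
    rw [Set.encard_eq_coe_toFinset_card] at heq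
    rw [← Set.toFinset_card]; exact_mod_cast heq
  obtain ⟨κ, u, h0, h1, hs, hspan⟩ := hΛ.exists_system
  let e := (Fintype.equivFinOfCardEq hcard).symm
  have hx := hs.comp e e.injective
  obtain ⟨-, rfl⟩ := hx.card_le_of_parameter hmc hd h0 h1 (by simp)
  obtain ⟨x', i, j, k, hsgn, hij, hik, hjk, hn⟩ := hx.exists_normalized (by norm_num) (by norm_num)
    (by rw [hd, Fintype.card_fin]
        rcases hmc with ⟨rfl, rfl⟩ | ⟨rfl, rfl⟩ | ⟨rfl, rfl⟩ <;> omega)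
  have hdich := hn.card_dichotomy (c := c) (by
    rw [hd]
    rcases hmc with ⟨rfl, rfl⟩ | ⟨rfl, rfl⟩ | ⟨rfl, rfl⟩ <;> intro n <;> omega)
  rw [Fintype.card_fin, hd] at hdich
  obtain ⟨l, hl, hlc⟩ := ((hdich.resolve_left (by
    rcases hmc with ⟨rfl, rfl⟩ | ⟨rfl, rfl⟩ | ⟨rfl, rfl⟩ <;> omega)).resolve_left (by
    rcases hmc with ⟨rfl, rfl⟩ | ⟨rfl, rfl⟩ | ⟨rfl, rfl⟩ <;> omega)).2 rfl (by
    rcases hmc with ⟨rfl, rfl⟩ | ⟨rfl, rfl⟩ | ⟨rfl, rfl⟩ <;> omega)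
  set X := (pillarSet x' (1 / 3) (x' i) (x' j) (x' k)).filter
    fun a => inner ℝ (x' a) (x' l) = (1 / 3 : ℝ) with hX
  -- In dimension 7 only three of the four clique members are used: with four, the residual of the
  -- vector from the other pillar would depend on theirs (the factor `8 - 2 m` vanishes).
  have hmX : m ≤ X.card := by
    rw [hlc]; rcases hmc with ⟨rfl, rfl⟩ | ⟨rfl, rfl⟩ | ⟨rfl, rfl⟩ <;> omega
  let g : Fin m → Fin (4 + 6 * c) := fun a => (X.equivFin.symm (Fin.castLE hmX a) : Fin _)
  have hg : Function.Injective g := fun a b hab => by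
    simpa using X.equivFin.symm.injective (Subtype.ext hab)
  have hgX : ∀ a, g a ∈ X := fun a => (X.equivFin.symm _).2
  have hgz : ∀ a, IsPillar (1 / 3) (x' i) (x' j) (x' k) (x' (g a)) := fun a =>
    mem_pillarSet.1 (Finset.mem_filter.1 (hgX a)).1
  have hgy : ∀ a, inner ℝ (x' (g a)) (x' l) = (1 / 3 : ℝ) := fun a =>
    (Finset.mem_filter.1 (hgX a)).2
  have hs' := hn.isEquiSystem
  have hgi : ∀ a b, a ≠ b → inner ℝ (x' (g a)) (x' (g b)) = (1 / 3 : ℝ) := fun a b hab =>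
    (hgz a).inner_eq_of_cross hn.triad (hgz b) hl (hs'.inner_eq fun h => hab (hg h))
      (by rw [hgy, hgy]) (by rw [hgy]; norm_num)
  let K := pillarConfig (x' i) (x' j) (x' k) (x' l) fun a => x' (g a)
  have hK := inner_pillarConfig hn.triad hgz hgi hl hgy
  refine ⟨K, hK, ?_⟩
  obtain ⟨D, n, hdata, hn2⟩ := exists_configData hmc
  refine hdata.eq_configLines hK (by rw [hd]; simp; omega) hs'
    (Sum.elim ![i, j, k] fun a => a.elim l g) ?_ ?_ ?_
  · rintro (a | _ | a)
    · fin_cases a <;> rfl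
    · rfl
    · rfl
  · have hspan' : ∀ a, Submodule.span ℝ {x' a} = (e a : Submodule ℝ E) := by
      intro a
      rw [hspan]
      rcases hsgn a with h | h <;> rw [h]
      · rfl
      · rw [← Set.neg_singleton, Submodule.span_neg]; rfl
    simp only [hspan']
    ext l
    constructor
    · intro hl; exact ⟨e.symm ⟨l, hl⟩, by simp⟩
    · rintro ⟨a, rfl⟩; exact (e a).2
  · rw [heq]
    simp only [Fintype.card_sum, Fintype.card_fin, Fintype.card_option]
    exact_mod_cast (by omega)

/-- Maximum equiangular sets in dimensions 5, 6 and 7 are unique up to isometry. -/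
lemma IsEquiangular.exists_isometry {E' : Type*} [NormedAddCommGroup E'] [InnerProductSpace ℝ E']
    [FiniteDimensional ℝ E'] {m c : ℕ} (hmc : IsGoodParameter m c) (hd : finrank ℝ E = m + 4)
    (hd' : finrank ℝ E' = m + 4) {Λ : Set (Submodule ℝ E)} {Λ' : Set (Submodule ℝ E')}
    (hΛ : IsEquiangular Λ) (hΛ' : IsEquiangular Λ') (hN : (4 + 6 * c : ℕ) ≤ Λ.encard)
    (hN' : (4 + 6 * c : ℕ) ≤ Λ'.encard) :
    ∃ ψ : E ≃ₗᵢ[ℝ] E', (fun l => l.map (ψ.toLinearEquiv : E →ₗ[ℝ] E')) '' Λ = Λ' := by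
  obtain ⟨K, hK, rfl⟩ := hΛ.exists_config hmc hd hN
  obtain ⟨K', hK', rfl⟩ := hΛ'.exists_config hmc hd' hN'
  obtain ⟨D, n, hdata, -⟩ := exists_configData hmc
  obtain ⟨ψ, hψ⟩ := hdata.exists_isometry hK hK' (by rw [hd]; simp; omega) (by rw [hd']; simp; omega)
  exact ⟨ψ, image_configLines ψ hψ⟩

end uniqueness

/-! ### Intersection numbers of the Steiner system. -/

section steiner

variable {𝓑 : Finset (Finset (Fin 23))}

/-- The blocks that contain `P`. -/
def blocksThrough (𝓑 : Finset (Finset (Fin 23))) (P : Finset (Fin 23)) :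
    Finset (Finset (Fin 23)) := 𝓑.filter (P ⊆ ·)

lemma mem_blocksThrough {P B : Finset (Fin 23)} : B ∈ blocksThrough 𝓑 P ↔ B ∈ 𝓑 ∧ P ⊆ B := by
  simp [blocksThrough]

/-- Double counting of the pairs `(B, R)` with `P ⊆ B` and `R ⊆ Q ∩ B`, `R` of size `j`. -/
lemma sum_choose_eq (𝓑 : Finset (Finset (Fin 23))) (P Q : Finset (Fin 23)) (j : ℕ) :
    ∑ B ∈ blocksThrough 𝓑 P, (Q ∩ B).card.choose j =
      ∑ R ∈ Q.powersetCard j, (blocksThrough 𝓑 (P ∪ R)).card := by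
  have h1 : ∀ B ∈ blocksThrough 𝓑 P, (Q ∩ B).card.choose j =
      ∑ R ∈ Q.powersetCard j, if R ⊆ B then 1 else 0 := by
    intro B _
    rw [← Finset.card_powersetCard, Finset.sum_boole, Nat.cast_id]
    congr 1
    ext R
    simp only [Finset.mem_powersetCard, Finset.mem_filter, Finset.subset_inter_iff]
    tauto
  rw [Finset.sum_congr rfl h1, Finset.sum_comm]
  refine Finset.sum_congr rfl fun R _ => ?_
  rw [Finset.sum_boole, Nat.cast_id]
  congr 1
  ext B
  simp only [Finset.mem_filter, mem_blocksThrough, Finset.union_subset_iff]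
  tauto

variable (h : IsSteinerSystem 4 7 23 𝓑)

include h

lemma IsSteinerSystem.eq_of_four_le {B B' : Finset (Fin 23)} (hB : B ∈ 𝓑) (hB' : B' ∈ 𝓑)
    (hc : 4 ≤ (B ∩ B').card) : B = B' := by
  obtain ⟨T, hT, hTc⟩ := Finset.exists_subset_card_eq hc
  rw [Finset.subset_inter_iff] at hT
  exact (h.2 T hTc).unique ⟨hB, hT.1⟩ ⟨hB', hT.2⟩

lemma IsSteinerSystem.card_through_four {P : Finset (Fin 23)} (hP : P.card = 4) :
    (blocksThrough 𝓑 P).card = 1 := by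
  obtain ⟨B, hB, hu⟩ := h.2 P hP
  rw [Finset.card_eq_one]
  refine ⟨B, Finset.eq_singleton_iff_unique_mem.2 ⟨mem_blocksThrough.2 hB, fun B' hB' => ?_⟩⟩
  exact hu B' (mem_blocksThrough.1 hB')

lemma IsSteinerSystem.card_through_succ {P : Finset (Fin 23)} {j l : ℕ} (hP : P.card = j)
    (hj : ∀ R : Finset (Fin 23), R.card = j + 1 → (blocksThrough 𝓑 R).card = l) :
    (7 - j) * (blocksThrough 𝓑 P).card = (23 - j) * l := by
  have h1 := sum_choose_eq 𝓑 P Pᶜ 1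
  have h2 : ∀ B ∈ blocksThrough 𝓑 P, (Pᶜ ∩ B).card.choose 1 = 7 - j := by
    intro B hB
    rw [mem_blocksThrough] at hB
    rw [Nat.choose_one_right, Finset.inter_comm, ← Finset.sdiff_eq_inter_compl,
      Finset.card_sdiff_of_subset hB.2, h.1 B hB.1, hP]
  have h3 : ∀ R ∈ Pᶜ.powersetCard 1, (blocksThrough 𝓑 (P ∪ R)).card = l := by
    intro R hR
    rw [Finset.mem_powersetCard] at hR
    refine hj _ ?_
    rw [Finset.card_union_of_disjoint, hP, hR.2]
    exact Finset.disjoint_right.2 fun a ha => Finset.mem_compl.1 (hR.1 ha)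
  rw [Finset.sum_congr rfl h2, Finset.sum_congr rfl h3, Finset.sum_const, Finset.sum_const,
    Finset.card_powersetCard, Nat.choose_one_right, Finset.card_compl, hP, Fintype.card_fin] at h1
  simpa [mul_comm] using h1

/-- The numbers of blocks through `0, …, 4` points. -/
lemma IsSteinerSystem.card_through {P : Finset (Fin 23)} (hP : P.card ≤ 4) :
    (blocksThrough 𝓑 P).card = [253, 77, 21, 5, 1].getD P.card 0 := by
  have e4 := fun (P : Finset (Fin 23)) hP => h.card_through_four (P := P) hP
  have e3 : ∀ P : Finset (Fin 23), P.card = 3 → (blocksThrough 𝓑 P).card = 5 := fun P hP => by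
    have := h.card_through_succ hP e4
    omega
  have e2 : ∀ P : Finset (Fin 23), P.card = 2 → (blocksThrough 𝓑 P).card = 21 := fun P hP => by
    have := h.card_through_succ hP e3
    omega
  have e1 : ∀ P : Finset (Fin 23), P.card = 1 → (blocksThrough 𝓑 P).card = 77 := fun P hP => by
    have := h.card_through_succ hP e2
    omega
  have e0 : ∀ P : Finset (Fin 23), P.card = 0 → (blocksThrough 𝓑 P).card = 253 := fun P hP => by
    have := h.card_through_succ hP e1
    omega
  obtain hc | hc | hc | hc | hc : P.card = 0 ∨ P.card = 1 ∨ P.card = 2 ∨ P.card = 3 ∨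
    P.card = 4 := by omega
  · rw [e0 P hc, hc]; rfl
  · rw [e1 P hc, hc]; rfl
  · rw [e2 P hc, hc]; rfl
  · rw [e3 P hc, hc]; rfl
  · rw [e4 P hc, hc]; rfl

lemma IsSteinerSystem.card_eq : 𝓑.card = 253 := by
  have := h.card_through (P := ∅) (by simp)
  simpa [blocksThrough] using this

lemma IsSteinerSystem.sum_choose {P Q : Finset (Fin 23)} (hd : Disjoint P Q) {j : ℕ}
    (hj : P.card + j ≤ 4) : ∑ B ∈ blocksThrough 𝓑 P, (Q ∩ B).card.choose j =
      Q.card.choose j * [253, 77, 21, 5, 1].getD (P.card + j) 0 := by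
  rw [sum_choose_eq]
  have h3 : ∀ R ∈ Q.powersetCard j, (blocksThrough 𝓑 (P ∪ R)).card =
      [253, 77, 21, 5, 1].getD (P.card + j) 0 := by
    intro R hR
    rw [Finset.mem_powersetCard] at hR
    have : (P ∪ R).card = P.card + j := by
      rw [Finset.card_union_of_disjoint (hd.mono_right hR.1), hR.2]
    rw [h.card_through (by omega), this]
  rw [Finset.sum_congr rfl h3, Finset.sum_const, Finset.card_powersetCard, smul_eq_mul]

lemma IsSteinerSystem.sum_choose_all (Q : Finset (Fin 23)) {j : ℕ} (hj : j ≤ 4) :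
    ∑ B ∈ 𝓑, (Q ∩ B).card.choose j = Q.card.choose j * [253, 77, 21, 5, 1].getD j 0 := by
  have := h.sum_choose (P := ∅) (Q := Q) (Finset.disjoint_empty_left _) (j := j) (by simpa using hj)
  simpa [blocksThrough] using this

/-- Distinct blocks meet in one or three points. -/
lemma IsSteinerSystem.card_inter {B B' : Finset (Fin 23)} (hB : B ∈ 𝓑) (hB' : B' ∈ 𝓑)
    (hne : B ≠ B') : (B ∩ B').card = 1 ∨ (B ∩ B').card = 3 := by
  have hle : ∀ C ∈ 𝓑.erase B, (B ∩ C).card ≤ 3 := by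
    intro C hC
    by_contra hcon
    exact Finset.ne_of_mem_erase hC
      (h.eq_of_four_le hB (Finset.mem_of_mem_erase hC) (by omega)).symm
  have hs : ∀ j ≤ 4, ∑ C ∈ 𝓑.erase B, (((B ∩ C).card.choose j : ℕ) : ℤ) =
      (Nat.choose 7 j * [253, 77, 21, 5, 1].getD j 0 : ℕ) - (Nat.choose 7 j : ℕ) := by
    intro j hj
    have h1 := h.sum_choose_all B hj
    rw [← Finset.add_sum_erase _ _ hB, Finset.inter_self, h.1 B hB] at h1
    rw [← h1]; push_cast; ring
  have s0 := hs 0 (by norm_num)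
  have s1 := hs 1 (by norm_num)
  have s2 := hs 2 (by norm_num)
  have s3 := hs 3 (by norm_num)
  norm_num [Nat.choose] at s0 s1 s2 s3
  have hB'' : B' ∈ 𝓑.erase B := Finset.mem_erase.2 ⟨hne.symm, hB'⟩
  -- For an intersection of size 0, 1, 2, 3 the summand is 0, 0, 1, 0, so size 2 does not occur; the
  -- summand of `z0` is 1, 0, 0, 0 and excludes size 0.
  have z2 : ∑ C ∈ 𝓑.erase B, ((((B ∩ C).card.choose 2 : ℕ) : ℤ) - 3 *
      (((B ∩ C).card.choose 3 : ℕ) : ℤ)) = 0 := by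
    rw [Finset.sum_sub_distrib, ← Finset.mul_sum]
    linarith
  have z0 : ∑ C ∈ 𝓑.erase B, ((1 : ℤ) - ((B ∩ C).card : ℤ) + (((B ∩ C).card.choose 2 : ℕ) : ℤ) -
      (((B ∩ C).card.choose 3 : ℕ) : ℤ)) = 0 := by
    rw [Finset.sum_sub_distrib, Finset.sum_add_distrib, Finset.sum_sub_distrib]
    simp only [Finset.sum_const, nsmul_eq_mul, mul_one]
    rw [s1, s2, s3, Finset.card_erase_of_mem hB, h.card_eq]
    norm_num
  have t2 := (Finset.sum_eq_zero_iff_of_nonneg (fun C hC => by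
    have := hle C hC
    interval_cases (B ∩ C).card <;> simp [Nat.choose])).1 z2 B' hB''
  have t0 := (Finset.sum_eq_zero_iff_of_nonneg (fun C hC => by
    have := hle C hC
    interval_cases (B ∩ C).card <;> simp [Nat.choose])).1 z0 B' hB''
  have hle' := hle B' hB''
  interval_cases (B ∩ B').card <;> simp_all [Nat.choose]

lemma IsSteinerSystem.odd_inter {B B' : Finset (Fin 23)} (hB : B ∈ 𝓑) (hB' : B' ∈ 𝓑) :
    Odd (B ∩ B').card := by
  by_cases hne : B = B'
  · rw [hne, Finset.inter_self, h.1 B' hB']; decide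
  · rcases h.card_inter hB hB' hne with h1 | h1 <;> rw [h1] <;> decide

/-- A set of seven points that meets all blocks in an odd number of points is a block. -/
lemma IsSteinerSystem.mem_of_odd {Y : Finset (Fin 23)} (hY : Y.card = 7)
    (hodd : ∀ B ∈ 𝓑, Odd (Y ∩ B).card) : Y ∈ 𝓑 := by
  by_contra hcon
  have hlt : ∀ B ∈ 𝓑, (Y ∩ B).card < 7 := by
    intro B hB
    rw [← hY]
    refine lt_of_le_of_ne (Finset.card_le_card Finset.inter_subset_left) fun hc => hcon ?_
    have h1 := Finset.eq_of_subset_of_card_le Finset.inter_subset_left hc.ge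
    have h2 : Y ⊆ B := Finset.inter_eq_left.1 h1
    rwa [Finset.eq_of_subset_of_card_le h2 (by rw [hY, h.1 B hB])]
  have s2 := h.sum_choose_all Y (j := 2) (by norm_num)
  have s3 := h.sum_choose_all Y (j := 3) (by norm_num)
  rw [hY] at s2 s3
  -- For `x = 1, 3, 5` the value `3 · C(x, 3) - C(x, 2)` is 0, 0, 20, but the total over all blocks
  -- is `3 · 35 · 5 - 21 · 21 = 84`.
  have hdvd : (20 : ℤ) ∣ ∑ B ∈ 𝓑, (3 * (((Y ∩ B).card.choose 3 : ℕ) : ℤ) -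
      (((Y ∩ B).card.choose 2 : ℕ) : ℤ)) := by
    refine Finset.dvd_sum fun B hB => ?_
    have h1 := hlt B hB
    have h2 := hodd B hB
    interval_cases (Y ∩ B).card <;> revert h2 <;> decide
  rw [Finset.sum_sub_distrib, ← Finset.mul_sum, ← Nat.cast_sum, ← Nat.cast_sum, s2, s3] at hdvd
  revert hdvd
  decide

end steiner

/-! ### The 276 lines in dimension 23. -/

section partOne

/-- Rescaling vectors of equal length. -/
lemma IsEquiSystem.of_inner {ι E : Type*} [NormedAddCommGroup E] [InnerProductSpace ℝ E]
    {w : ι → E} {N κ : ℝ} (hN : 0 < N) (h1 : ∀ i, inner ℝ (w i) (w i) = N)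
    (h2 : ∀ i j, i ≠ j → |inner ℝ (w i) (w j)| = κ * N) :
    IsEquiSystem (fun i => (√N)⁻¹ • w i) κ := by
  have hs : √N ≠ 0 := (Real.sqrt_pos.2 hN).ne'
  refine ⟨fun i => ?_, fun i j hij => ?_⟩
  · have h3 : ‖w i‖ = √N := by
      rw [← h1 i, real_inner_self_eq_norm_sq, Real.sqrt_sq (norm_nonneg _)]
    rw [norm_smul, h3, norm_inv, Real.norm_of_nonneg (Real.sqrt_nonneg _), inv_mul_cancel₀ hs]
  · rw [real_inner_smul_left, real_inner_smul_right, ← mul_assoc, abs_mul, h2 i j hij,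
      ← mul_inv, Real.mul_self_sqrt hN.le, abs_of_pos (inv_pos.2 hN)]
    field_simp

lemma span_inv_sqrt_smul {E : Type*} [NormedAddCommGroup E] [InnerProductSpace ℝ E] {N : ℝ}
    (hN : 0 < N) (w : E) : Submodule.span ℝ {(√N)⁻¹ • w} = Submodule.span ℝ {w} :=
  Submodule.span_singleton_smul_eq (IsUnit.mk0 _ (inv_ne_zero (Real.sqrt_pos.2 hN).ne')) w

/-- Block and point vectors take one value on a set and another off it, so all their products reduce
to cardinalities of intersections. -/
lemma inner_two_valued (S T : Finset (Fin 23)) (a b c d : ℝ) :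
    inner ℝ (WithLp.toLp 2 fun j => if j ∈ S then a else b : EuclideanSpace ℝ (Fin 23))
      (WithLp.toLp 2 fun j => if j ∈ T then c else d) =
      23 * (b * d) + b * (c - d) * T.card + d * (a - b) * S.card +
        (a - b) * (c - d) * (S ∩ T).card := by
  have h1 : ∀ j : Fin 23, (if j ∈ S then a else b) * (if j ∈ T then c else d) =
      b * d + b * (c - d) * (if j ∈ T then 1 else 0) + d * (a - b) * (if j ∈ S then 1 else 0) +
        (a - b) * (c - d) * (if j ∈ S ∩ T then 1 else 0) := by
    intro j
    by_cases hS : j ∈ S <;> by_cases hT : j ∈ T <;> simp [hS, hT] <;> ring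
  rw [PiLp.inner_apply]
  simp only [RCLike.inner_apply, conj_trivial]
  simp_rw [mul_comm (if _ ∈ T then c else d), h1, Finset.sum_add_distrib, ← Finset.mul_sum,
    Finset.sum_boole, Finset.filter_univ_mem, Finset.sum_const, Finset.card_univ, Fintype.card_fin,
    nsmul_eq_mul]
  push_cast
  ring

lemma pointVector_eq (i : Fin 23) : pointVector i =
    WithLp.toLp 2 fun j => if j ∈ ({i} : Finset (Fin 23)) then 44 - √27 else -2 - √27 := by
  simp [pointVector]

lemma sqrt_three_mul : √3 * √3 = 3 := Real.mul_self_sqrt (by norm_num)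

lemma sqrt_twentySeven : √27 = 3 * √3 := by
  rw [show (27 : ℝ) = 3 ^ 2 * 3 by norm_num, Real.sqrt_mul (by norm_num),
    Real.sqrt_sq (by norm_num)]

lemma inner_blockVector {B B' : Finset (Fin 23)} (hB : B.card = 7) (hB' : B'.card = 7) :
    inner ℝ (blockVector B) (blockVector B') = 529 * ((B ∩ B').card - 2 : ℝ) := by
  rw [blockVector, blockVector, inner_two_valued, hB, hB']
  push_cast
  linear_combination 23 * sqrt_three_mul

lemma inner_pointVector (i j : Fin 23) :
    inner ℝ (pointVector i) (pointVector j) = if i = j then (2645 : ℝ) else 529 := by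
  rw [pointVector_eq, pointVector_eq, inner_two_valued, sqrt_twentySeven]
  by_cases hij : i = j
  · subst hij
    simp only [Finset.inter_self, Finset.card_singleton, if_true]
    push_cast
    linear_combination 207 * sqrt_three_mul
  · rw [Finset.singleton_inter_of_notMem (by simpa using hij), if_neg hij]
    simp only [Finset.card_singleton, Finset.card_empty]
    push_cast
    linear_combination 207 * sqrt_three_mul

lemma inner_blockVector_pointVector {B : Finset (Fin 23)} (hB : B.card = 7) (i : Fin 23) :
    inner ℝ (blockVector B) (pointVector i) = if i ∈ B then (529 : ℝ) else -529 := by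
  rw [pointVector_eq, blockVector, inner_two_valued, sqrt_twentySeven, hB]
  by_cases hij : i ∈ B
  · rw [Finset.inter_singleton_of_mem hij, if_pos hij]
    simp only [Finset.card_singleton]
    push_cast
    linear_combination -69 * sqrt_three_mul
  · rw [Finset.inter_singleton_of_notMem hij, if_neg hij]
    simp only [Finset.card_singleton, Finset.card_empty]
    push_cast
    linear_combination -69 * sqrt_three_mul

/-- The vectors of the blocks and points. -/
noncomputable def steinerVector (𝓑 : Finset (Finset (Fin 23))) :
    𝓑 ⊕ Fin 23 → EuclideanSpace ℝ (Fin 23) :=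
  Sum.elim (fun B => blockVector B) pointVector

variable {𝓑 : Finset (Finset (Fin 23))}

lemma steinerLines_eq_range :
    steinerLines 𝓑 = Set.range fun i => Submodule.span ℝ {steinerVector 𝓑 i} := by
  ext l
  constructor
  · rintro (⟨B, hB, rfl⟩ | ⟨i, rfl⟩)
    · exact ⟨.inl ⟨B, hB⟩, rfl⟩
    · exact ⟨.inr i, rfl⟩
  · rintro ⟨B | i, rfl⟩
    · exact Or.inl ⟨B, B.2, rfl⟩
    · exact Or.inr ⟨i, rfl⟩

variable (h : IsSteinerSystem 4 7 23 𝓑)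

include h

lemma IsSteinerSystem.inner_self_steinerVector (i : 𝓑 ⊕ Fin 23) :
    inner ℝ (steinerVector 𝓑 i) (steinerVector 𝓑 i) = (2645 : ℝ) := by
  rcases i with B | i
  · simp only [steinerVector, Sum.elim_inl]
    rw [inner_blockVector (h.1 B B.2) (h.1 B B.2), Finset.inter_self, h.1 B B.2]; norm_num
  · simp only [steinerVector, Sum.elim_inr]
    rw [inner_pointVector, if_pos rfl]

lemma IsSteinerSystem.abs_inner_steinerVector {i j : 𝓑 ⊕ Fin 23} (hij : i ≠ j) :
    |inner ℝ (steinerVector 𝓑 i) (steinerVector 𝓑 j)| = (1 / 5 * 2645 : ℝ) := by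
  rcases i with B | i <;> rcases j with B' | j <;>
    simp only [steinerVector, Sum.elim_inl, Sum.elim_inr]
  · have hne : (B : Finset (Fin 23)) ≠ B' := fun hh => hij (by rw [Subtype.ext hh])
    rw [inner_blockVector (h.1 B B.2) (h.1 B' B'.2)]
    rcases h.card_inter B.2 B'.2 hne with h1 | h1 <;> rw [h1] <;> norm_num [abs_of_neg]
  · rw [inner_blockVector_pointVector (h.1 B B.2)]
    split_ifs <;> norm_num [abs_of_neg]
  · rw [real_inner_comm, inner_blockVector_pointVector (h.1 B' B'.2)]
    split_ifs <;> norm_num [abs_of_neg]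
  · rw [inner_pointVector, if_neg (fun hh => hij (by rw [hh]))]; norm_num

lemma IsSteinerSystem.isEquiSystem :
    IsEquiSystem (fun i => (√2645)⁻¹ • steinerVector 𝓑 i) (1 / 5) :=
  IsEquiSystem.of_inner (by norm_num) h.inner_self_steinerVector
    fun _ _ => h.abs_inner_steinerVector

lemma IsSteinerSystem.span_steinerVector_injective :
    Function.Injective fun i => Submodule.span ℝ {steinerVector 𝓑 i} := by
  have := h.isEquiSystem.span_injective (by norm_num)
  simpa only [span_inv_sqrt_smul (show (0 : ℝ) < 2645 by norm_num)] using this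

lemma IsSteinerSystem.encard_steinerLines : (steinerLines 𝓑).encard = 276 := by
  rw [steinerLines_eq_range, ← Set.image_univ, h.span_steinerVector_injective.encard_image,
    Set.encard_univ, ENat.card_eq_coe_fintype_card]
  simp [h.card_eq]

lemma IsSteinerSystem.isEquiangular_steinerLines : IsEquiangular (steinerLines 𝓑) := by
  have := h.isEquiSystem.isEquiangular
  rw [steinerLines_eq_range]
  simpa only [span_inv_sqrt_smul (show (0 : ℝ) < 2645 by norm_num)] using this

lemma IsSteinerSystem.isMaximumEquiangular_steinerLines :
    IsMaximumEquiangular (steinerLines 𝓑) := by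
  refine ⟨h.isEquiangular_steinerLines, fun Ω' hΩ' => ?_⟩
  rw [h.encard_steinerLines]
  refine hΩ'.encard_le 276 fun κ x h0 h1 hx => ?_
  have := hx.card_le_choose h0 h1
  simp [Nat.choose] at this

end partOne

/-! ### Eight points whose pairs are cut out by blocks. -/

section octad

variable {𝓑 : Finset (Finset (Fin 23))} (h : IsSteinerSystem 4 7 23 𝓑)

include h

/-- There is a set of eight points all of whose pairs of points are cut out by blocks. -/
lemma IsSteinerSystem.exists_octad : ∃ O : Finset (Fin 23), O.card = 8 ∧
    ∀ P ⊆ O, P.card = 2 → ∃ B ∈ 𝓑, B ∩ O = P := by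
  obtain ⟨B₁, h₁⟩ : 𝓑.Nonempty := Finset.card_pos.1 (by rw [h.card_eq]; norm_num)
  obtain ⟨J, hJ, hJc⟩ := Finset.exists_subset_card_eq (show 3 ≤ B₁.card by rw [h.1 B₁ h₁]; norm_num)
  have h5 := h.card_through (P := J) (by omega)
  rw [hJc] at h5
  obtain ⟨B₂, h₂, hne⟩ := Finset.exists_mem_ne (s := blocksThrough 𝓑 J) (by rw [h5]; decide) B₁
  rw [mem_blocksThrough] at h₂
  have h3 : (B₁ ∩ B₂).card = 3 := by
    have hle := Finset.card_le_card (Finset.subset_inter hJ h₂.2)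
    rcases h.card_inter h₁ h₂.1 hne.symm with h4 | h4 <;> omega
  set O : Finset (Fin 23) := (B₁ \ B₂) ∪ (B₂ \ B₁) with hO
  have hdisj : Disjoint (B₁ \ B₂) (B₂ \ B₁) :=
    Finset.disjoint_left.2 fun a ha hb => (Finset.mem_sdiff.1 ha).2 (Finset.mem_sdiff.1 hb).1
  have hOc : O.card = 8 := by
    have e1 := Finset.card_sdiff_add_card_inter B₁ B₂
    have e2 := Finset.card_sdiff_add_card_inter B₂ B₁
    rw [Finset.inter_comm B₂, h.1 B₂ h₂.1] at e2
    rw [h.1 B₁ h₁] at e1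
    rw [hO, Finset.card_union_of_disjoint hdisj]
    omega
  -- Blocks meet `B₁` and `B₂` oddly, hence their symmetric difference evenly.
  have heven : ∀ B ∈ 𝓑, Even (B ∩ O).card := by
    intro B hB
    have o1 := h.odd_inter hB h₁
    have o2 := h.odd_inter hB h₂.1
    have e1 := Finset.card_sdiff_add_card_inter (B ∩ B₁) B₂
    have e2 := Finset.card_sdiff_add_card_inter (B ∩ B₂) B₁
    have e3 : B ∩ O = ((B ∩ B₁) \ B₂) ∪ ((B ∩ B₂) \ B₁) := by
      ext a; simp only [hO, Finset.mem_inter, Finset.mem_union, Finset.mem_sdiff]; tauto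
    have e4 : Disjoint ((B ∩ B₁) \ B₂) ((B ∩ B₂) \ B₁) := by
      refine Finset.disjoint_left.2 fun a ha hb => ?_
      simp only [Finset.mem_inter, Finset.mem_sdiff] at ha hb
      exact ha.2 hb.1.2
    have e5 : B ∩ B₂ ∩ B₁ = B ∩ B₁ ∩ B₂ := by
      ext a; simp only [Finset.mem_inter]; tauto
    rw [e5] at e2
    rw [e3, Finset.card_union_of_disjoint e4]
    rw [Nat.odd_iff] at o1 o2
    rw [Nat.even_iff]
    omega
  refine ⟨O, hOc, fun P hP hPc => ?_⟩
  by_contra hcon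
  push Not at hcon
  set Q := O \ P with hQ
  have hQc : Q.card = 6 := by rw [hQ, Finset.card_sdiff_of_subset hP, hOc, hPc]
  have hPQ : Disjoint P Q := Finset.disjoint_sdiff
  have hsplit : ∀ B ∈ blocksThrough 𝓑 P, (Q ∩ B).card = 2 ∨ (Q ∩ B).card = 4 := by
    intro B hB
    rw [mem_blocksThrough] at hB
    have e1 : B ∩ O = P ∪ (Q ∩ B) := by
      ext a
      simp only [hQ, Finset.mem_inter, Finset.mem_union, Finset.mem_sdiff]
      have := @hP a
      have := @hB.2 a
      tauto
    have e2 : (B ∩ O).card = 2 + (Q ∩ B).card := by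
      rw [e1, Finset.card_union_of_disjoint (hPQ.mono_right Finset.inter_subset_left), hPc]
    have e3 := heven B hB.1
    have e4 : (B ∩ O).card ≤ 7 := by
      rw [← h.1 B hB.1]; exact Finset.card_le_card Finset.inter_subset_left
    have e5 : (Q ∩ B).card ≠ 0 := fun h0 => by
      rw [Finset.card_eq_zero] at h0
      rw [h0, Finset.union_empty] at e1
      exact hcon B hB.1 e1
    rw [Nat.even_iff] at e3
    omega
  have s0 := h.sum_choose hPQ (j := 0) (by omega)
  have s1 := h.sum_choose hPQ (j := 1) (by omega)
  have s2 := h.sum_choose hPQ (j := 2) (by omega)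
  rw [hQc, hPc] at s0 s1 s2
  -- Two four-subsets of the six points of `Q` share at least two points; with `P` this makes four
  -- common points.
  have hone : ((blocksThrough 𝓑 P).filter fun B => (Q ∩ B).card = 4).card ≤ 1 := by
    rw [Finset.card_le_one]
    intro B hB B' hB'
    simp only [Finset.mem_filter, mem_blocksThrough] at hB hB'
    refine h.eq_of_four_le hB.1.1 hB'.1.1 ?_
    have e1 : P ∪ ((Q ∩ B) ∩ (Q ∩ B')) ⊆ B ∩ B' := by
      refine Finset.union_subset (Finset.subset_inter hB.1.2 hB'.1.2) ?_
      exact Finset.inter_subset_inter Finset.inter_subset_right Finset.inter_subset_right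
    have e2 := Finset.card_le_card e1
    rw [Finset.card_union_of_disjoint
      (hPQ.mono_right (Finset.inter_subset_left.trans Finset.inter_subset_left)), hPc] at e2
    have e3 := Finset.card_union_add_card_inter (Q ∩ B) (Q ∩ B')
    have e4 : ((Q ∩ B) ∪ (Q ∩ B')).card ≤ 6 := by
      rw [← hQc]
      exact Finset.card_le_card (Finset.union_subset Finset.inter_subset_left
        Finset.inter_subset_left)
    omega
  -- With `s0, s1, s2` equal to 21, 30, 15 this identity forces two blocks that meet `Q` in four
  -- points, against `hone`.
  have hsum : ∑ B ∈ blocksThrough 𝓑 P, (Q ∩ B).card.choose 0 +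
      ∑ B ∈ blocksThrough 𝓑 P, (Q ∩ B).card.choose 2 =
      ∑ B ∈ blocksThrough 𝓑 P, (Q ∩ B).card.choose 1 +
      3 * ((blocksThrough 𝓑 P).filter fun B => (Q ∩ B).card = 4).card := by
    rw [Finset.card_filter, Finset.mul_sum, ← Finset.sum_add_distrib, ← Finset.sum_add_distrib]
    refine Finset.sum_congr rfl fun B hB => ?_
    rcases hsplit B hB with h4 | h4 <;> rw [h4] <;> rfl
  rw [s0, s1, s2] at hsum
  norm_num [Nat.choose] at hsum
  omega

end octad

/-! ### Projections of block vectors in dimensions 5, 6 and 7. -/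

section partTwo

/-- Vectors supported on `O`, of sum zero, and constant on `A`. -/
def octadSpace (O A : Finset (Fin 23)) : Submodule ℝ (EuclideanSpace ℝ (Fin 23)) where
  carrier := {u | (∀ j, j ∉ O → u j = 0) ∧ ∑ j, u j = 0 ∧ ∀ i ∈ A, ∀ j ∈ A, u i = u j}
  zero_mem' := ⟨fun _ _ => rfl, by simp, fun _ _ _ _ => rfl⟩
  add_mem' := by
    rintro u v ⟨h1, h2, h3⟩ ⟨g1, g2, g3⟩
    refine ⟨fun j hj => ?_, ?_, fun i hi j hj => ?_⟩
    · rw [PiLp.add_apply, h1 j hj, g1 j hj, add_zero]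
    · simp only [PiLp.add_apply, Finset.sum_add_distrib, h2, g2, add_zero]
    · rw [PiLp.add_apply, PiLp.add_apply, h3 i hi j hj, g3 i hi j hj]
  smul_mem' := by
    rintro c u ⟨h1, h2, h3⟩
    refine ⟨fun j hj => ?_, ?_, fun i hi j hj => ?_⟩
    · rw [PiLp.smul_apply, h1 j hj, smul_zero]
    · simp only [PiLp.smul_apply, ← Finset.smul_sum, h2, smul_zero]
    · rw [PiLp.smul_apply, PiLp.smul_apply, h3 i hi j hj]

/-- Restriction to `O \ A` is injective: a vector vanishing there is constant on `A` with sum zero,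
hence zero as `A` is not empty. -/
lemma finrank_octadSpace_le {O A : Finset (Fin 23)} (hA : A ⊆ O) (hne : A.Nonempty) :
    finrank ℝ (octadSpace O A) ≤ (O \ A).card := by
  let L : octadSpace O A →ₗ[ℝ] (↥(O \ A) → ℝ) :=
    { toFun := fun u j => (u : EuclideanSpace ℝ (Fin 23)) j
      map_add' := fun _ _ => rfl
      map_smul' := fun _ _ => rfl }
  have hL : Function.Injective L := by
    rw [injective_iff_map_eq_zero]
    rintro ⟨u, h1, h2, h3⟩ hu
    have hu' : ∀ j ∈ O \ A, u j = 0 := fun j hj => congrFun hu ⟨j, hj⟩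
    obtain ⟨a, ha⟩ := hne
    have hA0 : ∀ j, j ∉ A → u j = 0 := fun j hj => by
      by_cases hO : j ∈ O
      · exact hu' j (Finset.mem_sdiff.2 ⟨hO, hj⟩)
      · exact h1 j hO
    rw [← Finset.sum_subset (Finset.subset_univ A) (fun j _ hj => hA0 j hj),
      Finset.sum_congr rfl (fun j hj => h3 j hj a ha), Finset.sum_const, nsmul_eq_mul] at h2
    have hc : (A.card : ℝ) ≠ 0 := by
      exact_mod_cast (Finset.card_pos.2 ⟨a, ha⟩).ne'
    have ha0 := (mul_eq_zero.1 h2).resolve_left hc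
    ext j
    by_cases hj : j ∈ A
    · exact (h3 j hj a ha).trans ha0
    · exact hA0 j hj
  have := LinearMap.finrank_le_finrank_of_injective hL
  rwa [finrank_fintype_fun_eq_card, Fintype.card_coe] at this

/-- The projection of a block vector. -/
noncomputable def pairVector (O P : Finset (Fin 23)) : EuclideanSpace ℝ (Fin 23) :=
  WithLp.toLp 2 fun j => (if j ∈ P then 1 else 0) - (1 / 4 : ℝ) * (if j ∈ O then 1 else 0)

lemma pairVector_mem {O A P : Finset (Fin 23)} (hO : O.card = 8) (hP : P ⊆ O) (hPc : P.card = 2)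
    (hA : A ⊆ O) (hPA : Disjoint P A ∨ A ⊆ P) : pairVector O P ∈ octadSpace O A := by
  refine ⟨fun j hj => ?_, ?_, fun i hi j hj => ?_⟩
  · have : j ∉ P := fun hh => hj (hP hh)
    simp [pairVector, hj, this]
  · simp only [pairVector, Finset.sum_sub_distrib, ← Finset.mul_sum, Finset.sum_boole,
      Finset.filter_univ_mem, hO, hPc]
    norm_num
  · simp only [pairVector, hA hi, hA hj]
    rcases hPA with hd | hs
    · simp [Finset.disjoint_right.1 hd hi, Finset.disjoint_right.1 hd hj]
    · simp [hs hi, hs hj]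

lemma inner_pairVector {O P Q : Finset (Fin 23)} (hO : O.card = 8) (hP : P ⊆ O) (hPc : P.card = 2)
    (hQ : Q ⊆ O) (hQc : Q.card = 2) :
    inner ℝ (pairVector O P) (pairVector O Q) = ((P ∩ Q).card - 1 / 2 : ℝ) := by
  have h1 : ∀ j : Fin 23, ((if j ∈ P then 1 else 0) - (1 / 4 : ℝ) * (if j ∈ O then 1 else 0)) *
      ((if j ∈ Q then 1 else 0) - (1 / 4 : ℝ) * (if j ∈ O then 1 else 0)) =
      (if j ∈ P ∩ Q then 1 else 0) - 1 / 4 * (if j ∈ P then 1 else 0) -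
        1 / 4 * (if j ∈ Q then 1 else 0) + 1 / 16 * (if j ∈ O then 1 else 0) := by
    intro j
    by_cases e1 : j ∈ O
    · by_cases e2 : j ∈ P <;> by_cases e3 : j ∈ Q <;> simp [e1, e2, e3] <;> norm_num
    · have e2 : j ∉ P := fun hh => e1 (hP hh)
      have e3 : j ∉ Q := fun hh => e1 (hQ hh)
      simp [e1, e2, e3]
  rw [PiLp.inner_apply]
  simp only [RCLike.inner_apply, conj_trivial, pairVector]
  simp_rw [mul_comm ((if _ ∈ Q then (1 : ℝ) else 0) - _), h1, Finset.sum_add_distrib,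
    Finset.sum_sub_distrib, ← Finset.mul_sum, Finset.sum_boole, Finset.filter_univ_mem, hO, hPc,
    hQc]
  push_cast
  ring

lemma abs_inner_pairVector {O P Q : Finset (Fin 23)} (hO : O.card = 8) (hP : P ⊆ O)
    (hPc : P.card = 2) (hQ : Q ⊆ O) (hQc : Q.card = 2) (hne : P ≠ Q) :
    |inner ℝ (pairVector O P) (pairVector O Q)| = (1 / 3 * (3 / 2) : ℝ) := by
  rw [inner_pairVector hO hP hPc hQ hQc]
  have hlt : (P ∩ Q).card < 2 := by
    by_contra hc
    have h1 := Finset.eq_of_subset_of_card_le (Finset.inter_subset_left (s₁ := P) (s₂ := Q))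
      (by omega)
    exact hne (Finset.eq_of_subset_of_card_le (Finset.inter_eq_left.1 h1) (by omega))
  interval_cases (P ∩ Q).card <;> norm_num [abs_of_neg]

/-- On `O` the block vector and `23 • pairVector O P` differ by a constant, and constants on `O` are
orthogonal to sum-zero vectors supported on `O`. -/
lemma orthogonalProjectionOnto_blockVector {O A P B : Finset (Fin 23)} (hO : O.card = 8)
    (hP : P ⊆ O) (hPc : P.card = 2) (hA : A ⊆ O) (hPA : Disjoint P A ∨ A ⊆ P) (hB : B ∩ O = P) :
    (octadSpace O A).orthogonalProjectionOnto (blockVector B) =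
      (23 : ℝ) • ⟨pairVector O P, pairVector_mem hO hP hPc hA hPA⟩ := by
  ext1
  rw [← Submodule.starProjection_apply]
  refine Submodule.eq_starProjection_of_mem_of_inner_eq_zero (Submodule.coe_mem _) ?_
  rintro w ⟨w1, w2, -⟩
  rw [PiLp.inner_apply]
  simp only [RCLike.inner_apply, conj_trivial]
  have h1 : ∀ j, w j * (blockVector B - ((23 : ℝ) • (⟨pairVector O P,
      pairVector_mem hO hP hPc hA hPA⟩ : octadSpace O A) : octadSpace O A)) j =
      (-7 + √3 + 23 / 4) * w j := by
    intro j
    by_cases hj : j ∈ O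
    · rw [mul_comm]
      congr 1
      have : j ∈ P ↔ j ∈ B := by rw [← hB]; simp [hj]
      simp only [blockVector, pairVector, Submodule.coe_smul, PiLp.sub_apply, PiLp.smul_apply, hj,
        this, smul_eq_mul, if_true]
      split_ifs <;> ring
    · rw [w1 j hj]; simp
  rw [Finset.sum_congr rfl fun j _ => h1 j, ← Finset.mul_sum, w2, mul_zero]

/-- The pairs off `A` number `C(5, 2) = 10` if `A` is a triple. If `A` is a pair, it joins the `C(6,
2)` pairs off it to make 16. If `A` is a point, all `C(8, 2) = 28` pairs qualify. -/
lemma exists_pairs {m c : ℕ} (hmc : IsGoodParameter m c) {O : Finset (Fin 23)} (hO : O.card = 8) :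
    ∃ (A : Finset (Fin 23)) (𝓟 : Finset (Finset (Fin 23))), A ⊆ O ∧ A.card = 4 - m ∧
      𝓟.card = 4 + 6 * c ∧ ∀ P ∈ 𝓟, P ⊆ O ∧ P.card = 2 ∧ (Disjoint P A ∨ A ⊆ P) := by
  obtain ⟨A, hA, hAc⟩ := Finset.exists_subset_card_eq (show 4 - m ≤ O.card by omega)
  have hOA : (O \ A).card = 8 - (4 - m) := by rw [Finset.card_sdiff_of_subset hA, hO, hAc]
  have hdis : ∀ P ∈ (O \ A).powersetCard 2, P ⊆ O ∧ P.card = 2 ∧ (Disjoint P A ∨ A ⊆ P) := by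
    intro P hP
    rw [Finset.mem_powersetCard] at hP
    exact ⟨hP.1.trans Finset.sdiff_subset, hP.2, Or.inl (Finset.sdiff_disjoint.mono_left hP.1)⟩
  rcases hmc with ⟨rfl, rfl⟩ | ⟨rfl, rfl⟩ | ⟨rfl, rfl⟩
  · exact ⟨A, (O \ A).powersetCard 2, hA, hAc, by rw [Finset.card_powersetCard, hOA]; rfl, hdis⟩
  · refine ⟨A, insert A ((O \ A).powersetCard 2), hA, hAc, ?_, ?_⟩
    · rw [Finset.card_insert_of_notMem, Finset.card_powersetCard, hOA]
      · rfl
      · intro hmem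
        have h1 := (Finset.mem_powersetCard.1 hmem).1
        have h2 : A = ∅ := Finset.disjoint_self_iff_empty _ |>.1
          (Finset.sdiff_disjoint.mono_left h1)
        rw [h2] at hAc; simp at hAc
    · intro P hP
      rcases Finset.mem_insert.1 hP with rfl | hP
      · exact ⟨hA, hAc, Or.inr subset_rfl⟩
      · exact hdis P hP
  · obtain ⟨a, rfl⟩ := Finset.card_eq_one.1 hAc
    refine ⟨{a}, O.powersetCard 2, hA, hAc, by rw [Finset.card_powersetCard, hO]; rfl, ?_⟩
    intro P hP
    rw [Finset.mem_powersetCard] at hP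
    refine ⟨hP.1, hP.2, ?_⟩
    by_cases ha : a ∈ P
    · exact Or.inr (by simpa using ha)
    · exact Or.inl (by simpa using ha)

/-- In dimensions 5, 6 and 7, a maximum equiangular set is a projection of a part of the
Steiner lines. -/
lemma IsSteinerSystem.appearsAsProjection {𝓑 : Finset (Finset (Fin 23))}
    (h : IsSteinerSystem 4 7 23 𝓑) {m c : ℕ} (hmc : IsGoodParameter m c)
    {Λ : Set (Submodule ℝ (EuclideanSpace ℝ (Fin (m + 4))))} (hΛ : IsMaximumEquiangular Λ) :
    AppearsAsProjection Λ (steinerLines 𝓑) := by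
  obtain ⟨O, hO, hpair⟩ := h.exists_octad
  obtain ⟨A, 𝓟, hA, hAc, h𝓟c, h𝓟⟩ := exists_pairs hmc hO
  have hm3 : m < 4 := by rcases hmc with ⟨rfl, rfl⟩ | ⟨rfl, rfl⟩ | ⟨rfl, rfl⟩ <;> norm_num
  set U := octadSpace O A with hU
  let w : 𝓟 → U := fun P => ⟨pairVector O P,
    pairVector_mem hO (h𝓟 P P.2).1 (h𝓟 P P.2).2.1 hA (h𝓟 P P.2).2.2⟩
  have hw : IsEquiSystem (fun P => (√(3 / 2))⁻¹ • w P) (1 / 3) := by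
    refine IsEquiSystem.of_inner (by norm_num) (fun P => ?_) (fun P Q hPQ => ?_)
    · obtain ⟨h1, h2, -⟩ := h𝓟 P P.2
      rw [Submodule.coe_inner]
      simp only [w]
      rw [inner_pairVector hO h1 h2 h1 h2, Finset.inter_self, h2]; norm_num
    · obtain ⟨h1, h2, -⟩ := h𝓟 P P.2
      obtain ⟨h3, h4, -⟩ := h𝓟 Q Q.2
      rw [Submodule.coe_inner]
      exact abs_inner_pairVector hO h1 h2 h3 h4 fun hh => hPQ (Subtype.ext hh)
  have hspan : ∀ P, Submodule.span ℝ {(√(3 / 2))⁻¹ • w P} = Submodule.span ℝ {w P} := fun P =>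
    span_inv_sqrt_smul (by norm_num) _
  have hrank : finrank ℝ U = m + 4 := by
    refine le_antisymm ?_ ?_
    · refine (finrank_octadSpace_le hA (Finset.card_pos.1 (by omega))).trans ?_
      rw [Finset.card_sdiff_of_subset hA, hO, hAc]; omega
    -- The relative bound is attained by `4 + 6 c` lines at cosine `1 / 3` in dimension `m + 4`, so
    -- they need that dimension.
    · have := hw.relative_bound
      rw [Fintype.card_coe, h𝓟c] at this
      have h2 : (m + 4 : ℝ) ≤ finrank ℝ U := by
        rcases hmc with ⟨rfl, rfl⟩ | ⟨rfl, rfl⟩ | ⟨rfl, rfl⟩ <;> push_cast at this ⊢ <;> linarith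
      exact_mod_cast h2
  have hencard : ∀ {F : Type} [NormedAddCommGroup F] [InnerProductSpace ℝ F] {x : 𝓟 → F},
      IsEquiSystem x (1 / 3) → (4 + 6 * c : ℕ) ≤
        (Set.range fun P => Submodule.span ℝ {x P}).encard := by
    intro F _ _ x hx
    rw [← Set.image_univ, (hx.span_injective (by norm_num)).encard_image, Set.encard_univ,
      ENat.card_eq_coe_fintype_card, Fintype.card_coe, h𝓟c]
  -- The projected lines, carried to the ambient space of `Λ`, cannot outnumber `Λ`; both sets are
  -- then large enough for uniqueness.
  have hlarge : (4 + 6 * c : ℕ) ≤ Λ.encard := by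
    let ψ : U ≃ₗᵢ[ℝ] EuclideanSpace ℝ (Fin (m + 4)) :=
      ((stdOrthonormalBasis ℝ U).reindex (finCongr hrank)).repr
    have hψ : IsEquiSystem (fun P => ψ ((√(3 / 2))⁻¹ • w P)) (1 / 3) :=
      ⟨fun P => by rw [ψ.norm_map, hw.norm_eq],
        fun P Q hPQ => by rw [ψ.inner_map_map, hw.abs_inner P Q hPQ]⟩
    exact (hencard hψ).trans (hΛ.2 _ hψ.isEquiangular)
  obtain ⟨φ, hφ⟩ := hΛ.1.exists_isometry hmc (by simp) hrank hw.isEquiangular hlarge (hencard hw)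
  choose B hB𝓑 hB using fun P : 𝓟 => hpair P (h𝓟 P P.2).1 (h𝓟 P P.2).2.1
  refine ⟨Set.range fun P => Submodule.span ℝ {blockVector (B P)}, ?_, U, φ, ?_⟩
  · rintro _ ⟨P, rfl⟩
    exact Or.inl ⟨B P, hB𝓑 P, rfl⟩
  · rw [hφ, ← Set.range_comp]
    congr 1
    funext P
    rw [hspan, Function.comp_apply, Submodule.map_span, Set.image_singleton]
    have := orthogonalProjectionOnto_blockVector hO (h𝓟 P P.2).1 (h𝓟 P P.2).2.1 hA (h𝓟 P P.2).2.2
      (hB P)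
    rw [ContinuousLinearMap.coe_coe, this]
    exact Submodule.span_singleton_smul_eq (IsUnit.mk0 _ (by norm_num)) _

end partTwo

/-! ### Dividing the complement of a block into eight pairs. -/

section pairing

open scoped symmDiff

lemma card_symmDiff_add {α : Type*} [DecidableEq α] (s t : Finset α) :
    (s ∆ t).card + 2 * (s ∩ t).card = s.card + t.card := by
  have h1 : s ∆ t = (s \ t) ∪ (t \ s) := rfl
  have h2 : Disjoint (s \ t) (t \ s) :=
    Finset.disjoint_left.2 fun a ha hb => (Finset.mem_sdiff.1 ha).2 (Finset.mem_sdiff.1 hb).1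
  have h3 := Finset.card_sdiff_add_card_inter s t
  have h4 := Finset.card_sdiff_add_card_inter t s
  rw [Finset.inter_comm] at h4
  rw [h1, Finset.card_union_of_disjoint h2]
  omega

/-- The traces outside the block `B₀` of the blocks that meet it in three points. -/
def quads (𝓑 : Finset (Finset (Fin 23))) (B₀ : Finset (Fin 23)) : Finset (Finset (Fin 23)) :=
  (𝓑.filter fun B => (B₀ ∩ B).card = 3).image (· \ B₀)

variable {𝓑 : Finset (Finset (Fin 23))} {B₀ : Finset (Fin 23)}

lemma mem_quads {F : Finset (Fin 23)} :
    F ∈ quads 𝓑 B₀ ↔ ∃ B ∈ 𝓑, (B₀ ∩ B).card = 3 ∧ B \ B₀ = F := by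
  simp [quads, and_assoc]

lemma disjoint_of_mem_quads {F : Finset (Fin 23)} (hF : F ∈ quads 𝓑 B₀) : Disjoint F B₀ := by
  obtain ⟨B, -, -, rfl⟩ := mem_quads.1 hF
  exact Finset.sdiff_disjoint

variable (h : IsSteinerSystem 4 7 23 𝓑) (h₀ : B₀ ∈ 𝓑)

include h

lemma IsSteinerSystem.card_of_mem_quads {F : Finset (Fin 23)} (hF : F ∈ quads 𝓑 B₀) :
    F.card = 4 := by
  obtain ⟨B, hB, hc, rfl⟩ := mem_quads.1 hF
  have := Finset.card_sdiff_add_card_inter B B₀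
  rw [Finset.inter_comm, hc, h.1 B hB] at this
  omega

include h₀

/-- Three points outside a block are in a unique quad. -/
lemma IsSteinerSystem.exists_quad {A : Finset (Fin 23)} (hA : A.card = 3) (hd : Disjoint A B₀) :
    ∃ B ∈ 𝓑, (B₀ ∩ B).card = 3 ∧ A ⊆ B ∧
      ∀ B' ∈ 𝓑, (B₀ ∩ B').card = 3 → A ⊆ B' → B' = B := by
  have s0 := h.card_through (P := A) (by omega)
  have s1 := h.sum_choose hd (j := 1) (by omega)
  rw [hA] at s0
  rw [hA, h.1 B₀ h₀] at s1
  -- The five blocks through `A` meet `B₀` in 1 or 3 points each and in 7 points altogether, so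
  -- exactly one of them meets it in 3.
  have hsum : ∑ B ∈ blocksThrough 𝓑 A, (B₀ ∩ B).card.choose 1 = (blocksThrough 𝓑 A).card +
      2 * ((blocksThrough 𝓑 A).filter fun B => (B₀ ∩ B).card = 3).card := by
    rw [Finset.card_eq_sum_ones, Finset.card_filter, Finset.mul_sum, ← Finset.sum_add_distrib]
    refine Finset.sum_congr rfl fun B hB => ?_
    rw [mem_blocksThrough] at hB
    have hne : B₀ ≠ B := by
      rintro rfl
      rw [Finset.disjoint_of_subset_iff_left_eq_empty hB.2] at hd
      rw [hd] at hA; simp at hA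
    rcases h.card_inter h₀ hB.1 hne with h1 | h1 <;> rw [h1] <;> rfl
  rw [s0, s1] at hsum
  have h1 : ((blocksThrough 𝓑 A).filter fun B => (B₀ ∩ B).card = 3).card = 1 := by
    norm_num at hsum; omega
  obtain ⟨B, hB⟩ := Finset.card_eq_one.1 h1
  have hmem : ∀ B', (B' ∈ 𝓑 ∧ A ⊆ B') ∧ (B₀ ∩ B').card = 3 ↔ B' = B := fun B' => by
    rw [← mem_blocksThrough, ← Finset.mem_singleton (a := B) (b := B'), ← hB, Finset.mem_filter]
  obtain ⟨⟨h2, h3⟩, h4⟩ := (hmem B).2 rfl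
  exact ⟨B, h2, h4, h3, fun B' g1 g2 g3 => (hmem B').1 ⟨⟨g1, g3⟩, g2⟩⟩

/-- A third common point would put three points into two quads, against the uniqueness in
`exists_quad`. -/
lemma IsSteinerSystem.quads_inter {F₁ F₂ p : Finset (Fin 23)} (h₁ : F₁ ∈ quads 𝓑 B₀)
    (h₂ : F₂ ∈ quads 𝓑 B₀) (hne : F₁ ≠ F₂) (hp : p.card = 2) (hp₁ : p ⊆ F₁) (hp₂ : p ⊆ F₂) :
    F₁ ∩ F₂ = p := by
  refine (Finset.eq_of_subset_of_card_le (Finset.subset_inter hp₁ hp₂) ?_).symm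
  by_contra hc
  obtain ⟨A, hA, hAc⟩ := Finset.exists_subset_card_eq (show 3 ≤ (F₁ ∩ F₂).card by omega)
  rw [Finset.subset_inter_iff] at hA
  obtain ⟨B, -, -, -, hu⟩ := h.exists_quad h₀ hAc ((disjoint_of_mem_quads h₁).mono_left hA.1)
  obtain ⟨B₁, g1, g2, rfl⟩ := mem_quads.1 h₁
  obtain ⟨B₂, k1, k2, rfl⟩ := mem_quads.1 h₂
  apply hne
  rw [hu B₁ g1 g2 (hA.1.trans Finset.sdiff_subset), hu B₂ k1 k2 (hA.2.trans Finset.sdiff_subset)]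

/-- The set `B₁ ∆ B₂ ∆ B₀` meets every block oddly and has `8 + 7 - 2 · 4 = 7` points, so it is a
block by `mem_of_odd`; its trace off `B₀` is the required set. -/
lemma IsSteinerSystem.union_mem_quads {F₁ F₂ p : Finset (Fin 23)} (h₁ : F₁ ∈ quads 𝓑 B₀)
    (h₂ : F₂ ∈ quads 𝓑 B₀) (hne : F₁ ≠ F₂) (hp : p.card = 2) (hp₁ : p ⊆ F₁) (hp₂ : p ⊆ F₂) :
    (F₁ \ p) ∪ (F₂ \ p) ∈ quads 𝓑 B₀ := by
  have hinter := h.quads_inter h₀ h₁ h₂ hne hp hp₁ hp₂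
  have hF₁ := h.card_of_mem_quads h₁
  have hF₂ := h.card_of_mem_quads h₂
  obtain ⟨B₁, g1, g2, g3⟩ := mem_quads.1 h₁
  obtain ⟨B₂, k1, k2, k3⟩ := mem_quads.1 h₂
  have hB : B₁ ≠ B₂ := by rintro rfl; exact hne (g3.symm.trans k3)
  have hsub : p ⊆ B₁ ∩ B₂ := Finset.subset_inter (hp₁.trans (g3 ▸ Finset.sdiff_subset))
    (hp₂.trans (k3 ▸ Finset.sdiff_subset))
  have h3 : (B₁ ∩ B₂).card = 3 := by
    have := Finset.card_le_card hsub
    rcases h.card_inter g1 k1 hB with h4 | h4 <;> omega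
  have hin : ((B₁ ∩ B₂) \ B₀) = p := by
    rw [← hinter, ← g3, ← k3]; ext a
    simp only [Finset.mem_inter, Finset.mem_sdiff]; tauto
  have h1 : ((B₀ ∩ B₁) ∩ (B₀ ∩ B₂)).card = 1 := by
    have e1 := Finset.card_sdiff_add_card_inter (B₁ ∩ B₂) B₀
    have e2 : (B₀ ∩ B₁) ∩ (B₀ ∩ B₂) = (B₁ ∩ B₂) ∩ B₀ := by
      ext a; simp only [Finset.mem_inter]; tauto
    rw [hin, hp, h3] at e1
    rw [e2]; omega
  set Y := (B₁ ∆ B₂) ∆ B₀ with hY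
  have hodd : ∀ B ∈ 𝓑, Odd (Y ∩ B).card := by
    intro B hB
    have o1 := h.odd_inter g1 hB
    have o2 := h.odd_inter k1 hB
    have o3 := h.odd_inter h₀ hB
    have e1 : Y ∩ B = ((B₁ ∩ B) ∆ (B₂ ∩ B)) ∆ (B₀ ∩ B) := by
      ext a; simp only [hY, Finset.mem_inter, Finset.mem_symmDiff]; tauto
    have e2 := card_symmDiff_add (B₁ ∩ B) (B₂ ∩ B)
    have e3 := card_symmDiff_add ((B₁ ∩ B) ∆ (B₂ ∩ B)) (B₀ ∩ B)
    rw [e1]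
    rw [Nat.odd_iff] at o1 o2 o3 ⊢
    omega
  have hYc : Y.card = 7 := by
    have e1 := card_symmDiff_add B₁ B₂
    have e2 := card_symmDiff_add (B₁ ∆ B₂) B₀
    have e3 : (B₁ ∆ B₂) ∩ B₀ = (B₀ ∩ B₁) ∆ (B₀ ∩ B₂) := by
      ext a; simp only [Finset.mem_inter, Finset.mem_symmDiff]; tauto
    have e4 := card_symmDiff_add (B₀ ∩ B₁) (B₀ ∩ B₂)
    rw [h.1 B₁ g1, h.1 B₂ k1, h3] at e1
    rw [h.1 B₀ h₀, e3] at e2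
    rw [g2, k2, h1] at e4
    rw [hY]; omega
  have hYB : Y ∈ 𝓑 := h.mem_of_odd hYc hodd
  have hout : Y \ B₀ = (F₁ \ p) ∪ (F₂ \ p) := by
    rw [← hinter, ← g3, ← k3]; ext a
    simp only [hY, Finset.mem_inter, Finset.mem_sdiff, Finset.mem_symmDiff, Finset.mem_union]
    tauto
  refine mem_quads.2 ⟨Y, hYB, ?_, hout⟩
  have e1 := Finset.card_sdiff_add_card_inter Y B₀
  have e2 : Disjoint (F₁ \ p) (F₂ \ p) := by
    refine Finset.disjoint_left.2 fun a ha hb => ?_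
    rw [Finset.mem_sdiff] at ha hb
    exact ha.2 (hinter ▸ Finset.mem_inter.2 ⟨ha.1, hb.1⟩)
  rw [hout, Finset.card_union_of_disjoint e2, Finset.card_sdiff_of_subset hp₁,
    Finset.card_sdiff_of_subset hp₂, hF₁, hF₂, hp, hYc] at e1
  rw [Finset.inter_comm]
  omega

/-- The complement of a block is divided into eight pairs, such that the union of any two of them
is a quad. -/
lemma IsSteinerSystem.exists_pairing : ∃ 𝓟 : Finset (Finset (Fin 23)), 𝓟.card = 8 ∧
    (∀ C ∈ 𝓟, C.card = 2 ∧ Disjoint C B₀) ∧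
    (∀ C ∈ 𝓟, ∀ C' ∈ 𝓟, C ≠ C' → Disjoint C C' ∧ C ∪ C' ∈ quads 𝓑 B₀) ∧
    ∀ x, x ∉ B₀ → ∃ C ∈ 𝓟, x ∈ C := by
  have hcomp : (B₀ᶜ).card = 16 := by
    rw [Finset.card_compl, h.1 B₀ h₀]; rfl
  obtain ⟨p, hp, hpc⟩ := Finset.exists_subset_card_eq (show 2 ≤ (B₀ᶜ).card by omega)
  have hpd : Disjoint p B₀ := Finset.disjoint_left.2 fun a ha => Finset.mem_compl.1 (hp ha)
  -- As with a parallel class of lines in an affine space over two elements, a single pair `p`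
  -- determines the others: they complete it to quads.
  set 𝓟 : Finset (Finset (Fin 23)) :=
    insert p (((quads 𝓑 B₀).filter (p ⊆ ·)).image (· \ p)) with h𝓟
  have hmem : ∀ C, C ∈ 𝓟 ↔ C = p ∨ ∃ F ∈ quads 𝓑 B₀, p ⊆ F ∧ F \ p = C := by
    intro C; simp [h𝓟, and_assoc]
  have h1 : ∀ C ∈ 𝓟, C.card = 2 ∧ Disjoint C B₀ := by
    intro C hC
    rcases (hmem C).1 hC with rfl | ⟨F, hF, hpF, rfl⟩
    · exact ⟨hpc, hpd⟩
    · refine ⟨?_, (disjoint_of_mem_quads hF).mono_left Finset.sdiff_subset⟩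
      rw [Finset.card_sdiff_of_subset hpF, h.card_of_mem_quads hF, hpc]
  have h2 : ∀ C ∈ 𝓟, ∀ C' ∈ 𝓟, C ≠ C' → Disjoint C C' ∧ C ∪ C' ∈ quads 𝓑 B₀ := by
    intro C hC C' hC' hne
    rcases (hmem C).1 hC with rfl | ⟨F, hF, hpF, rfl⟩ <;>
      rcases (hmem C').1 hC' with rfl | ⟨F', hF', hpF', rfl⟩
    · exact absurd rfl hne
    · exact ⟨Finset.disjoint_sdiff, by rwa [Finset.union_sdiff_of_subset hpF']⟩
    · exact ⟨Finset.sdiff_disjoint, by rwa [Finset.sdiff_union_of_subset hpF]⟩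
    · have hFF : F ≠ F' := by rintro rfl; exact hne rfl
      refine ⟨Finset.disjoint_left.2 fun a ha hb => ?_,
        h.union_mem_quads h₀ hF hF' hFF hpc hpF hpF'⟩
      rw [Finset.mem_sdiff] at ha hb
      exact ha.2 (h.quads_inter h₀ hF hF' hFF hpc hpF hpF' ▸ Finset.mem_inter.2 ⟨ha.1, hb.1⟩)
  have h3 : ∀ x, x ∉ B₀ → ∃ C ∈ 𝓟, x ∈ C := by
    intro x hx
    by_cases hxp : x ∈ p
    · exact ⟨p, (hmem p).2 (Or.inl rfl), hxp⟩
    · obtain ⟨B, hB, hB3, hAB, -⟩ := h.exists_quad h₀ (A := insert x p)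
        (by rw [Finset.card_insert_of_notMem hxp, hpc])
        (by rw [Finset.disjoint_insert_left]; exact ⟨hx, hpd⟩)
      refine ⟨(B \ B₀) \ p, (hmem _).2 (Or.inr ⟨B \ B₀, mem_quads.2 ⟨B, hB, hB3, rfl⟩, ?_, rfl⟩), ?_⟩
      · intro a ha
        exact Finset.mem_sdiff.2 ⟨hAB (Finset.mem_insert_of_mem ha), Finset.disjoint_left.1 hpd ha⟩
      · simp only [Finset.mem_sdiff]
        exact ⟨⟨hAB (Finset.mem_insert_self _ _), hx⟩, hxp⟩
  refine ⟨𝓟, ?_, h1, h2, h3⟩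
  have hU : 𝓟.biUnion id = B₀ᶜ := by
    ext x
    simp only [Finset.mem_biUnion, id, Finset.mem_compl]
    exact ⟨fun ⟨C, hC, hx⟩ => Finset.disjoint_left.1 (h1 C hC).2 hx, h3 x⟩
  have hc := Finset.card_biUnion (s := 𝓟) (t := id) fun C hC C' hC' hne => (h2 C hC C' hC' hne).1
  have h2' : ∑ C ∈ 𝓟, (id C).card = ∑ _C ∈ 𝓟, 2 := Finset.sum_congr rfl fun C hC => (h1 C hC).1
  rw [hU, hcomp, h2', Finset.sum_const, smul_eq_mul] at hc
  omega

/-- The blocks that are unions of pairs outside `B₀`. -/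
lemma IsSteinerSystem.card_saturated_blocks {𝓟 : Finset (Finset (Fin 23))} (hc : 𝓟.card = 8)
    (h1 : ∀ C ∈ 𝓟, C.card = 2 ∧ Disjoint C B₀)
    (h2 : ∀ C ∈ 𝓟, ∀ C' ∈ 𝓟, C ≠ C' → Disjoint C C' ∧ C ∪ C' ∈ quads 𝓑 B₀) :
    29 ≤ (𝓑.filter fun B => ∀ C ∈ 𝓟, C ⊆ B ∨ Disjoint C B).card := by
  set 𝓢 := 𝓑.filter fun B => ∀ C ∈ 𝓟, C ⊆ B ∨ Disjoint C B with h𝓢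
  have h₀𝓢 : B₀ ∈ 𝓢 := Finset.mem_filter.2 ⟨h₀, fun C hC => Or.inr (h1 C hC).2⟩
  have hex : ∀ R ∈ 𝓟.powersetCard 2, ∃ B ∈ 𝓢.erase B₀, 𝓟.filter (· ⊆ B) = R := by
    intro R hR
    rw [Finset.mem_powersetCard] at hR
    obtain ⟨C, C', hne, rfl⟩ := Finset.card_eq_two.1 hR.2
    have hC : C ∈ 𝓟 := hR.1 (by simp)
    have hC' : C' ∈ 𝓟 := hR.1 (by simp)
    obtain ⟨B, hB, hB3, hBF⟩ := mem_quads.1 (h2 C hC C' hC' hne).2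
    have hout : ∀ a, a ∉ B₀ → (a ∈ B ↔ a ∈ C ∨ a ∈ C') := fun a ha => by
      rw [← Finset.mem_union, ← hBF, Finset.mem_sdiff]; tauto
    have hsub : ∀ D ∈ 𝓟, (D = C ∨ D = C') → D ⊆ B := by
      intro D hD hDC a ha
      rw [hout a (Finset.disjoint_left.1 (h1 D hD).2 ha)]
      rcases hDC with rfl | rfl
      · exact Or.inl ha
      · exact Or.inr ha
    have hdis : ∀ D ∈ 𝓟, D ≠ C → D ≠ C' → Disjoint D B := by
      intro D hD hDC hDC'
      refine Finset.disjoint_left.2 fun a ha hb => ?_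
      rw [hout a (Finset.disjoint_left.1 (h1 D hD).2 ha)] at hb
      rcases hb with hb | hb
      · exact Finset.disjoint_left.1 (h2 D hD C hC hDC).1 ha hb
      · exact Finset.disjoint_left.1 (h2 D hD C' hC' hDC').1 ha hb
    refine ⟨B, Finset.mem_erase.2 ⟨?_, Finset.mem_filter.2 ⟨hB, fun D hD => ?_⟩⟩, ?_⟩
    · rintro rfl
      rw [Finset.inter_self, h.1 B hB] at hB3
      omega
    · by_cases hDC : D = C ∨ D = C'
      · exact Or.inl (hsub D hD hDC)
      · push Not at hDC
        exact Or.inr (hdis D hD hDC.1 hDC.2)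
    · ext D
      simp only [Finset.mem_filter, Finset.mem_insert, Finset.mem_singleton]
      constructor
      · rintro ⟨hD, hDB⟩
        by_contra hDC
        push Not at hDC
        have := (hdis D hD hDC.1 hDC.2)
        rw [Finset.disjoint_of_subset_iff_left_eq_empty hDB] at this
        have hD2 := (h1 D hD).1
        rw [this] at hD2; simp at hD2
      · intro hDC
        have hD : D ∈ 𝓟 := by rcases hDC with rfl | rfl <;> assumption
        exact ⟨hD, hsub D hD hDC⟩
  -- Each of the `C(8, 2) = 28` choices of two pairs comes from a block other than `B₀`, which
  -- itself contains none of the pairs.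
  have hle : (𝓟.powersetCard 2).card ≤ (𝓢.erase B₀).card := by
    refine Finset.card_le_card_of_surjOn (fun B => 𝓟.filter (· ⊆ B)) fun R hR => ?_
    obtain ⟨B, hB, hBR⟩ := hex R hR
    exact ⟨B, hB, hBR⟩
  rw [Finset.card_powersetCard, hc, Finset.card_erase_of_mem h₀𝓢] at hle
  norm_num [Nat.choose] at hle
  omega

end pairing

/-! ### The 36 lines in dimension 15. -/

section partThree

/-- Vectors that are constant on the members of `𝓟`. -/
def pairSpace (𝓟 : Finset (Finset (Fin 23))) : Submodule ℝ (EuclideanSpace ℝ (Fin 23)) where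
  carrier := {u | ∀ C ∈ 𝓟, ∀ i ∈ C, ∀ j ∈ C, u i = u j}
  zero_mem' := fun _ _ _ _ _ _ => rfl
  add_mem' := by
    intro u v hu hv C hC i hi j hj
    rw [PiLp.add_apply, PiLp.add_apply, hu C hC i hi j hj, hv C hC i hi j hj]
  smul_mem' := by
    intro c u hu C hC i hi j hj
    rw [PiLp.smul_apply, PiLp.smul_apply, hu C hC i hi j hj]

/-- A vector constant on the pairs is determined by its coordinates on `B₀` and at one
representative of each pair. -/
lemma finrank_pairSpace_le {B₀ : Finset (Fin 23)} {𝓟 : Finset (Finset (Fin 23))}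
    (h3 : ∀ x, x ∉ B₀ → ∃ C ∈ 𝓟, x ∈ C) :
    finrank ℝ (pairSpace 𝓟) ≤ B₀.card + 𝓟.card := by
  classical
  -- The default 0 serves an empty member only; injectivity uses members that contain a given point.
  let rep : 𝓟 → Fin 23 := fun C =>
    if hC : (C : Finset (Fin 23)).Nonempty then hC.choose else 0
  let L : pairSpace 𝓟 →ₗ[ℝ] (B₀ ⊕ 𝓟 → ℝ) :=
    { toFun := fun u => Sum.elim (fun j => (u : EuclideanSpace ℝ (Fin 23)) j)
        fun C => (u : EuclideanSpace ℝ (Fin 23)) (rep C)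
      map_add' := fun _ _ => by ext (i | i) <;> rfl
      map_smul' := fun _ _ => by ext (i | i) <;> rfl }
  have hL : Function.Injective L := by
    rw [injective_iff_map_eq_zero]
    rintro ⟨u, hu⟩ h0
    ext j
    change u j = 0
    by_cases hj : j ∈ B₀
    · exact congrFun h0 (Sum.inl ⟨j, hj⟩)
    · obtain ⟨C, hC, hjC⟩ := h3 j hj
      have h1 : u (rep ⟨C, hC⟩) = 0 := congrFun h0 (Sum.inr ⟨C, hC⟩)
      have h2 : rep ⟨C, hC⟩ ∈ C := by
        have hne : C.Nonempty := ⟨j, hjC⟩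
        simp only [rep, dif_pos hne]
        exact hne.choose_spec
      rw [hu C hC j hjC _ h2, h1]
  have := LinearMap.finrank_le_finrank_of_injective hL
  rwa [finrank_fintype_fun_eq_card, Fintype.card_sum, Fintype.card_coe, Fintype.card_coe] at this

/-- Some maximum equiangular set in dimension 15 is a part of the Steiner lines. -/
lemma IsSteinerSystem.exists_fifteen {𝓑 : Finset (Finset (Fin 23))}
    (h : IsSteinerSystem 4 7 23 𝓑) :
    ∃ Λ : Set (Submodule ℝ (EuclideanSpace ℝ (Fin 15))), IsMaximumEquiangular Λ ∧
      Λ.encard = 36 ∧ AppearsAsSubset Λ (steinerLines 𝓑) := by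
  obtain ⟨B₀, h₀⟩ : 𝓑.Nonempty := Finset.card_pos.1 (by rw [h.card_eq]; norm_num)
  obtain ⟨𝓟, hc, h1, h2, h3⟩ := h.exists_pairing h₀
  have h29 := h.card_saturated_blocks h₀ hc h1 h2
  set 𝓢 := 𝓑.filter fun B => ∀ C ∈ 𝓟, C ⊆ B ∨ Disjoint C B with h𝓢
  let f : 𝓢 ⊕ B₀ → 𝓑 ⊕ Fin 23 :=
    Sum.map (fun B => ⟨B, (Finset.mem_filter.1 B.2).1⟩) Subtype.val
  have hf : Function.Injective f := Function.Injective.sumMap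
    (fun B B' hB => Subtype.ext (Subtype.mk.inj hB)) Subtype.val_injective
  have hmem : ∀ i, steinerVector 𝓑 (f i) ∈ pairSpace 𝓟 := by
    rintro (B | i) C hC j hj k hk
    · simp only [f, Sum.map_inl, steinerVector, Sum.elim_inl, blockVector]
      rcases (Finset.mem_filter.1 B.2).2 C hC with hs | hd
      · rw [if_pos (hs hj), if_pos (hs hk)]
      · rw [if_neg (Finset.disjoint_left.1 hd hj), if_neg (Finset.disjoint_left.1 hd hk)]
    · simp only [f, Sum.map_inr, steinerVector, Sum.elim_inr, pointVector]
      have hne : ∀ a ∈ C, a ≠ (i : Fin 23) := by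
        rintro a ha rfl
        exact Finset.disjoint_left.1 (h1 C hC).2 ha i.2
      rw [if_neg (hne j hj), if_neg (hne k hk)]
  let W := pairSpace 𝓟
  let w : 𝓢 ⊕ B₀ → W := fun i => ⟨steinerVector 𝓑 (f i), hmem i⟩
  have hw : IsEquiSystem (fun i => (√2645)⁻¹ • w i) (1 / 5) :=
    IsEquiSystem.of_inner (by norm_num) (fun i => h.inner_self_steinerVector (f i))
      fun i j hij => h.abs_inner_steinerVector (hf.ne hij)
  have hcard : 36 ≤ Fintype.card (𝓢 ⊕ B₀) := by
    rw [Fintype.card_sum, Fintype.card_coe, Fintype.card_coe, h.1 B₀ h₀]; omega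
  have hrank : finrank ℝ W = 15 := by
    refine le_antisymm ?_ ?_
    · have := finrank_pairSpace_le h3
      rwa [h.1 B₀ h₀, hc] at this
    -- In dimension at most 14 the relative bound at cosine `1 / 5` allows fewer than 36 lines.
    · have h4 := hw.relative_bound
      have h5 : (36 : ℝ) ≤ Fintype.card (𝓢 ⊕ B₀) := by exact_mod_cast hcard
      by_contra hlt
      have h6 : (finrank ℝ W : ℝ) ≤ 14 := by exact_mod_cast (by omega : finrank ℝ W ≤ 14)
      nlinarith
  let φ : EuclideanSpace ℝ (Fin 15) ≃ₗᵢ[ℝ] W :=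
    (((stdOrthonormalBasis ℝ W).reindex (finCongr hrank)).repr).symm
  have hx : IsEquiSystem (fun i => φ.symm ((√2645)⁻¹ • w i)) (1 / 5) :=
    ⟨fun i => by rw [φ.symm.norm_map, hw.norm_eq],
      fun i j hij => by rw [φ.symm.inner_map_map, hw.abs_inner i j hij]⟩
  have hle : ∀ Ω' : Set (Submodule ℝ (EuclideanSpace ℝ (Fin 15))), IsEquiangular Ω' →
      Ω'.encard ≤ 36 := fun Ω' hΩ' =>
    hΩ'.encard_le 36 fun κ x h0 h1 hx => hx.false_of_fifteen (by simp) h0 h1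
  have hencard : (Set.range fun i => Submodule.span ℝ {φ.symm ((√2645)⁻¹ • w i)}).encard = 36 := by
    refine le_antisymm (hle _ hx.isEquiangular) ?_
    rw [← Set.image_univ, (hx.span_injective (by norm_num)).encard_image, Set.encard_univ,
      ENat.card_eq_coe_fintype_card]
    exact_mod_cast hcard
  refine ⟨_, ⟨hx.isEquiangular, fun Ω' hΩ' => hencard.symm ▸ hle Ω' hΩ'⟩, hencard,
    W.subtypeₗᵢ.comp φ.toLinearIsometry, ?_⟩
  rintro _ ⟨_, ⟨i, rfl⟩, rfl⟩
  rw [steinerLines_eq_range]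
  refine ⟨f i, ?_⟩
  simp only
  rw [Submodule.map_span, Set.image_singleton]
  have : (W.subtypeₗᵢ.comp φ.toLinearIsometry).toLinearMap (φ.symm ((√2645)⁻¹ • w i)) =
      (√2645)⁻¹ • steinerVector 𝓑 (f i) := by
    simp [w]
  rw [this, span_inv_sqrt_smul (by norm_num)]

end partThree

theorem mainTheorem11 (𝓑 : Finset (Finset (Fin 23))) (h𝓑 : IsSteinerSystem 4 7 23 𝓑) :
    (IsMaximumEquiangular (steinerLines 𝓑) ∧ (steinerLines 𝓑).encard = 276) ∧
    (∀ d : ℕ, d = 5 ∨ d = 6 ∨ d = 7 →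
      ∀ Λ : Set (Submodule ℝ (EuclideanSpace ℝ (Fin d))), IsMaximumEquiangular Λ →
        AppearsAsProjection Λ (steinerLines 𝓑)) ∧
    (∃ Λ : Set (Submodule ℝ (EuclideanSpace ℝ (Fin 15))), IsMaximumEquiangular Λ ∧
      Λ.encard = 36 ∧ AppearsAsSubset Λ (steinerLines 𝓑)) := by
  refine ⟨⟨h𝓑.isMaximumEquiangular_steinerLines, h𝓑.encard_steinerLines⟩, ?_, h𝓑.exists_fifteen⟩
  rintro d (rfl | rfl | rfl) Λ hΛ
  · exact h𝓑.appearsAsProjection (m := 1) (c := 1) (Or.inl ⟨rfl, rfl⟩) hΛ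
  · exact h𝓑.appearsAsProjection (m := 2) (c := 2) (Or.inr (Or.inl ⟨rfl, rfl⟩)) hΛ
  · exact h𝓑.appearsAsProjection (m := 3) (c := 4) (Or.inr (Or.inr ⟨rfl, rfl⟩)) hΛ
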